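/- **Setting.** Let $(\deg \mathbf e_a)_{a\in I}$ be a family of integers, and let $\mathcal H$ be the graded complex vector space with homogeneous basis $\{\mathbf e_a,\mathbf e_a^*\}_{a\in I}$, $\deg\mathbf e_a^*=1-\deg\mathbf e_a$, with the odd symplectic form $-\omega(\mathbf e_a,\mathbf e_b^*)=\omega(\mathbf e_b^*,\mathbf e_a)=\delta_{ab}$, $\omega(\mathbf e_a,\mathbf e_b)=\omega(\mathbf e_a^*,\mathbf e_b^*)=0$. Write $\{\mathbf e_i\}$ for the whole basis, $\phi^i$ for the dual coordinates, $(-1)^i$ for $(-1)^{\deg \mathbf e_i}$, $\omega_{ij}=\omega(\mathbf e_i,\mathbf e_j)$, $(\omega^{ij})$ for the inverse matrix. Let $$S=\tfrac12\mathcal V_{i_1i_2}\phi^{i_2}\phi^{i_1}+\sum_{k\ge3}\tfrac1k\mathcal V_{i_1\cdots i_k}\phi^{i_k}\cdots\phi^{i_1}$$ be a cyclic field theory: $\mathcal V_{i_1\cdots i_k}\in\mathbb C$ vanishes unless $\deg \mathbf e_{i_1}+\dots+\deg \mathbf e_{i_k}=0$, $\mathcal V_{i_1\cdots i_k}=(-1)^{(i_2+\cdots+i_k)i_1}\mathcal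 V_{i_2\cdots i_ki_1}$, and (automatic if $I$ is finite) for fixed $i_2,\dots,i_k$ only finitely many $\mathcal V_{i_1i_2\cdots i_k}$ are nonzero. Assume the classical BV master equation $(S,S)=0$ for the constant odd Poisson bracket $(\ ,\ )=\frac{\overleftarrow\partial}{\partial\phi^i}\omega^{ij}\frac{\overrightarrow\partial}{\partial\phi^j}$ on cyclic functions: for all $n\ge 1$ and $i_1,\dots,i_n$, the signed sum (with Koszul signs) over the cyclic rotations $u_1\cdots u_n$ of $i_1\cdots i_n$ of $\sum_{s=1}^{n-1}\sum_{i,j}\mathcal V_{i\,u_{s+1}\cdots u_n}\,\omega^{ij}\,\mathcal V_{u_1\cdots u_s\,j}$ is zero. Let $m_k(\mathbf e_{i_1},\dots,\mathbf e_{i_k})=\sum_{j,l}\mathbf e_j(-1)^{l}\omega^{jl}\mathcal V_{l i_1\cdots i_k}$ and $Q=m_1$. Assume that coordinates are chosen such that the gauge condition is $\phi^*_a=0$, and that the action is proper: with respect to $\mathcal H=\mathcal H_+\oplus\mathcal H_-$, $\mathcal H_+=\langle\mathbf e_a\rangle$, $\mathcal H_-=\langle\mathbf e_a^*\rangle$,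 there is a degree zero map $T=\begin{pmatrix}1&t\\0&1\end{pmatrix}$ preserving $\omega$ with $Q=T^{-1}\begin{pmatrix}0&0\\c_3&0\end{pmatrix}T$, where $c_3$ is the $\mathcal H_+\to\mathcal H_-$ block of $Q$. Let $\mathcal V_{gf}$ be the matrix $(\omega(\mathbf e_a,Q\mathbf e_b))_{a,b\in I}$ and let $\mathcal V_{gf}^+$ be a BV propagator: $\mathcal V_{gf}^+\mathcal V_{gf}=\mathcal V_{gf}\mathcal V_{gf}^+=1-P_{gf}$ and $\mathcal V_{gf}^+P_{gf}=0$ for a projection $P_{gf}$ onto $\ker\mathcal V_{gf}$. Put $Q^+=\begin{pmatrix}\mathcal V_{gf}^+&0\\0&0\end{pmatrix}\cdot(\omega_{ij})$, $P=1-QQ^+-Q^+Q$, $\mathcal H^p=P\mathcal H$, $\iota:\mathcal H^p\to\mathcal H$ the inclusion, $\pi=P:\mathcal H\to\mathcal H^p$, and $\omega^p=\omega(\iota\otimes\iota)$. Let $G_k$ be the set of rooted planar trees with $k$ leaves all of whose vertices have at least three incident edges. For $\Gamma\in G_k$ let $\tilde m_\Gamma:\mathcal H^{\otimes k}\to\mathcal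 H$ be obtained by attaching $m_r$ to each vertex with $r$ incoming edges and $-Q^+$ to each internal edge (the tree without vertices gives $Q$), and let $$\tilde m^p_k=\pi\circ\sum_{\Gamma\in G_k}\tilde m_\Gamma\circ\iota^{\otimes k}.$$ *Amplitudes.* An amputated connected tree contraction with $n$ free ends consists of vertices $v_1,\dots,v_N$ of valences $3\le e_1\le\dots\le e_N$, with cyclically ordered labelled half-edges, and a partial pairing of the half-edges into internal edges which makes the graph a connected tree and leaves $n$ half-edges free. Let $\lambda_l$ be the number of vertices of valence $l$. For such a $\Upsilon$ let $\tilde{\mathcal V}_\Upsilon=\sum_{h}\omega\circ(1\otimes\tilde m_{\Upsilon,h})$, the sum being over the $n$ free ends $h$, where $\tilde m_{\Upsilon,h}$ is $\tilde m_\Gamma$ for the rooted planar $(n-1)$-tree $\Gamma$ obtained from $\Upsilon$ by taking $h$ as root, and $\omega\circ(1\otimes f)(o_1,\dots,o_n)=(-1)^{\deg o_1}\omega(o_1,f(o_2,\dots,o_n))$ for homogeneous $o_1$. The tree on-shell amplitudes are $$\tilde{\mathcal V}^p_n=\Big(\sum_{\Upsilon}\ \prod_{l\ge3}\frac1{\lambda_l!\,l^{\lambda_l}}\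 \tilde{\mathcal V}_\Upsilon\Big)\circ\iota^{\otimes n}:(\mathcal H^p)^{\otimes n}\to\mathbb C,\qquad n\ge3.$$ (Equivalently, contractions that differ by rotations of the half-edges at the vertices are identified to one Feynman graph, which is counted with $\prod_l 1/\lambda_l!$ divided by the number of rotations leaving it invariant.) **Corollary.** $P$ is a projection with $QP=0$, and for all $n\ge 3$ $$\tilde{\mathcal V}^p_n=\omega^p\circ(1\otimes\tilde m^p_{n-1}).$$ The amplitudes therefore form the minimal cyclic $A_\infty$-algebra $(\mathcal H^p,\omega^p,\tilde{\mathfrak m}^p)$. That is, $\omega^p$ is a nondegenerate skew form of degree $-1$ on the graded space $\mathcal H^p$; the $\tilde m^p_k$ are multilinear of degree one, satisfy the $A_\infty$-relations $$\sum_{j\ge0,\ l\ge1,\ j+l\le n}(-1)^{\deg o_1+\cdots+\deg o_j}\,\tilde m^p_{n-l+1}(o_1,\dots,o_j,\tilde m^p_l(o_{j+1},\dots,o_{j+l}),o_{j+l+1},\dots,o_n)=0\qquad(n\ge1),$$ and $\tilde m^p_1=0$; and $\omega^p(o_1,\tilde m^p_k(o_2,\dots,o_{k+1}))=(-1)^{\deg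 o_2}\omega^p(o_2,\tilde m^p_k(o_3,\dots,o_{k+1},o_1))$ for homogeneous $o_1,\dots,o_{k+1}\in\mathcal H^p$, $k\ge1$. -/

import Mathlib

noncomputable section

namespace BVTree

/-! ### Graded spaces, `A_∞`-algebras, cyclic `A_∞`-algebras

Operations are written on lists: `m [x₁, …, x_k]` is `m_k(x₁, …, x_k)`. -/

section Abstract

variable {V : Type*} [AddCommGroup V] [Module ℂ V]

/-- `xs = [x₁, …, x_k]` is a list of homogeneous elements, `x_r` having degree `d_r` where
`ds = [d₁, …, d_k]`. -/
def Homogeneous (𝒜 : ℤ → Submodule ℂ V) (ds : List ℤ) (xs : List V) : Prop :=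
  List.Forall₂ (fun d x => x ∈ 𝒜 d) ds xs

/-- `A_∞`-algebra (bar convention: every `m_k`, `k ≥ 1`, has degree one, and `m_0 = 0`). -/
structure IsAInfinity (𝒜 : ℤ → Submodule ℂ V) (m : List V → V) : Prop where
  grading : DirectSum.IsInternal 𝒜
  map_nil : m [] = 0
  multilinear : ∀ A B : List V, IsLinearMap ℂ (fun x => m (A ++ x :: B))
  degree_one : ∀ ds xs, Homogeneous 𝒜 ds xs → m xs ∈ 𝒜 (ds.sum + 1)
  relation : ∀ ds xs, Homogeneous 𝒜 ds xs →
    ∑ j ∈ Finset.range xs.length, ∑ l ∈ Finset.Icc 1 (xs.length - j),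
      ((-1 : ℂ) ^ (ds.take j).sum) •
        m (xs.take j ++ m ((xs.drop j).take l) :: xs.drop (j + l)) = 0

/-- Odd constant symplectic structure: a nondegenerate skew bilinear form of degree `-1`. -/
structure IsOddSymplectic (𝒜 : ℤ → Submodule ℂ V) (ω : V →ₗ[ℂ] V →ₗ[ℂ] ℂ) : Prop where
  degree : ∀ p q : ℤ, ∀ x ∈ 𝒜 p, ∀ y ∈ 𝒜 q, p + q ≠ 1 → ω x y = 0
  skew : ∀ x y, ω y x = - ω x y
  nondegenerate : ∀ x, x ≠ 0 → ∃ y, ω x y ≠ 0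

/-- Cyclic `A_∞`-algebra `(V, ω, m)`. -/
structure IsCyclicAInfinity (𝒜 : ℤ → Submodule ℂ V) (ω : V →ₗ[ℂ] V →ₗ[ℂ] ℂ)
    (m : List V → V) : Prop extends IsAInfinity 𝒜 m where
  symplectic : IsOddSymplectic 𝒜 ω
  cyclic : ∀ (d₁ d₂ : ℤ) (ds : List ℤ) (x₁ x₂ : V) (xs : List V),
    Homogeneous 𝒜 (d₁ :: d₂ :: ds) (x₁ :: x₂ :: xs) →
      ω x₁ (m (x₂ :: xs)) = (-1 : ℂ) ^ d₂ * ω x₂ (m (xs ++ [x₁]))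

/-- Minimal cyclic `A_∞`-algebra: moreover `m_1 = 0`. -/
structure IsMinimalCyclicAInfinity (𝒜 : ℤ → Submodule ℂ V) (ω : V →ₗ[ℂ] V →ₗ[ℂ] ℂ)
    (m : List V → V) : Prop extends IsCyclicAInfinity 𝒜 ω m where
  minimal : ∀ x, m [x] = 0

end Abstract

/-! ### Rooted planar trees -/

/-- Rooted planar trees; the children of a vertex are ordered, and `leaf` is the tree `|`
without vertices. -/
inductive PTree : Type
  | leaf : PTree
  | node : List PTree → PTree

namespace PTree

mutual
/-- Number of leaves (the root is not counted). -/
def leaves : PTree → ℕ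
  | leaf => 1
  | node cs => leavesList cs
/-- Total number of leaves of a list of trees. -/
def leavesList : List PTree → ℕ
  | [] => 0
  | c :: cs => leaves c + leavesList cs
end

mutual
/-- Every vertex has at least two incoming edges, that is at least three incident edges. -/
def Stable : PTree → Prop
  | leaf => True
  | node cs => 2 ≤ cs.length ∧ StableList cs
/-- All trees of the list are stable. -/
def StableList : List PTree → Prop
  | [] => True
  | c :: cs => Stable c ∧ StableList cs
end

/-- The set `G_k` of rooted planar `k`-trees. -/
def treesWith (k : ℕ) : Set PTree := {Γ | Γ.Stable ∧ Γ.leaves = k}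

section Eval

variable {V : Type*} [AddCommGroup V] [Module ℂ V]

mutual
/-- `f̃_Γ`: the operation `m_k` at each vertex with `k` incoming edges and `-Q⁺` at each internal
edge and at the root edge; the tree `|` gives the identity. The entries of the list of arguments
are attached to the leaves from left to right. -/
def evalF (m : List V → V) (Qp : V →ₗ[ℂ] V) : PTree → List V → V
  | leaf, xs => xs.headD 0
  | node cs, xs => - Qp (m (evalFs m Qp cs xs))
/-- The operations `f̃` of a list of trees, applied to consecutive blocks of arguments. -/
def evalFs (m : List V → V) (Qp : V →ₗ[ℂ] V) : List PTree → List V → List V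
  | [], _ => []
  | c :: cs, xs => evalF m Qp c (xs.take c.leaves) :: evalFs m Qp cs (xs.drop c.leaves)
end

/-- `m̃_Γ`: the same, with nothing attached to the root edge; the tree `|` gives `m_1 = Q`. -/
def evalM (m : List V → V) (Qp : V →ₗ[ℂ] V) : PTree → List V → V
  | leaf, xs => m xs
  | node cs, xs => m (evalFs m Qp cs xs)

end Eval

end PTree

/-! ### Fields and antifields -/

/-- Index set of the homogeneous Darboux basis: `inl a` stands for `e_a` (fields) and `inr a`
for `e_a^*` (antifields). -/
abbrev Idx (ι : Type*) := ι ⊕ ι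

/-- `deg e_a = d a` and `deg e_a^* = 1 - deg e_a`. -/
def deg {ι : Type*} (d : ι → ℤ) : Idx ι → ℤ
  | Sum.inl a => d a
  | Sum.inr a => 1 - d a

/-- Degree of a word `e_{i_1} ⋯ e_{i_k}`. -/
def wdeg {ι : Type*} (d : ι → ℤ) (w : List (Idx ι)) : ℤ := (w.map (deg d)).sum

/-- The space `ℋ₊` spanned by the `e_a`. -/
abbrev FieldSpace (ι : Type*) := ι →₀ ℂ

/-- The space `ℋ = ℋ₊ ⊕ ℋ₋` spanned by the `e_a` and the `e_a^*`. -/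
abbrev BVSpace (ι : Type*) := Idx ι →₀ ℂ

/-- The homogeneous part `ℋ^k`. -/
def grade {ι : Type*} (d : ι → ℤ) (k : ℤ) : Submodule ℂ (BVSpace ι) :=
  Finsupp.supported ℂ ℂ {i | deg d i = k}

/-- The parity operator, `x ↦ (-1)^{deg x} x` on homogeneous elements. -/
def parity {ι : Type*} (d : ι → ℤ) : BVSpace ι →ₗ[ℂ] BVSpace ι :=
  Finsupp.linearCombination ℂ (fun i => Finsupp.single i ((-1 : ℂ) ^ deg d i))

open Classical in
/-- The Darboux matrix `ω_{ij}`: `-ω(e_a, e_b^*) = ω(e_b^*, e_a) = δ_{ab}`. -/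
def omegaLow {ι : Type*} : Idx ι → Idx ι → ℂ
  | Sum.inl a, Sum.inr b => if a = b then -1 else 0
  | Sum.inr a, Sum.inl b => if a = b then 1 else 0
  | _, _ => 0

open Classical in
/-- The inverse matrix `ω^{ij}`. -/
def omegaUp {ι : Type*} : Idx ι → Idx ι → ℂ
  | Sum.inl a, Sum.inr b => if a = b then 1 else 0
  | Sum.inr a, Sum.inl b => if a = b then -1 else 0
  | _, _ => 0

/-- The odd symplectic form `ω` on `ℋ`. -/
def omega (ι : Type*) : BVSpace ι →ₗ[ℂ] BVSpace ι →ₗ[ℂ] ℂ :=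
  Finsupp.linearCombination ℂ (fun i => Finsupp.linearCombination ℂ (fun j => omegaLow i j))

/-- Inclusion `ℋ₊ → ℋ`, `e_a ↦ e_a`. -/
def incF (ι : Type*) : FieldSpace ι →ₗ[ℂ] BVSpace ι := Finsupp.lmapDomain ℂ ℂ Sum.inl

/-- The map `ℋ₊ → ℋ`, `e_a ↦ e_a^*`. -/
def incA (ι : Type*) : FieldSpace ι →ₗ[ℂ] BVSpace ι := Finsupp.lmapDomain ℂ ℂ Sum.inr

/-- Components along the `e_a`. -/
def resF (ι : Type*) : BVSpace ι →ₗ[ℂ] FieldSpace ι :=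
  Finsupp.lcomapDomain Sum.inl Sum.inl_injective

/-- Components along the `e_a^*`. -/
def resA (ι : Type*) : BVSpace ι →ₗ[ℂ] FieldSpace ι :=
  Finsupp.lcomapDomain Sum.inr Sum.inr_injective

/-- The matrix `{ω_{ij}}`, blocks `(0, -1; 1, 0)`, as an operator on `ℋ`. -/
def omegaMatrix (ι : Type*) : BVSpace ι →ₗ[ℂ] BVSpace ι :=
  - incF ι ∘ₗ resA ι + incA ι ∘ₗ resF ι

/-- Multilinear extension of a function given on words in the basis. -/
def extend {I M : Type*} [AddCommGroup M] [Module ℂ M] :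
    (List I → M) → List (I →₀ ℂ) → M
  | c, [] => c []
  | c, v :: vs => v.sum (fun i a => a • extend (fun w => c (i :: w)) vs)

/-! ### Cyclic field theories with a classical BV structure -/

open Classical in
/-- The coefficients of the constant odd Poisson bracket `(A, B)` of two cyclic functions
`A = ∑ (1/k) A_{i_1 ⋯ i_k} φ^{i_k} ⋯ φ^{i_1}` and `B` (all orders `k, l ≥ 2` with
`k + l - 2 = n`). With
`b_{u_1 ⋯ u_n} = A_{i u_l ⋯ u_n} ω^{ij} B_{u_1 ⋯ u_{l-1} j}`,
the value is the signed average of `b` over the cyclic rotations of the word. -/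
def bracket {ι : Type*} (d : ι → ℤ) (A B : List (Idx ι) → ℂ) (w : List (Idx ι)) : ℂ :=
  (1 / (w.length : ℂ)) * ∑ r ∈ Finset.range w.length,
    (-1 : ℂ) ^ (wdeg d (w.take r) * wdeg d (w.drop r)) *
      ∑ s ∈ Finset.Ico 1 w.length, ∑ᶠ p : Idx ι × Idx ι,
        A (p.1 :: (w.rotate r).drop s) * omegaUp p.1 p.2 * B ((w.rotate r).take s ++ [p.2])

/-- A cyclic field theory with fields `φ^a`, `φ^{a,*}` dual to `e_a`, `e_a^*`: an action
`S = ½ 𝒱_{i_1 i_2} φ^{i_2} φ^{i_1} + ∑_{k ≥ 3} (1/k) 𝒱_{i_1 ⋯ i_k} φ^{i_k} ⋯ φ^{i_1}` of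
degree zero with cyclic coefficients. There may be infinitely many fields; `locallyFinite`
(automatic for finitely many fields) says that the components of the vector field `(·, S)` define
operations `m_k : ℋ^{⊗ k} → ℋ`, and makes the index sums in `(S, S)` finite. -/
structure CyclicFieldTheory {ι : Type*} (d : ι → ℤ) where
  /-- The coefficients `𝒱_{i_1 ⋯ i_k}`. -/
  coeff : List (Idx ι) → ℂ
  coeff_short : ∀ w, w.length < 2 → coeff w = 0
  degree_zero : ∀ w, wdeg d w ≠ 0 → coeff w = 0
  cyclic : ∀ i w, coeff (i :: w) = (-1 : ℂ) ^ (wdeg d w * deg d i) * coeff (w ++ [i])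
  locallyFinite : ∀ w, {i | coeff (i :: w) ≠ 0}.Finite

namespace CyclicFieldTheory

variable {ι : Type*} {d : ι → ℤ} (S : CyclicFieldTheory d)

/-- The classical BV master equation `(S, S) = 0`. -/
def MasterEquation : Prop := ∀ w, bracket d S.coeff S.coeff w = 0

/-- The coefficient `c^j_{i_1 ⋯ i_k} = (-1)^{deg e_l} ω^{jl} 𝒱_{l i_1 ⋯ i_k}`; the only `l` with
`ω^{jl} ≠ 0` is the partner `j.swap` of `j`. -/
def vertexCoeff (w : List (Idx ι)) (j : Idx ι) : ℂ :=
  (-1 : ℂ) ^ deg d j.swap * omegaUp j j.swap * S.coeff (j.swap :: w)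

theorem vertexCoeff_finite (w : List (Idx ι)) :
    (Function.support (S.vertexCoeff w)).Finite := by
  refine ((S.locallyFinite w).preimage (f := Sum.swap)
    (Function.Injective.injOn (Function.LeftInverse.injective Sum.swap_swap))).subset ?_
  intro j hj h
  exact hj (by simp only [vertexCoeff]; rw [h, mul_zero])

/-- `m_k(e_{i_1}, …, e_{i_k}) = e_j c^j_{i_1 ⋯ i_k}`. -/
def vertex (w : List (Idx ι)) : BVSpace ι :=
  Finsupp.ofSupportFinite (S.vertexCoeff w) (S.vertexCoeff_finite w)

/-- The operations `m_k` of the theory. -/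
def m (xs : List (BVSpace ι)) : BVSpace ι := extend S.vertex xs

/-- `Q = m_1`. -/
def Q : BVSpace ι →ₗ[ℂ] BVSpace ι := Finsupp.linearCombination ℂ (fun i => S.vertex [i])

/-- The lower left block of `Q` (the block `c_3`), extended by zero to `ℋ`. -/
def Qlow : BVSpace ι →ₗ[ℂ] BVSpace ι :=
  (incA ι ∘ₗ resA ι) ∘ₗ S.Q ∘ₗ (incF ι ∘ₗ resF ι)

/-- The action is proper, in the coordinates in which the gauge condition is `φ^* = 0`: there is a
degree zero linear map `T = (1, t; 0, 1)` preserving `ω` with `Q = T⁻¹ (0, 0; c_3, 0) T`. -/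
def IsProper : Prop :=
  ∃ t : FieldSpace ι →ₗ[ℂ] FieldSpace ι,
    let T : BVSpace ι →ₗ[ℂ] BVSpace ι := LinearMap.id + incF ι ∘ₗ t ∘ₗ resA ι
    (∀ k, ∀ x ∈ grade d k, T x ∈ grade d k) ∧
    (∀ x y, omega ι (T x) (T y) = omega ι x y) ∧
    T ∘ₗ S.Q = S.Qlow ∘ₗ T

/-- The gauge fixed kinetic matrix `(𝒱_gf)_{ab} = ω(e_a, Q e_b)`, as an operator on `ℋ₊`
(see `kinetic_apply`); it is the matrix of `½ ω(Φ, QΦ)` restricted to `φ^* = 0`. -/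
def kinetic : FieldSpace ι →ₗ[ℂ] FieldSpace ι := - resA ι ∘ₗ S.Q ∘ₗ incF ι

theorem kinetic_apply (a b : ι) :
    S.kinetic (Finsupp.single b 1) a =
      omega ι (Finsupp.single (Sum.inl a) 1) (S.Q (Finsupp.single (Sum.inl b) 1)) := by
  classical
  have key : ∀ y : BVSpace ι, omega ι (Finsupp.single (Sum.inl a) 1) y = - y (Sum.inr a) := by
    intro y
    induction y using Finsupp.induction_linear with
    | zero => simp
    | add f g hf hg => rw [map_add, hf, hg, Finsupp.add_apply]; ring
    | single i c =>
      rcases i with i | i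
      · simp [omega, omegaLow]
      · by_cases h : a = i
        · subst h; simp [omega, omegaLow]
        · simp [omega, omegaLow, h]
  rw [key]
  simp [kinetic, incF, resA, Finsupp.lcomapDomain, Finsupp.comapDomain_apply]

/-- `Vp` is the BV propagator `𝒱_gf⁺`: the inverse of `𝒱_gf` off its kernel, that is
`𝒱_gf⁺ 𝒱_gf = 𝒱_gf 𝒱_gf⁺ = 1 - P_gf` and `𝒱_gf⁺ P_gf = 0`, where `P_gf` is the projection onto
the kernel of `𝒱_gf`. -/
def IsBVPropagator (Vp : FieldSpace ι →ₗ[ℂ] FieldSpace ι) : Prop :=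
  ∃ Pgf : FieldSpace ι →ₗ[ℂ] FieldSpace ι,
    Pgf ∘ₗ Pgf = Pgf ∧ LinearMap.range Pgf = LinearMap.ker S.kinetic ∧
    Vp ∘ₗ S.kinetic = LinearMap.id - Pgf ∧ S.kinetic ∘ₗ Vp = LinearMap.id - Pgf ∧
    Vp ∘ₗ Pgf = 0

/-- `Q⁺ = 𝒱_L⁺ ω`, where `𝒱_L⁺ = (𝒱_gf⁺, 0; 0, 0)`. -/
def Qplus (Vp : FieldSpace ι →ₗ[ℂ] FieldSpace ι) : BVSpace ι →ₗ[ℂ] BVSpace ι :=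
  (incF ι ∘ₗ Vp ∘ₗ resF ι) ∘ₗ omegaMatrix ι

/-- `P = 1 - QQ⁺ - Q⁺Q`. -/
def P (Vp : FieldSpace ι →ₗ[ℂ] FieldSpace ι) : BVSpace ι →ₗ[ℂ] BVSpace ι :=
  LinearMap.id - S.Q ∘ₗ Qplus Vp - Qplus Vp ∘ₗ S.Q

/-- The space of on-shell (physical) states `ℋ^p = Pℋ`. -/
def Hp (Vp : FieldSpace ι →ₗ[ℂ] FieldSpace ι) : Submodule ℂ (BVSpace ι) :=
  LinearMap.range (S.P Vp)

/-- The grading of `ℋ^p`. -/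
def gradeHp (Vp : FieldSpace ι →ₗ[ℂ] FieldSpace ι) (k : ℤ) : Submodule ℂ (S.Hp Vp) :=
  (grade d k).comap (S.Hp Vp).subtype

/-- `ω^p = ω(ι ⊗ ι)`, the restriction of `ω` to `ℋ^p`. -/
def omegaHp (Vp : FieldSpace ι →ₗ[ℂ] FieldSpace ι) :
    S.Hp Vp →ₗ[ℂ] S.Hp Vp →ₗ[ℂ] ℂ :=
  (omega ι).domRestrict₁₂ (S.Hp Vp) (S.Hp Vp)

/-- The explicit minimal model `m̃^p_k = π ∘ ∑_{Γ ∈ G_k} m̃_Γ ∘ ι^{⊗ k}`. -/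
def mp (Vp : FieldSpace ι →ₗ[ℂ] FieldSpace ι) (xs : List (S.Hp Vp)) : S.Hp Vp :=
  (S.P Vp).rangeRestrict
    (∑ᶠ Γ ∈ PTree.treesWith xs.length,
      PTree.evalM S.m (Qplus Vp) Γ (xs.map (S.Hp Vp).subtype))

end CyclicFieldTheory

/-! ### Tree Feynman graphs -/

/-- An amputated connected tree Wick contraction with `n` free ends. There are vertices
`v_1, …, v_N` of valences `3 ≤ e_1 ≤ ⋯ ≤ e_N`, the half edges at `v_q` being labelled in their
cyclic order by `Fin (e_q)`. The involution `σ` exchanges the two half edges of each internal edge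
and fixes the free ends (the ends at which an external field was attached before amputation). -/
structure TreeContraction (n : ℕ) where
  /-- Number of vertices. -/
  N : ℕ
  /-- Valences. -/
  e : Fin N → ℕ
  mono : Monotone e
  three_le : ∀ q, 3 ≤ e q
  /-- Pairing of the half edges. -/
  σ : (Σ q, Fin (e q)) → (Σ q, Fin (e q))
  involutive : Function.Involutive σ
  card_free : Nat.card {h // σ h = h} = n
  /-- The graph on the vertices is connected and has no cycle through distinct vertices. -/
  isTree : (SimpleGraph.fromRel (fun p q => ∃ h, h.1 = p ∧ (σ h).1 = q)).IsTree
  /-- No edge joins a vertex to itself. -/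
  no_self_edge : ∀ h, σ h ≠ h → (σ h).1 ≠ h.1
  /-- Two vertices are joined by at most one edge. -/
  no_double_edge : ∀ h h', σ h ≠ h → σ h' ≠ h' → h.1 = h'.1 → (σ h).1 = (σ h').1 → h = h'

namespace TreeContraction

variable {n : ℕ} (G : TreeContraction n)

/-- The half edge `i` steps after `h` in the cyclic order at its vertex. -/
def next (h : Σ q, Fin (G.e q)) (i : ℕ) : Σ q, Fin (G.e q) :=
  ⟨h.1, ⟨(h.2.1 + i) % G.e h.1, Nat.mod_lt _ (lt_of_lt_of_le (by norm_num) (G.three_le h.1))⟩⟩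

open Classical in
/-- The rooted planar tree seen on entering the vertex of `h` through `h`, explored to the given
number of vertices in depth. -/
def unfold : ℕ → (Σ q, Fin (G.e q)) → PTree
  | 0, _ => PTree.leaf
  | k + 1, h => PTree.node ((List.range (G.e h.1 - 1)).map (fun i =>
      if G.σ (G.next h (i + 1)) = G.next h (i + 1) then PTree.leaf
      else unfold k (G.σ (G.next h (i + 1)))))

/-- The rooted planar `(n-1)`-tree obtained by choosing the free end `h` as root. (A path in a tree
with `N` vertices meets at most `N` vertices.) -/
def rootedAt (h : Σ q, Fin (G.e q)) : PTree := G.unfold G.N h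

/-- The weight `∏_l 1 / (λ_l! l^{λ_l})`, where `λ_l` is the number of vertices of valence `l`.
It is `1/Λ!` divided by the order of the group of rotations of the half edges at the vertices, so
that a graph (a contraction up to these rotations) counts with `1/Λ!` times the inverse of the
number of rotations that leave it invariant. -/
def weight : ℂ :=
  (∏ l ∈ Finset.univ.image G.e, ((Nat.card {q // G.e q = l}).factorial : ℂ)⁻¹) *
    ∏ q, (G.e q : ℂ)⁻¹

end TreeContraction

namespace CyclicFieldTheory

variable {ι : Type*} {d : ι → ℤ} (S : CyclicFieldTheory d)

/-- The cyclic function of a planar tree graph,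
`𝒱̃_Γ = n · ω ∘ (1 ⊗ m̃(s(Γ)))`, where `s(Γ)` is the average of the rooted trees obtained by choosing
one of the `n` free ends as root, hence the sum over these `n` choices. On homogeneous elements
`ω ∘ (1 ⊗ f)` is `(x, ys) ↦ (-1)^{deg x} ω(x, f(ys))`, because `f` has degree one. -/
def cyclicFunction (Vp : FieldSpace ι →ₗ[ℂ] FieldSpace ι) {n : ℕ} (G : TreeContraction n)
    (x : BVSpace ι) (ys : List (BVSpace ι)) : ℂ :=
  ∑ᶠ h ∈ {h | G.σ h = h},
    omega ι (parity d x) (PTree.evalM S.m (Qplus Vp) (G.rootedAt h) ys)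

/-- The amputated tree correlation function `𝒱̃_n(x, y_1, …, y_{n-1})`: the weighted sum over all
amputated connected tree Feynman graphs with `n` free ends. -/
def treeCorrelation (Vp : FieldSpace ι →ₗ[ℂ] FieldSpace ι)
    (x : BVSpace ι) (ys : List (BVSpace ι)) : ℂ :=
  ∑ᶠ G : TreeContraction (ys.length + 1), G.weight * S.cyclicFunction Vp G x ys

/-- The tree on-shell amplitude `𝒱̃^p_n = 𝒱̃_n ∘ ι^{⊗ n}` on `ℋ^p`. -/
def onShellAmplitude (Vp : FieldSpace ι →ₗ[ℂ] FieldSpace ι)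
    (x : S.Hp Vp) (ys : List (S.Hp Vp)) : ℂ :=
  S.treeCorrelation Vp x (ys.map (S.Hp Vp).subtype)

end CyclicFieldTheory

end BVTree

end

noncomputable section

namespace BVTree

/-! ### Sums over the ways to cut a list in two -/

section SplitSum

variable {α β W W' : Type*} [AddCommMonoid W] [AddCommMonoid W']

/-- The sum of `f A B` over all decompositions `xs = A ++ B`. -/
def splitSum (f : List α → List α → W) (xs : List α) : W :=
  ∑ j ∈ Finset.range (xs.length + 1), f (xs.take j) (xs.drop j)

theorem splitSum_nil (f : List α → List α → W) : splitSum f [] = f [] [] := by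
  simp [splitSum]

theorem splitSum_cons (f : List α → List α → W) (x : α) (xs : List α) :
    splitSum f (x :: xs) = f [] (x :: xs) + splitSum (fun A B => f (x :: A) B) xs := by
  unfold splitSum
  rw [List.length_cons, Finset.sum_range_succ', add_comm]
  simp

theorem splitSum_congr {f g : List α → List α → W} {xs : List α}
    (h : ∀ A B, A ++ B = xs → f A B = g A B) : splitSum f xs = splitSum g xs :=
  Finset.sum_congr rfl fun j _ => h _ _ (List.take_append_drop j xs)

theorem splitSum_add (f g : List α → List α → W) (xs : List α) :
    splitSum (fun A B => f A B + g A B) xs = splitSum f xs + splitSum g xs :=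
  Finset.sum_add_distrib

theorem splitSum_zero (xs : List α) : splitSum (fun _ _ => (0 : W)) xs = 0 := by
  simp [splitSum]

theorem map_splitSum {F : Type*} [FunLike F W W'] [AddMonoidHomClass F W W'] (φ : F)
    (f : List α → List α → W) (xs : List α) :
    φ (splitSum f xs) = splitSum (fun A B => φ (f A B)) xs :=
  map_sum φ _ _

theorem splitSum_comm (f : List α → List α → List β → List β → W) (xs : List α) (ys : List β) :
    splitSum (fun A B => splitSum (fun C D => f A B C D) ys) xs =
      splitSum (fun C D => splitSum (fun A B => f A B C D) xs) ys :=
  Finset.sum_comm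

theorem splitSum_map (f : List β → List β → W) (e : α → β) (xs : List α) :
    splitSum f (xs.map e) = splitSum (fun A B => f (A.map e) (B.map e)) xs := by
  simp [splitSum, List.map_take, List.map_drop]

theorem splitSum_append_cons (f : List α → List α → W) (A : List α) (y : α) (C : List α) :
    splitSum f (A ++ y :: C) = splitSum (fun A₁ A₂ => f A₁ (A₂ ++ y :: C)) A +
      splitSum (fun C₁ C₂ => f (A ++ y :: C₁) C₂) C := by
  induction A generalizing f with
  | nil => simp [splitSum_cons, splitSum_nil]
  | cons a A ih => simp [splitSum_cons, ih, add_assoc]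

/-- The last cut, after the whole list. -/
theorem splitSum_eq_add_of_last (f : List α → List α → W) (xs : List α) :
    splitSum f xs = splitSum (fun A B => if B = [] then 0 else f A B) xs + f xs [] := by
  induction xs generalizing f with
  | nil => simp [splitSum_nil]
  | cons x xs ih => rw [splitSum_cons, splitSum_cons, ih]; simp [add_assoc]

theorem splitSum_assoc (g : List α → List α → List α → W) (xs : List α) :
    splitSum (fun A D => splitSum (fun B C => g A B C) D) xs =
      splitSum (fun D C => splitSum (fun A B => g A B C) D) xs := by
  induction xs generalizing g with
  | nil => simp [splitSum_nil]
  | cons x xs ih =>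
    rw [splitSum_cons, splitSum_cons, splitSum_cons, ih (fun A B C => g (x :: A) B C), splitSum_nil]
    rw [splitSum_congr (f := fun A B => splitSum (fun A B_1 => g A B_1 B) (x :: A))
      (fun A B _ => splitSum_cons _ _ _), splitSum_add]
    rw [add_assoc]

/-- The sum of `f A B C` over all decompositions `xs = A ++ B ++ C`. -/
def splitSum₃ (f : List α → List α → List α → W) (xs : List α) : W :=
  splitSum (fun A D => splitSum (fun B C => f A B C) D) xs

theorem splitSum₃_congr {f g : List α → List α → List α → W} {xs : List α}
    (h : ∀ A B C, A ++ B ++ C = xs → f A B C = g A B C) : splitSum₃ f xs = splitSum₃ g xs :=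
  splitSum_congr fun A D hD => splitSum_congr fun B C hC => h A B C (by rw [List.append_assoc, hC, hD])

theorem splitSum₃_add (f g : List α → List α → List α → W) (xs : List α) :
    splitSum₃ (fun A B C => f A B C + g A B C) xs = splitSum₃ f xs + splitSum₃ g xs := by
  simp only [splitSum₃, splitSum_add]

theorem map_splitSum₃ {F : Type*} [FunLike F W W'] [AddMonoidHomClass F W W'] (φ : F)
    (f : List α → List α → List α → W) (xs : List α) :
    φ (splitSum₃ f xs) = splitSum₃ (fun A B C => φ (f A B C)) xs := by
  simp only [splitSum₃, map_splitSum]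

theorem splitSum₃_zero (xs : List α) : splitSum₃ (fun _ _ _ => (0 : W)) xs = 0 := by
  simp only [splitSum₃, splitSum_zero]

/-- If `f A B C` vanishes unless `B` is the whole list, only that term is left. -/
theorem splitSum₃_eq_single (f : List α → List α → List α → W) (xs : List α)
    (h : ∀ A B C, A ++ B ++ C = xs → ¬ (A = [] ∧ C = []) → f A B C = 0) :
    splitSum₃ f xs = f [] xs [] := by
  unfold splitSum₃
  have h1 : ∀ D : List α, ∀ g : List α → List α → W, (∀ B C, B ++ C = D → C ≠ [] → g B C = 0) →
      splitSum g D = g D [] := by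
    intro D g hg
    rw [splitSum_eq_add_of_last, splitSum_congr (g := fun _ _ => 0), splitSum_zero, zero_add]
    intro A B hAB
    split_ifs with hB
    · rfl
    · exact hg A B hAB hB
  cases xs with
  | nil => simp [splitSum_nil]
  | cons x xs =>
    rw [splitSum_cons, h1 (x :: xs) _ (fun B C hBC hC => h [] B C (by simpa using hBC) (by simp [hC])),
      splitSum_congr (g := fun _ _ => 0), splitSum_zero, add_zero]
    intro A B hAB
    rw [splitSum_congr (g := fun _ _ => 0), splitSum_zero]
    intro B' C' hBC
    exact h _ _ _ (by rw [List.append_assoc, hBC, List.cons_append, hAB]) (by simp)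

/-- Regrouping of a decomposition into five pieces. -/
theorem splitSum₃_splitSum₃ (f : List α → List α → List α → List α → List α → W) (xs : List α) :
    splitSum₃ (fun A B C => splitSum₃ (fun A' B' C' => f A A' B' C' C) B) xs =
      splitSum₃ (fun A B C => splitSum (fun A₁ A₂ => splitSum (fun C₁ C₂ => f A₁ A₂ B C₁ C₂) C) A)
        xs := by
  have step : ∀ D : List α, ∀ g : List α → List α → List α → List α → W,
      splitSum (fun B C => splitSum₃ (fun A' B' C' => g A' B' C' C) B) D =
        splitSum (fun A' E => splitSum (fun B' C => splitSum (fun C₁ C₂ => g A' B' C₁ C₂) C) E) D := by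
    intro D g
    unfold splitSum₃
    rw [← splitSum_assoc (fun A' E C => splitSum (fun B' C' => g A' B' C' C) E)]
    refine splitSum_congr fun A' E _ => ?_
    rw [← splitSum_assoc (fun B' C' C => g A' B' C' C)]
  calc _ = splitSum (fun A D => splitSum (fun A' E => splitSum (fun B' C =>
        splitSum (fun C₁ C₂ => f A A' B' C₁ C₂) C) E) D) xs :=
        splitSum_congr fun A D _ => step D (fun A' B' C' C => f A A' B' C' C)
    _ = splitSum (fun D E => splitSum (fun A A' => splitSum (fun B' C =>
        splitSum (fun C₁ C₂ => f A A' B' C₁ C₂) C) E) D) xs :=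
        splitSum_assoc (fun A A' E => splitSum (fun B' C =>
          splitSum (fun C₁ C₂ => f A A' B' C₁ C₂) C) E) xs
    _ = _ := splitSum_congr fun D E _ => splitSum_comm _ _ _

end SplitSum

/-! ### Sums over planar forests -/

namespace PTree

/-- Lists of stable trees with `n` leaves altogether. -/
def forestsWith (n : ℕ) : Set (List PTree) := {cs | StableList cs ∧ leavesList cs = n}

theorem Stable.leaves_pos : ∀ {Γ : PTree}, Γ.Stable → 0 < Γ.leaves
  | leaf, _ => by simp [leaves]
  | node [], h => by simp [Stable] at h
  | node (c :: cs), h => by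
    have := Stable.leaves_pos h.2.1
    simp only [leaves, leavesList]; omega

theorem StableList.length_le : ∀ {cs : List PTree}, StableList cs → cs.length ≤ leavesList cs
  | [], _ => by simp
  | c :: cs, h => by
    have := h.1.leaves_pos
    have := StableList.length_le h.2
    simp only [leavesList, List.length_cons]; omega

theorem treesWith_zero : treesWith 0 = ∅ := by
  ext Γ
  simp only [treesWith, Set.mem_ofPred_eq, Set.mem_empty_iff_false, iff_false, not_and]
  exact fun h => h.leaves_pos.ne'

theorem forestsWith_zero : forestsWith 0 = {[]} := by
  ext cs
  simp only [forestsWith, Set.mem_ofPred_eq, Set.mem_singleton_iff]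
  constructor
  · rintro ⟨h, h0⟩
    have := h.length_le
    exact List.eq_nil_of_length_eq_zero (by omega)
  · rintro rfl
    simp [StableList, leavesList]

theorem finite_treesWith_and_forestsWith (n : ℕ) :
    (treesWith n).Finite ∧ (forestsWith n).Finite := by
  induction n using Nat.strong_induction_on with
  | _ n ih =>
    rcases n with _ | n
    · rw [treesWith_zero, forestsWith_zero]; simp
    have hA : (⋃ j ∈ Finset.range n,
        Set.image2 List.cons (treesWith (j + 1)) (forestsWith (n - j))).Finite := by
      refine Set.Finite.biUnion (Finset.finite_toSet _) fun j hj => ?_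
      have hj : j < n := Finset.mem_range.1 hj
      exact Set.Finite.image2 _ (ih (j + 1) (by omega)).1 (ih (n - j) (by omega)).2
    have hmem : ∀ c c' cs, StableList (c :: c' :: cs) → leavesList (c :: c' :: cs) = n + 1 →
        c :: c' :: cs ∈ (⋃ j ∈ Finset.range n,
          Set.image2 List.cons (treesWith (j + 1)) (forestsWith (n - j))) := by
      intro c c' cs hs hl
      have h1 := hs.1.leaves_pos
      have h2 := hs.2.1.leaves_pos
      simp only [leavesList] at hl
      simp only [Set.mem_iUnion, Finset.mem_range]
      refine ⟨c.leaves - 1, by omega, c, ⟨hs.1, by omega⟩, c' :: cs, ⟨hs.2, ?_⟩, rfl⟩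
      simp only [leavesList]; omega
    have hT : (treesWith (n + 1)).Finite := by
      refine ((Set.finite_singleton leaf).union (hA.image node)).subset ?_
      rintro (_ | cs) ⟨hs, hl⟩
      · simp
      · right
        rcases cs with _ | ⟨c, _ | ⟨c', cs⟩⟩
        · simp [Stable] at hs
        · simp [Stable] at hs
        · exact ⟨_, hmem c c' cs hs.2 hl, rfl⟩
    refine ⟨hT, ((hT.image (fun c => [c])).union hA).subset ?_⟩
    rintro cs ⟨hs, hl⟩
    rcases cs with _ | ⟨c, _ | ⟨c', cs⟩⟩
    · simp [leavesList] at hl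
    · left; exact ⟨c, ⟨hs.1, by simpa [leavesList] using hl⟩, rfl⟩
    · right; exact hmem c c' cs hs hl

theorem finite_treesWith (n : ℕ) : (treesWith n).Finite := (finite_treesWith_and_forestsWith n).1

theorem finite_forestsWith (n : ℕ) : (forestsWith n).Finite :=
  (finite_treesWith_and_forestsWith n).2

/-- `treesWith n` as a finset. -/
def treeFinset (n : ℕ) : Finset PTree := (finite_treesWith n).toFinset

/-- `forestsWith n` as a finset. -/
def forestFinset (n : ℕ) : Finset (List PTree) := (finite_forestsWith n).toFinset

theorem mem_treeFinset {n : ℕ} {Γ : PTree} : Γ ∈ treeFinset n ↔ Γ.Stable ∧ Γ.leaves = n := by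
  simp [treeFinset, treesWith]

theorem mem_forestFinset {n : ℕ} {cs : List PTree} :
    cs ∈ forestFinset n ↔ StableList cs ∧ leavesList cs = n := by
  simp [forestFinset, forestsWith]

theorem sum_forestFinset_succ {W : Type*} [AddCommMonoid W] (n : ℕ) (g : List PTree → W) :
    ∑ cs ∈ forestFinset (n + 1), g cs = ∑ j ∈ Finset.range (n + 1),
      ∑ Γ ∈ treeFinset (j + 1), ∑ cs ∈ forestFinset (n - j), g (Γ :: cs) := by
  rw [Finset.sum_congr rfl (fun j _ => (Finset.sum_product (treeFinset (j + 1))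
    (forestFinset (n - j)) (fun p => g (p.1 :: p.2))).symm), Finset.sum_sigma']
  symm
  refine Finset.sum_bij (fun p _ => p.2.1 :: p.2.2) ?_ ?_ ?_ ?_
  · rintro ⟨j, Γ, cs⟩ h
    simp only [Finset.mem_sigma, Finset.mem_range, Finset.mem_product, mem_treeFinset,
      mem_forestFinset] at h ⊢
    refine ⟨⟨h.2.1.1, h.2.2.1⟩, ?_⟩
    simp only [leavesList]; omega
  · rintro ⟨j, Γ, cs⟩ h ⟨j', Γ', cs'⟩ h' heq
    simp only [Finset.mem_sigma, Finset.mem_range, Finset.mem_product, mem_treeFinset,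
      mem_forestFinset] at h h'
    simp only [List.cons.injEq] at heq
    obtain ⟨rfl, rfl⟩ := heq
    have : j = j' := by omega
    subst this; rfl
  · intro cs h
    rw [mem_forestFinset] at h
    rcases cs with _ | ⟨c, cs⟩
    · simp [leavesList] at h
    have h1 := h.1.1.leaves_pos
    have h2 := h.2
    simp only [leavesList] at h2
    refine ⟨⟨c.leaves - 1, c, cs⟩, ?_, rfl⟩
    simp only [Finset.mem_sigma, Finset.mem_range, Finset.mem_product, mem_treeFinset,
      mem_forestFinset]
    exact ⟨by omega, ⟨h.1.1, by omega⟩, h.1.2, by omega⟩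
  · intros; rfl

theorem sum_treeFinset {W : Type*} [AddCommMonoid W] (n : ℕ) (g : PTree → W) :
    ∑ Γ ∈ treeFinset n, g Γ = (if n = 1 then g leaf else 0) +
      ∑ cs ∈ forestFinset n, if 2 ≤ cs.length then g (node cs) else 0 := by
  classical
  rw [← Finset.sum_filter, ← Finset.sum_filter_add_sum_filter_not _ (fun Γ => Γ = leaf)]
  congr 1
  · split_ifs with h
    · subst h
      rw [Finset.sum_eq_single leaf]
      · intro b hb hb'; simp at hb; exact absurd hb.2 hb'
      · intro h; exact absurd (by simp [mem_treeFinset, Stable, leaves]) h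
    · refine Finset.sum_eq_zero fun Γ hΓ => ?_
      simp only [Finset.mem_filter, mem_treeFinset] at hΓ
      obtain ⟨⟨_, h2⟩, rfl⟩ := hΓ
      exact absurd h2.symm h
  · symm
    refine Finset.sum_bij (fun cs _ => node cs) ?_ ?_ ?_ ?_
    · intro cs h
      simp only [Finset.mem_filter, mem_treeFinset, mem_forestFinset] at h ⊢
      exact ⟨⟨⟨h.2, h.1.1⟩, h.1.2⟩, by simp⟩
    · intro cs _ cs' _ h; simpa using h
    · rintro (_ | cs) h
      · simp at h
      · simp only [Finset.mem_filter, mem_treeFinset, mem_forestFinset] at h ⊢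
        exact ⟨cs, ⟨⟨h.1.1.2, h.1.2⟩, h.1.1.1⟩, rfl⟩
    · intros; rfl

end PTree

end BVTree

namespace BVTree

open PTree

section ForestSums

variable {V W W' : Type*} [AddCommGroup V] [Module ℂ V]

/-- The sum of `φ (f̃_{Γ₁}(…), …, f̃_{Γ_k}(…))` over all stable planar forests `Γ₁ ⋯ Γ_k` with as many
leaves as there are arguments. -/
def forestSum [AddCommMonoid W] (m : List V → V) (Qp : V →ₗ[ℂ] V) (φ : List V → W)
    (xs : List V) : W :=
  ∑ cs ∈ forestFinset xs.length, φ (evalFs m Qp cs xs)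

/-- The sum of `f̃_Γ` over all stable planar trees with as many leaves as there are arguments. -/
def treeF (m : List V → V) (Qp : V →ₗ[ℂ] V) (xs : List V) : V :=
  ∑ Γ ∈ treeFinset xs.length, evalF m Qp Γ xs

/-- The sum of `φ (f̃_Γ(…))` over the same trees. -/
def treeSum [AddCommMonoid W] (m : List V → V) (Qp : V →ₗ[ℂ] V) (φ : V → W) (xs : List V) : W :=
  ∑ Γ ∈ treeFinset xs.length, φ (evalF m Qp Γ xs)

/-- The operations of arity at least two. -/
def higher [Zero W] (m : List V → W) (xs : List V) : W := if 2 ≤ xs.length then m xs else 0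

/-- The sum of `m̃_Γ` over all stable planar trees with at least one vertex. -/
def treeM (m : List V → V) (Qp : V →ₗ[ℂ] V) (xs : List V) : V :=
  forestSum m Qp (higher m) xs

/-- The projection of a list of length one to its entry; other lists are sent to zero. -/
def single : List V → V
  | [x] => x
  | _ => 0

variable [AddCommMonoid W] [AddCommMonoid W'] (m : List V → V) (Qp : V →ₗ[ℂ] V)

theorem length_evalFs : ∀ (cs : List PTree) (xs : List V), (evalFs m Qp cs xs).length = cs.length
  | [], _ => by simp [evalFs]
  | c :: cs, xs => by simp [evalFs, length_evalFs cs]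

theorem forestSum_nil (φ : List V → W) : forestSum m Qp φ [] = φ [] := by
  have : forestFinset 0 = {[]} := by
    ext; simp [forestFinset, forestsWith_zero]
  simp [forestSum, this, evalFs]

theorem forestSum_cons (φ : List V → W) (x : V) (xs : List V) :
    forestSum m Qp φ (x :: xs) =
      splitSum (fun B C => treeSum m Qp (fun v => forestSum m Qp (fun l => φ (v :: l)) C) (x :: B))
        xs := by
  unfold forestSum splitSum treeSum
  rw [List.length_cons, sum_forestFinset_succ]
  refine Finset.sum_congr rfl fun j hj => ?_
  have hj : j ≤ xs.length := by have := Finset.mem_range.1 hj; omega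
  simp only [List.length_cons, List.length_take, List.length_drop, min_eq_left hj]
  refine Finset.sum_congr rfl fun Γ hΓ => Finset.sum_congr rfl fun cs _ => ?_
  rw [mem_treeFinset] at hΓ
  simp [evalFs, hΓ.2]

theorem forestSum_add (φ ψ : List V → W) (xs : List V) :
    forestSum m Qp (fun l => φ l + ψ l) xs = forestSum m Qp φ xs + forestSum m Qp ψ xs :=
  Finset.sum_add_distrib

theorem forestSum_zero (xs : List V) : forestSum m Qp (fun _ => (0 : W)) xs = 0 := by
  simp [forestSum]

theorem map_forestSum {F : Type*} [FunLike F W W'] [AddMonoidHomClass F W W'] (f : F)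
    (φ : List V → W) (xs : List V) :
    f (forestSum m Qp φ xs) = forestSum m Qp (fun l => f (φ l)) xs :=
  map_sum f _ _

theorem forestSum_splitSum_comm {α : Type*} (f : List V → List α → List α → W) (xs : List V)
    (ys : List α) :
    forestSum m Qp (fun l => splitSum (f l) ys) xs =
      splitSum (fun A B => forestSum m Qp (fun l => f l A B) xs) ys :=
  Finset.sum_comm

theorem forestSum_comm (f : List V → List V → W) (xs ys : List V) :
    forestSum m Qp (fun l => forestSum m Qp (fun l' => f l l') ys) xs =
      forestSum m Qp (fun l' => forestSum m Qp (fun l => f l l') xs) ys :=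
  Finset.sum_comm

theorem forestSum_congr {φ ψ : List V → W} {xs : List V} (hxs : xs ≠ [])
    (h : ∀ l, l ≠ [] → φ l = ψ l) : forestSum m Qp φ xs = forestSum m Qp ψ xs := by
  refine Finset.sum_congr rfl fun cs hcs => h _ fun h0 => ?_
  rw [mem_forestFinset] at hcs
  have : cs = [] := by
    rw [← List.length_eq_zero_iff, ← length_evalFs m Qp cs xs, h0]; rfl
  subst this
  exact hxs (by simpa [leavesList] using hcs.2.symm)

theorem IsLinearMap.splitSum {E : Type*} [AddCommGroup E] [Module ℂ E] {α : Type*}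
    {f : List α → List α → V → E} {xs : List α}
    (h : ∀ A B, A ++ B = xs → IsLinearMap ℂ (f A B)) :
    IsLinearMap ℂ (fun y => splitSum (fun A B => f A B y) xs) := by
  constructor
  · intro y z
    rw [← splitSum_add]
    exact splitSum_congr fun A B hAB => (h A B hAB).map_add y z
  · intro c y
    have := map_splitSum (LinearMap.lsmul ℂ E c) (fun A B => f A B y) xs
    simp only [LinearMap.lsmul_apply] at this
    rw [this]
    exact splitSum_congr fun A B hAB => (h A B hAB).map_smul c y

theorem IsLinearMap.forestSum {E : Type*} [AddCommGroup E] [Module ℂ E]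
    {f : List V → V → E} {xs : List V} (h : ∀ l, IsLinearMap ℂ (f l)) :
    IsLinearMap ℂ (fun y => forestSum m Qp (fun l => f l y) xs) := by
  constructor
  · intro y z
    rw [← forestSum_add]
    simp only [(h _).map_add]
  · intro c y
    have := map_forestSum m Qp (LinearMap.lsmul ℂ E c) (fun l => f l y) xs
    simp only [LinearMap.lsmul_apply] at this
    rw [this]
    simp only [(h _).map_smul]

theorem treeSum_splitSum_comm {α : Type*} (f : V → List α → List α → W) (xs : List V)
    (ys : List α) :
    treeSum m Qp (fun v => splitSum (f v) ys) xs =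
      splitSum (fun A B => treeSum m Qp (fun v => f v A B) xs) ys :=
  Finset.sum_comm

theorem treeSum_add (φ ψ : V → W) (xs : List V) :
    treeSum m Qp (fun v => φ v + ψ v) xs = treeSum m Qp φ xs + treeSum m Qp ψ xs :=
  Finset.sum_add_distrib

theorem treeSum_zero (xs : List V) : treeSum m Qp (fun _ => (0 : W)) xs = 0 := by
  simp [treeSum]

theorem treeSum_eq {E : Type*} [AddCommGroup E] [Module ℂ E] {f : V → E} (hf : IsLinearMap ℂ f)
    (xs : List V) : treeSum m Qp f xs = f (treeF m Qp xs) :=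
  (map_sum hf.mk' _ _).symm

/-- Cutting a forest in two. -/
theorem forestSum_splitSum (ψ : List V → List V → W) (xs : List V) :
    forestSum m Qp (splitSum ψ) xs =
      splitSum (fun A B => forestSum m Qp (fun l₁ => forestSum m Qp (ψ l₁) B) A) xs := by
  induction h : xs.length using Nat.strong_induction_on generalizing xs ψ with
  | _ n ih =>
    subst h
    cases xs with
    | nil => simp [forestSum_nil, splitSum_nil]
    | cons x xs =>
      rw [forestSum_cons, splitSum_cons, forestSum_nil, forestSum_cons]
      simp only [forestSum_cons]
      rw [splitSum_congr (g := fun B C =>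
        treeSum m Qp (fun v => forestSum m Qp (fun l => ψ [] (v :: l)) C) (x :: B) +
        splitSum (fun C₁ C₂ => treeSum m Qp (fun v => forestSum m Qp (fun l₁ =>
          forestSum m Qp (ψ (v :: l₁)) C₂) C₁) (x :: B)) C)]
      · rw [splitSum_add]
        congr 1
        rw [splitSum_assoc (fun B C₁ C₂ => treeSum m Qp (fun v => forestSum m Qp (fun l₁ =>
          forestSum m Qp (ψ (v :: l₁)) C₂) C₁) (x :: B))]
      · intro B C hBC
        simp only [splitSum_cons, forestSum_add, treeSum_add]
        congr 1
        rw [← treeSum_splitSum_comm]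
        congr 1
        funext v
        refine ih C.length ?_ _ _ rfl
        rw [← hBC]; simp only [List.length_cons, List.length_append]; omega

/-- The tree of a forest to which a given leaf belongs. -/
theorem forestSum_append_cons (φ : List V → W) (A : List V) (y : V) (C : List V) :
    forestSum m Qp φ (A ++ y :: C) =
      splitSum (fun A₁ A₂ => splitSum (fun C₁ C₂ => forestSum m Qp (fun l₁ =>
        treeSum m Qp (fun v => forestSum m Qp (fun l₂ => φ (l₁ ++ v :: l₂)) C₂)
          (A₂ ++ y :: C₁)) A₁) C) A := by
  induction h : A.length using Nat.strong_induction_on generalizing A φ with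
  | _ n ih =>
    subst h
    cases A with
    | nil => simp [splitSum_nil, forestSum_cons, forestSum_nil]
    | cons a A =>
      rw [List.cons_append, forestSum_cons, splitSum_append_cons, splitSum_cons, add_comm]
      congr 1
      · simp [forestSum_nil]
      · simp only [forestSum_cons]
        rw [splitSum_congr (g := fun B A' => splitSum (fun A₁ A₂ => splitSum (fun C₁ C₂ =>
          treeSum m Qp (fun w => forestSum m Qp (fun l₁ =>
            treeSum m Qp (fun v => forestSum m Qp (fun l₂ => φ (w :: l₁ ++ v :: l₂)) C₂)
          (A₂ ++ y :: C₁)) A₁) (a :: B)) C) A')]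
        · rw [splitSum_assoc (fun B A₁ A₂ => splitSum (fun C₁ C₂ =>
          treeSum m Qp (fun w => forestSum m Qp (fun l₁ =>
            treeSum m Qp (fun v => forestSum m Qp (fun l₂ => φ (w :: l₁ ++ v :: l₂)) C₂)
          (A₂ ++ y :: C₁)) A₁) (a :: B)) C)]
          exact splitSum_congr fun D A₂ _ => splitSum_comm _ _ _
        · intro B A' hBA
          simp only [← treeSum_splitSum_comm]
          congr 1
          funext v
          refine ih A'.length ?_ _ _ rfl
          rw [← hBA]; simp only [List.length_cons, List.length_append]; omega

/-- The operations extended multilinearly. -/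
def Multilinear {E : Type*} [AddCommGroup E] [Module ℂ E] (f : List V → E) : Prop :=
  ∀ A B : List V, IsLinearMap ℂ fun x => f (A ++ x :: B)

theorem Multilinear.higher {E : Type*} [AddCommGroup E] [Module ℂ E] {f : List V → E}
    (hf : Multilinear f) : Multilinear (higher f) := by
  intro A B
  simp only [BVTree.higher, List.length_append, List.length_cons]
  split_ifs
  · exact hf A B
  · exact (0 : V →ₗ[ℂ] E).isLinear

theorem Multilinear.map_zero {E : Type*} [AddCommGroup E] [Module ℂ E] {f : List V → E}
    (hf : Multilinear f) (A B : List V) : f (A ++ 0 :: B) = 0 := (hf A B).map_zero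

theorem treeF_eq (xs : List V) : treeF m Qp xs = single xs - Qp (treeM m Qp xs) := by
  unfold treeF treeM forestSum
  rw [sum_treeFinset, sub_eq_add_neg, map_sum, ← Finset.sum_neg_distrib]
  congr 1
  · rcases xs with _ | ⟨x, _ | ⟨y, xs⟩⟩ <;> simp [single, evalF]
  · refine Finset.sum_congr rfl fun cs _ => ?_
    simp only [higher, length_evalFs]
    split_ifs <;> simp [evalF]

theorem treeM_nil : treeM m Qp [] = 0 := by simp [treeM, forestSum_nil, higher]

theorem treeM_singleton (x : V) : treeM m Qp [x] = 0 := by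
  have h : ∀ Γ : PTree, ∀ l, higher m [evalF m Qp Γ l] = 0 := by simp [higher]
  simp [treeM, forestSum_cons, splitSum_nil, forestSum_nil, treeSum, h]

variable {m}

theorem multilinear_single : Multilinear (single : List V → V) := by
  intro A C
  rcases A with _ | ⟨a, _ | ⟨b, A⟩⟩ <;> rcases C with _ | ⟨c, C⟩ <;>
    simp only [single, List.nil_append, List.cons_append]
  · exact LinearMap.id.isLinear
  all_goals exact (0 : V →ₗ[ℂ] V).isLinear

theorem Multilinear.treeM (hm : Multilinear m) : Multilinear (treeM m Qp) := by
  intro A C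
  induction h : A.length + C.length using Nat.strong_induction_on generalizing A C with
  | _ n ih =>
    subst h
    unfold BVTree.treeM
    simp only [forestSum_append_cons]
    refine IsLinearMap.splitSum fun A₁ A₂ hA => IsLinearMap.splitSum fun C₁ C₂ hC => ?_
    have key : ∀ y : V, ∀ l₁ : List V, treeSum m Qp (fun v => forestSum m Qp (fun l₂ =>
        BVTree.higher m (l₁ ++ v :: l₂)) C₂) (A₂ ++ y :: C₁) = forestSum m Qp (fun l₂ =>
        BVTree.higher m (l₁ ++ treeF m Qp (A₂ ++ y :: C₁) :: l₂)) C₂ := fun y l₁ =>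
      treeSum_eq m Qp (IsLinearMap.forestSum m Qp fun l₂ => hm.higher _ _) _
    simp only [key]
    by_cases h0 : A₁ = [] ∧ C₂ = []
    · obtain ⟨rfl, rfl⟩ := h0
      simp only [forestSum_nil]
      simp only [BVTree.higher, List.nil_append, List.length_singleton]
      exact (0 : V →ₗ[ℂ] V).isLinear
    · refine IsLinearMap.forestSum m Qp fun l₁ => IsLinearMap.forestSum m Qp fun l₂ => ?_
      have h1 : IsLinearMap ℂ fun y => treeF m Qp (A₂ ++ y :: C₁) := by
        simp only [treeF_eq]
        have hs := multilinear_single (V := V) A₂ C₁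
        have hl : A₂.length + C₁.length < A.length + C.length := by
          rw [← hA, ← hC]
          simp only [List.length_append]
          rcases A₁ with _ | ⟨a, A₁⟩
          · rcases C₂ with _ | ⟨c, C₂⟩
            · simp at h0
            · simp
          · simp; omega
        have hM := ih _ hl A₂ C₁ rfl
        exact IsLinearMap.mk (fun y z => by rw [hs.map_add, hM.map_add, map_add]; abel)
          (fun c y => by rw [hs.map_smul, hM.map_smul, map_smul, smul_sub])
      have h2 := hm.higher l₁ l₂
      exact IsLinearMap.mk (fun y z => by rw [h1.map_add, h2.map_add])
        (fun c y => by rw [h1.map_smul, h2.map_smul])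

theorem forestSum_eq_add (hm : Multilinear m) (hm0 : m [] = 0) (xs : List V) :
    forestSum m Qp m xs = m [treeF m Qp xs] + treeM m Qp xs := by
  cases xs with
  | nil =>
    rw [forestSum_nil, treeM_nil, treeF_eq, treeM_nil, hm0]
    simpa [single] using (hm.map_zero [] []).symm
  | cons x xs =>
    rw [treeM, forestSum_cons, forestSum_cons]
    conv_lhs => rw [splitSum_eq_add_of_last]
    conv_rhs => rw [splitSum_eq_add_of_last]
    simp only [forestSum_nil]
    have : ∀ v : V, higher m [v] = 0 := by simp [higher]
    simp only [this, treeSum_zero, add_zero]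
    rw [add_comm, ← treeSum_eq m Qp (f := fun v => m [v]) (hm [] [])]
    congr 1
    refine splitSum_congr fun B C _ => ?_
    split_ifs with hC
    · rfl
    · congr 1
      funext v
      refine forestSum_congr m Qp hC fun l hl => ?_
      have : 2 ≤ (v :: l).length := by
        have := List.length_pos_iff.2 hl
        simp only [List.length_cons]; omega
      simp only [higher, if_pos this]

section Parity

variable {Qp} {eps : V →ₗ[ℂ] V}

mutual
theorem evalF_map_parity (hε : ∀ xs, m (xs.map eps) = - eps (m xs))
    (hQε : ∀ x, Qp (eps x) = - eps (Qp x)) : ∀ (Γ : PTree) (xs : List V),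
    evalF m Qp Γ (xs.map eps) = eps (evalF m Qp Γ xs)
  | leaf, [] => by simp [evalF]
  | leaf, x :: xs => by simp [evalF]
  | node cs, xs => by
    simp only [evalF]
    rw [evalFs_map_parity hε hQε cs xs, hε, map_neg, hQε, map_neg, neg_neg]
theorem evalFs_map_parity (hε : ∀ xs, m (xs.map eps) = - eps (m xs))
    (hQε : ∀ x, Qp (eps x) = - eps (Qp x)) : ∀ (cs : List PTree) (xs : List V),
    evalFs m Qp cs (xs.map eps) = (evalFs m Qp cs xs).map eps
  | [], xs => by simp [evalFs]
  | c :: cs, xs => by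
    simp only [evalFs, List.map_cons]
    rw [← List.map_take, ← List.map_drop, evalF_map_parity hε hQε c, evalFs_map_parity hε hQε cs]
end

theorem forestSum_map_parity (hε : ∀ xs, m (xs.map eps) = - eps (m xs))
    (hQε : ∀ x, Qp (eps x) = - eps (Qp x))
    (φ : List V → W) (xs : List V) :
    forestSum m Qp φ (xs.map eps) = forestSum m Qp (fun l => φ (l.map eps)) xs := by
  simp only [forestSum, List.length_map, evalFs_map_parity hε hQε]

end Parity

end ForestSums

end BVTree

namespace BVTree

open PTree

section Transfer

variable {V : Type*} [AddCommGroup V] [Module ℂ V] {m : List V → V} {Qp eps : V →ₗ[ℂ] V}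

theorem forestSum_map_splitSum₃ {E : Type*} [AddCommGroup E] [Module ℂ E]
    (φ : List V → List V → List V → E) (xs : List V) :
    forestSum m Qp (splitSum₃ φ) xs = splitSum₃ (fun A B C => forestSum m Qp (fun l₁ =>
      forestSum m Qp (fun l₃ => forestSum m Qp (fun l₂ => φ l₁ l₂ l₃) B) C) A) xs := by
  unfold splitSum₃
  rw [forestSum_splitSum]
  refine splitSum_congr fun A D _ => ?_
  simp only [forestSum_splitSum]
  rw [forestSum_splitSum_comm]
  refine splitSum_congr fun B C _ => ?_
  simp only [forestSum_comm m Qp _ B C]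

/-- The sum over all forests with a marked leaf `y` in front of a multilinear operation of arity at
least two. -/
theorem treeM_append_cons (hm : Multilinear m) (A : List V) (y : V) (C : List V) :
    treeM m Qp (A ++ y :: C) =
      splitSum (fun A₁ A₂ => splitSum (fun C₁ C₂ => forestSum m Qp (fun l₁ =>
        forestSum m Qp (fun l₂ => higher m (l₁ ++ treeF m Qp (A₂ ++ y :: C₁) :: l₂)) C₂) A₁) C) A := by
  unfold treeM
  rw [forestSum_append_cons]
  refine splitSum_congr fun A₁ A₂ _ => splitSum_congr fun C₁ C₂ _ => ?_
  congr 1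
  funext l₁
  exact treeSum_eq m Qp (IsLinearMap.forestSum m Qp fun l₂ => hm.higher _ _) _

theorem forestSum_splitSum₃_comm {E : Type*} [AddCommGroup E] {α : Type*}
    (f : List V → List α → List α → List α → E) (xs : List V) (ys : List α) :
    forestSum m Qp (fun l => splitSum₃ (f l) ys) xs =
      splitSum₃ (fun A B C => forestSum m Qp (fun l => f l A B C) xs) ys := by
  simp only [splitSum₃, forestSum_splitSum_comm]

theorem splitSum₃_higher
    (hrel : ∀ xs, splitSum₃ (fun A B C => m (A.map eps ++ m B :: C)) xs = 0) (l : List V) :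
    m [m l] + splitSum₃ (fun A B C => higher m (A.map eps ++ m B :: C)) l = 0 := by
  rw [← hrel l]
  have h1 : splitSum₃ (fun A B C => if A = [] ∧ C = [] then m [m B] else 0) l = m [m l] := by
    rw [splitSum₃_eq_single]
    · simp
    · intro A B C _ h; simp [h]
  rw [← h1, ← splitSum₃_add]
  refine splitSum₃_congr fun A B C _ => ?_
  split_ifs with h
  · obtain ⟨rfl, rfl⟩ := h
    simp [higher]
  · rw [zero_add, higher, if_pos]
    rcases A with _ | ⟨a, A⟩
    · rcases C with _ | ⟨c, C⟩
      · simp at h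
      · simp
    · simp; omega

/-- The relation behind the transferred `A_∞`-relations, for arguments annihilated by `m_1`. -/
theorem treeM_relation (hm : Multilinear m) (hm0 : m [] = 0)
    (hε : ∀ xs, m (xs.map eps) = - eps (m xs)) (hQε : ∀ x, Qp (eps x) = - eps (Qp x))
    (hrel : ∀ xs, splitSum₃ (fun A B C => m (A.map eps ++ m B :: C)) xs = 0)
    (hQQ : ∀ x, m [m [x]] = 0)
    {P : V →ₗ[ℂ] V} (hP : ∀ x, P x = x - m [Qp x] - Qp (m [x]))
    (xs : List V) (hxs : ∀ x ∈ xs, m [x] = 0) :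
    m [treeM m Qp xs] +
      splitSum₃ (fun A B C => treeM m Qp (A.map eps ++ P (treeM m Qp B) :: C)) xs = 0 := by
  have hQ := hm [] []
  simp only [List.nil_append] at hQ
  have hMmul := hm.treeM Qp
  induction h : xs.length using Nat.strong_induction_on generalizing xs with
  | _ n ih =>
    subst h
    -- the morphism equation for shorter lists
    have hE : ∀ B : List V, B.length < xs.length → (∀ x ∈ B, m [x] = 0) →
        forestSum m Qp m B =
          splitSum₃ (fun A B C => treeF m Qp (A.map eps ++ P (treeM m Qp B) :: C)) B := by
      intro B hB hB0
      have hX := ih _ hB B hB0 rfl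
      have hs : m [single B] = 0 := by
        rcases B with _ | ⟨b, _ | ⟨b', B⟩⟩
        · simpa [single] using hQ.map_zero
        · simpa [single] using hB0 b (by simp)
        · simpa [single] using hQ.map_zero
      have h1 : splitSum₃ (fun A B C => if A = [] ∧ C = [] then P (treeM m Qp B) else 0) B =
          P (treeM m Qp B) := by
        rw [splitSum₃_eq_single]
        · simp
        · intro A B C _ h; simp [h]
      have h2 : splitSum₃ (fun A B C => treeF m Qp (A.map eps ++ P (treeM m Qp B) :: C)) B =
          P (treeM m Qp B) - Qp (splitSum₃ (fun A B C =>
            treeM m Qp (A.map eps ++ P (treeM m Qp B) :: C)) B) := by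
        rw [← h1, sub_eq_add_neg, ← LinearMap.neg_apply, map_splitSum₃, ← splitSum₃_add]
        refine splitSum₃_congr fun A B' C hABC => ?_
        rw [treeF_eq, LinearMap.neg_apply, sub_eq_add_neg]
        congr 1
        split_ifs with h
        · obtain ⟨rfl, rfl⟩ := h
          simp at hABC
          simp [single]
        · rcases A with _ | ⟨a, _ | ⟨b, A⟩⟩ <;> rcases C with _ | ⟨c, C⟩ <;> simp [single] at h ⊢
      rw [forestSum_eq_add Qp hm hm0, h2, treeF_eq, hQ.map_sub, hs, hP,
        eq_neg_of_add_eq_zero_right hX, map_neg]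
      abel
    have hrel' : forestSum m Qp (fun l =>
        m [m l] + splitSum₃ (fun A B C => higher m (A.map eps ++ m B :: C)) l) xs = 0 := by
      simp only [splitSum₃_higher hrel, forestSum_zero]
    have hQm : forestSum m Qp (fun l => m [m l]) xs = m [treeM m Qp xs] := by
      have := map_forestSum m Qp hQ.mk' m xs
      simp only [IsLinearMap.mk'_apply] at this
      rw [← this, forestSum_eq_add Qp hm hm0, hQ.map_add, hQQ, zero_add]
    rw [forestSum_add, hQm, forestSum_map_splitSum₃] at hrel'
    rw [← hrel']
    congr 1
    symm
    rw [splitSum₃_congr (g := fun A B C => splitSum₃ (fun A' B' C' =>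
      forestSum m Qp (fun l₁ => forestSum m Qp (fun l₂ =>
        higher m (l₁ ++ treeF m Qp (A'.map eps ++ P (treeM m Qp B') :: C') :: l₂)) C) (A.map eps)) B)]
    · rw [splitSum₃_splitSum₃ (fun A A' B' C' C => forestSum m Qp (fun l₁ => forestSum m Qp (fun l₂ =>
        higher m (l₁ ++ treeF m Qp (A'.map eps ++ P (treeM m Qp B') :: C') :: l₂)) C) (A.map eps))]
      refine splitSum₃_congr fun A B C _ => ?_
      rw [treeM_append_cons hm, splitSum_map]
    · intro A B C hABC
      simp only [forestSum_map_parity hε hQε]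
      by_cases h0 : A = [] ∧ C = []
      · obtain ⟨rfl, rfl⟩ := h0
        have h1 : ∀ y : V, higher m [y] = 0 := by simp [higher]
        simp [forestSum_nil, h1, forestSum_zero, splitSum₃_zero]
      have hl : B.length < xs.length := by
        rw [← hABC]
        simp only [List.length_append]
        rcases A with _ | ⟨a, A⟩
        · rcases C with _ | ⟨c, C⟩
          · simp at h0
          · simp
        · simp; omega
      have hB := hE B hl (fun x hx => hxs x (by rw [← hABC]; simp [hx]))
      simp only [← forestSum_splitSum₃_comm]
      congr 1
      funext l₁
      congr 1
      funext l₃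
      have hL := hm.higher (l₁.map eps) l₃
      have h1 := map_forestSum m Qp hL.mk' m B
      have h2 := map_splitSum₃ hL.mk'
        (fun A B C => treeF m Qp (A.map eps ++ P (treeM m Qp B) :: C)) B
      rw [← hB, h1] at h2
      exact h2

/-- The forests in front of a multilinear operation of arity at least two whose last tree is the
leaf `x`. -/
def lastLeaf (m : List V → V) (Qp : V →ₗ[ℂ] V) (C : List V) (x : V) : V :=
  forestSum m Qp (fun l => higher m (l ++ [x])) C

theorem lastLeaf_nil (x : V) : lastLeaf m Qp [] x = 0 := by
  simp [lastLeaf, forestSum_nil, higher]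

theorem splitSum_single_append {E : Type*} [AddCommGroup E] [Module ℂ E] {f : List V → V → E}
    (hf : ∀ B, IsLinearMap ℂ (f B)) (xs : List V) (x : V) :
    splitSum (fun B C => f B (single (C ++ [x]))) xs = f xs x := by
  rw [splitSum_eq_add_of_last, splitSum_congr (g := fun _ _ => 0), splitSum_zero]
  · simp [single]
  · intro B C _
    rcases C with _ | ⟨c, _ | ⟨c', C⟩⟩ <;> simp [single, (hf B).map_zero]

theorem splitSum_single_cons {E : Type*} [AddCommGroup E] [Module ℂ E] {f : V → List V → E}
    (hf : ∀ C, IsLinearMap ℂ (fun v => f v C)) (xs : List V) (x : V) :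
    splitSum (fun B C => f (single (x :: B)) C) xs = f x xs := by
  have h0 : ∀ C, f 0 C = 0 := fun C => (hf C).map_zero
  cases xs with
  | nil => simp [splitSum_nil, single]
  | cons y ys =>
    rw [splitSum_cons, splitSum_congr (g := fun _ _ => 0), splitSum_zero, add_zero, single]
    intro A B _
    simp [single, h0]

/-- Cutting a tree above the vertex to which its last leaf is attached. -/
theorem treeM_concat (hm : Multilinear m) (xs : List V) (x : V) :
    treeM m Qp (xs ++ [x]) = lastLeaf m Qp xs x +
      splitSum (fun B C => treeM m Qp (B ++ [- Qp (lastLeaf m Qp C x)])) xs := by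
  induction h : xs.length using Nat.strong_induction_on generalizing xs with
  | _ n ih =>
    subst h
    have hM : ∀ ys y, treeM m Qp (ys ++ [y]) = splitSum (fun A₁ A₂ => forestSum m Qp (fun l =>
        higher m (l ++ [treeF m Qp (A₂ ++ [y])])) A₁) ys := by
      intro ys y
      rw [treeM_append_cons hm]
      simp only [splitSum_nil, forestSum_nil]
    have hlin : ∀ B, IsLinearMap ℂ
        (fun v => forestSum m Qp (fun l => higher m (l ++ [v])) B) := fun B =>
      IsLinearMap.forestSum m Qp fun l => hm.higher l []
    have hF : ∀ C : List V, C.length < xs.length → treeF m Qp (C ++ [x]) = single (C ++ [x]) +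
        splitSum (fun C₁ C₂ => treeF m Qp (C₁ ++ [- Qp (lastLeaf m Qp C₂ x)])) C := by
      intro C hC
      rw [treeF_eq, ih _ hC C rfl, map_add, map_splitSum]
      simp only [treeF_eq, sub_eq_add_neg, splitSum_add]
      have h1 : splitSum (fun A B => single (A ++ [- Qp (lastLeaf m Qp B x)])) C =
          - Qp (lastLeaf m Qp C x) := by
        cases C with
        | nil => simp [splitSum_nil, single]
        | cons c C =>
          rw [splitSum_cons, splitSum_congr (g := fun _ _ => 0), splitSum_zero]
          · simp [single]
          · intro A B _
            rcases A with _ | ⟨a, A⟩ <;> simp [single]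
      have h2 := map_splitSum (-(LinearMap.id : V →ₗ[ℂ] V)) (fun A B =>
        Qp (treeM m Qp (A ++ [- Qp (lastLeaf m Qp B x)]))) C
      simp only [LinearMap.neg_apply, LinearMap.id_apply] at h2
      rw [h1, ← h2]
      abel
    rw [hM]
    rw [splitSum_congr (g := fun B C =>
      forestSum m Qp (fun l => higher m (l ++ [single (C ++ [x])])) B +
      splitSum (fun C₁ C₂ => forestSum m Qp (fun l =>
        higher m (l ++ [treeF m Qp (C₁ ++ [- Qp (lastLeaf m Qp C₂ x)])])) B) C)]
    · rw [splitSum_add, splitSum_single_append hlin, splitSum_assoc (fun B C₁ C₂ =>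
        forestSum m Qp (fun l =>
          higher m (l ++ [treeF m Qp (C₁ ++ [- Qp (lastLeaf m Qp C₂ x)])])) B)]
      simp only [hM, lastLeaf]
    · intro B C hBC
      rcases B with _ | ⟨b, B⟩
      · have h1 : ∀ y : V, higher m [y] = 0 := by simp [higher]
        simp [forestSum_nil, h1, splitSum_zero]
      · have := map_splitSum (hlin (b :: B)).mk'
          (fun C₁ C₂ => treeF m Qp (C₁ ++ [- Qp (lastLeaf m Qp C₂ x)])) C
        simp only [IsLinearMap.mk'_apply] at this
        rw [hF C (by rw [← hBC]; simp), ← this]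
        exact (hlin (b :: B)).map_add _ _

/-- Cyclic invariance of the sum over all planar trees. -/
theorem treeM_cyclic (hm : Multilinear m) {w : V →ₗ[ℂ] V →ₗ[ℂ] ℂ}
    (hcyc : ∀ x y xs, w x (m (y :: xs)) = w (eps y) (m (xs ++ [x])))
    (hskew : ∀ x y, w y x = - w x y) (hpar : ∀ x y, w (eps x) (eps y) = - w x y)
    (hQε : ∀ x, Qp (eps x) = - eps (Qp x))
    (hsym : ∀ x z, w (Qp x) z = w x (Qp (eps z))) (x y : V) (xs : List V) :
    w x (treeM m Qp (y :: xs)) = w (eps y) (treeM m Qp (xs ++ [x])) := by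
  induction h : xs.length using Nat.strong_induction_on generalizing x y xs with
  | _ n ih =>
    subst h
    have h0 := treeM_append_cons (Qp := Qp) hm [] y xs
    simp only [splitSum_nil, forestSum_nil, List.nil_append] at h0
    have hc : ∀ v l, w x (higher m (v :: l)) = w (eps v) (higher m (l ++ [x])) := by
      intro v l
      simp only [higher, List.length_cons, List.length_append, List.length_nil]
      split_ifs
      · exact hcyc _ _ _
      · simp
    have hlin : ∀ C, IsLinearMap ℂ (fun v => w (eps v) (lastLeaf m Qp C x)) := fun C =>
      ⟨fun a b => by simp, fun a b => by simp⟩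
    rw [h0, treeM_concat hm, map_add, map_splitSum, map_splitSum]
    simp only [map_forestSum, hc]
    simp only [← map_forestSum]
    rw [← splitSum_single_cons hlin, ← splitSum_add]
    refine splitSum_congr fun B C hBC => ?_
    change w (eps (treeF m Qp (y :: B))) (lastLeaf m Qp C x) = _
    rw [treeF_eq, map_sub, map_sub, LinearMap.sub_apply, sub_eq_add_neg]
    congr 1
    rcases C with _ | ⟨c, C⟩
    · rw [lastLeaf_nil]
      simp [(hm.treeM Qp).map_zero]
    · rw [← ih B.length (by rw [← hBC]; simp) _ _ _ rfl, ← neg_neg (eps (Qp _)), ← hQε, map_neg,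
        LinearMap.neg_apply, neg_neg, hsym, hQε, map_neg, hpar, neg_neg, hskew]
      simp

end Transfer

end BVTree

namespace BVTree

/-! ### Addresses of the vertices of a rooted planar tree -/

namespace PTree

theorem induction {motive : PTree → Prop} (leaf : motive leaf)
    (node : ∀ cs, (∀ c ∈ cs, motive c) → motive (node cs)) : ∀ Γ, motive Γ
  | .leaf => leaf
  | .node cs => node cs fun c hc =>
    have := List.sizeOf_lt_of_mem hc
    induction leaf node c

/-- The subtree above the `i`-th incoming edge of the lowest vertex. -/
def child (i : ℕ) : PTree → Option PTree
  | leaf => none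
  | node cs => cs[i]?

/-- The subtree at an address. An address lists the edges to be followed from the root, the last
one first, so that the address `i :: p` belongs to the `i`-th child of the vertex at `p`. -/
def sub (Γ : PTree) : List ℕ → Option PTree
  | [] => some Γ
  | i :: p => (sub Γ p).bind (child i)

/-- There is a vertex at the address `p`. -/
def IsVertex (Γ : PTree) (p : List ℕ) : Prop := ∃ cs, Γ.sub p = some (node cs)

/-- The number of incoming edges of the vertex at the address `p`. -/
def arity (Γ : PTree) (p : List ℕ) : ℕ :=
  match Γ.sub p with
  | some (node cs) => cs.length
  | _ => 0

theorem arity_eq {Γ : PTree} {p : List ℕ} {cs : List PTree} (h : Γ.sub p = some (node cs)) :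
    Γ.arity p = cs.length := by
  simp [arity, h]

theorem sub_cons {Γ : PTree} {p : List ℕ} {cs : List PTree} (h : Γ.sub p = some (node cs)) (i : ℕ) :
    Γ.sub (i :: p) = cs[i]? := by
  simp [sub, h, child]

theorem sub_cons_eq_some {Γ t : PTree} {p : List ℕ} {i : ℕ} (h : Γ.sub (i :: p) = some t) :
    ∃ cs, Γ.sub p = some (node cs) ∧ ∃ hi : i < cs.length, cs[i] = t := by
  rw [sub, Option.bind_eq_some_iff] at h
  obtain ⟨t', h1, h2⟩ := h
  rcases t' with _ | cs
  · simp [child] at h2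
  · exact ⟨cs, h1, by simpa [child, List.getElem?_eq_some_iff] using h2⟩

theorem IsVertex.of_cons {Γ : PTree} {p : List ℕ} {i : ℕ} (h : Γ.IsVertex (i :: p)) :
    Γ.IsVertex p ∧ i < Γ.arity p := by
  obtain ⟨cs, h⟩ := h
  obtain ⟨cs', h1, h2, -⟩ := sub_cons_eq_some h
  exact ⟨⟨cs', h1⟩, by rwa [arity_eq h1]⟩

theorem IsVertex.of_append {Γ : PTree} {p : List ℕ} : ∀ {s : List ℕ}, Γ.IsVertex (s ++ p) →
    Γ.IsVertex p
  | [], h => h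
  | _ :: _, h => IsVertex.of_append h.of_cons.1

theorem isVertex_nil_node (cs : List PTree) : (node cs).IsVertex [] := ⟨cs, rfl⟩

theorem not_isVertex_leaf : ∀ p : List ℕ, ¬ leaf.IsVertex p
  | [], h => by obtain ⟨cs, h⟩ := h; simp [sub] at h
  | _ :: p, h => not_isVertex_leaf p h.of_cons.1

theorem sub_append_singleton (cs : List PTree) (i : ℕ) : ∀ p : List ℕ,
    (node cs).sub (p ++ [i]) = cs[i]?.bind (fun c => c.sub p)
  | [] => by cases h : cs[i]? <;> simp [sub, child, h]
  | j :: p => by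
    rw [List.cons_append, sub, sub_append_singleton cs i p]
    cases cs[i]? <;> simp [sub]

theorem finite_sub (Γ : PTree) : {p | (Γ.sub p).isSome}.Finite := by
  induction Γ using PTree.induction with
  | leaf =>
    refine (Set.finite_singleton []).subset ?_
    rintro (_ | ⟨i, p⟩) hp
    · rfl
    · simp only [Set.mem_ofPred_eq, Option.isSome_iff_exists] at hp
      obtain ⟨t, ht⟩ := hp
      obtain ⟨cs, h, -⟩ := sub_cons_eq_some ht
      exact absurd ⟨cs, h⟩ (not_isVertex_leaf p)
  | node cs ih =>
    have : (⋃ i : Fin cs.length, (fun p => p ++ [i.1]) '' {p | (cs[i].sub p).isSome}).Finite :=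
      Set.finite_iUnion fun i => (ih _ (List.getElem_mem i.2)).image _
    refine ((Set.finite_singleton []).union this).subset ?_
    intro p hp
    rcases List.eq_nil_or_concat p with rfl | ⟨q, i, rfl⟩
    · simp
    · right
      rw [List.concat_eq_append, Set.mem_ofPred_eq, sub_append_singleton, Option.isSome_bind] at hp
      have hi : i < cs.length := by
        by_contra hi
        simp [List.getElem?_eq_none (not_lt.1 hi)] at hp
      rw [List.getElem?_eq_getElem hi] at hp
      exact Set.mem_iUnion.2 ⟨⟨i, hi⟩, q, hp, by simp⟩

/-- The vertices of a rooted planar tree. -/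
abbrev Vert (Γ : PTree) : Type := {p : List ℕ // Γ.IsVertex p}

instance (Γ : PTree) : Finite Γ.Vert :=
  (Γ.finite_sub.subset (by rintro p ⟨cs, h⟩; simp [h])).to_subtype

theorem IsVertex.length_lt {Γ : PTree} {p : List ℕ} (hp : Γ.IsVertex p) :
    p.length < Nat.card Γ.Vert := by
  have hv : ∀ j, Γ.IsVertex (p.drop j) := fun j =>
    IsVertex.of_append (s := p.take j) (by rwa [List.take_append_drop])
  have hinj : Function.Injective (fun j : Fin (p.length + 1) => (⟨p.drop j, hv j⟩ : Γ.Vert)) := by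
    intro i j h
    have := congrArg List.length (Subtype.ext_iff.1 h)
    simp only [List.length_drop] at this
    have := i.2; have := j.2
    ext; omega
  have := Nat.card_le_card_of_injective _ hinj
  rw [Nat.card_eq_fintype_card, Fintype.card_fin] at this
  exact this

theorem leavesList_eq_sum : ∀ cs : List PTree, leavesList cs = (cs.map leaves).sum
  | [] => rfl
  | c :: cs => by simp [leavesList, leavesList_eq_sum cs]

theorem stableList_iff : ∀ {cs : List PTree}, StableList cs ↔ ∀ c ∈ cs, c.Stable
  | [] => by simp [StableList]
  | c :: cs => by simp [StableList, stableList_iff (cs := cs)]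

/-- The addresses of the leaves. -/
abbrev LeafAddress (Γ : PTree) : Type := {p : List ℕ // Γ.sub p = some leaf}

instance (Γ : PTree) : Finite Γ.LeafAddress :=
  (Γ.finite_sub.subset (by intro p (h : Γ.sub p = some leaf); simp [h])).to_subtype

theorem card_leafAddress (Γ : PTree) : Nat.card Γ.LeafAddress = Γ.leaves := by
  induction Γ using PTree.induction with
  | leaf =>
    have : Unique (LeafAddress leaf) :=
      { default := ⟨[], rfl⟩
        uniq := by
          rintro ⟨_ | ⟨i, p⟩, hp⟩
          · rfl
          · exfalso
            have : ∀ p : List ℕ, ∀ cs, leaf.sub p ≠ some (node cs) := by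
              intro p
              induction p with
              | nil => intro cs; simp [sub]
              | cons i p ih =>
                intro cs h
                obtain ⟨cs, h, -⟩ := sub_cons_eq_some h
                exact ih cs h
            obtain ⟨cs, h, -⟩ := sub_cons_eq_some hp
            exact this p cs h }
    rw [Nat.card_unique]; rfl
  | node cs ih =>
    let f : (Σ i : Fin cs.length, (cs[i]).LeafAddress) → (node cs).LeafAddress := fun x =>
      ⟨x.2.1 ++ [x.1.1], by
        have := x.2.2
        rw [sub_append_singleton, List.getElem?_eq_getElem x.1.2]
        exact this⟩
    have hf : Function.Bijective f := by
      constructor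
      · rintro ⟨i, p, hp⟩ ⟨j, q, hq⟩ h
        have h := Subtype.ext_iff.1 h
        simp only [f] at h
        obtain ⟨rfl, h2⟩ := List.append_inj' h rfl
        have h2 : i = j := by ext; simpa using h2
        subst h2; rfl
      · rintro ⟨p, hp⟩
        rcases List.eq_nil_or_concat p with rfl | ⟨q, i, rfl⟩
        · simp [sub] at hp
        · have hp' := hp
          rw [List.concat_eq_append, sub_append_singleton, Option.bind_eq_some_iff] at hp'
          obtain ⟨c, h1, h2⟩ := hp'
          obtain ⟨hi, rfl⟩ := List.getElem?_eq_some_iff.1 h1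
          exact ⟨⟨⟨i, hi⟩, q, h2⟩, by ext1; simp [f]⟩
    rw [← Nat.card_eq_of_bijective f hf, Nat.card_sigma, leaves, leavesList_eq_sum,
      ← Fin.sum_univ_fun_getElem]
    refine Finset.sum_congr rfl fun i _ => ih _ (List.getElem_mem i.2)

/-- The half edges of a rooted planar tree: at each vertex, `0` is the half edge towards the root
and `i + 1` is the half edge towards the `i`-th child. -/
abbrev Half (Γ : PTree) : Type := Σ v : Γ.Vert, Fin (Γ.arity v.1 + 1)

open Classical in
/-- The pairing of the half edges in the internal edges, on the level of addresses. -/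
def pairingAux (Γ : PTree) : List ℕ × ℕ → List ℕ × ℕ
  | (p, j + 1) => if Γ.IsVertex (j :: p) then (j :: p, 0) else (p, j + 1)
  | ([], 0) => ([], 0)
  | (i :: p, 0) => (p, i + 1)

theorem pairingAux_mem {Γ : PTree} : ∀ {x : List ℕ × ℕ}, Γ.IsVertex x.1 → x.2 < Γ.arity x.1 + 1 →
    Γ.IsVertex (Γ.pairingAux x).1 ∧ (Γ.pairingAux x).2 < Γ.arity (Γ.pairingAux x).1 + 1
  | (p, j + 1), h, h' => by
    simp only [pairingAux]
    split_ifs with h1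
    · exact ⟨h1, Nat.succ_pos _⟩
    · exact ⟨h, h'⟩
  | ([], 0), h, _ => ⟨h, Nat.succ_pos _⟩
  | (i :: p, 0), h, _ => ⟨h.of_cons.1, Nat.succ_lt_succ h.of_cons.2⟩

theorem pairingAux_pairingAux {Γ : PTree} : ∀ {x : List ℕ × ℕ}, Γ.IsVertex x.1 →
    Γ.pairingAux (Γ.pairingAux x) = x
  | (p, j + 1), h => by
    by_cases h1 : Γ.IsVertex (j :: p) <;> simp [pairingAux, h1]
  | ([], 0), _ => rfl
  | (i :: p, 0), h => by
    change Γ.pairingAux (p, i + 1) = _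
    have h : Γ.IsVertex (i :: p) := h
    simp [pairingAux, h]

/-- The pairing of the half edges of a rooted planar tree; the root and the leaves are fixed. -/
def pairing (Γ : PTree) (x : Γ.Half) : Γ.Half :=
  ⟨⟨(Γ.pairingAux (x.1.1, x.2.1)).1, (pairingAux_mem x.1.2 x.2.2).1⟩,
    ⟨(Γ.pairingAux (x.1.1, x.2.1)).2, (pairingAux_mem x.1.2 x.2.2).2⟩⟩

theorem Half.ext' {Γ : PTree} : ∀ {x y : Γ.Half}, x.1.1 = y.1.1 → x.2.1 = y.2.1 → x = y
  | ⟨⟨_, _⟩, ⟨_, _⟩⟩, ⟨⟨_, _⟩, ⟨_, _⟩⟩, h, h' => by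
    simp only at h h'; subst h; subst h'; rfl

theorem pairing_involutive (Γ : PTree) : Function.Involutive Γ.pairing := by
  intro x
  have := pairingAux_pairingAux (Γ := Γ) (x := (x.1.1, x.2.1)) x.1.2
  exact Half.ext' (congrArg Prod.fst this) (congrArg Prod.snd this)

theorem card_pairing_fixed (cs : List PTree) :
    Nat.card {x // (node cs).pairing x = x} = (node cs).leaves + 1 := by
  set Γ := node cs with hΓ
  have hnil : Γ.IsVertex [] := isVertex_nil_node cs
  have hleaf : ∀ a : Γ.LeafAddress, ∃ x : {x // Γ.pairing x = x}, ∃ i p, a.1 = i :: p ∧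
      x.1.1.1 = p ∧ x.1.2.1 = i + 1 := by
    rintro ⟨_ | ⟨i, p⟩, ha⟩
    · simp [sub, hΓ] at ha
    · obtain ⟨cs', h1, hi, h2⟩ := sub_cons_eq_some ha
      have hnv : ¬ Γ.IsVertex (i :: p) := by
        rintro ⟨cs'', h⟩; simp [ha] at h
      refine ⟨⟨⟨⟨p, cs', h1⟩, ⟨i + 1, by simp [arity_eq h1, hi]⟩⟩, ?_⟩, i, p, rfl, rfl, rfl⟩
      exact Half.ext' (by simp [pairing, pairingAux, hnv]) (by simp [pairing, pairingAux, hnv])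
  choose g hg using hleaf
  let f : Option Γ.LeafAddress → {x // Γ.pairing x = x} := fun a =>
    a.elim ⟨⟨⟨[], hnil⟩, 0⟩, Half.ext' (by simp [pairing, pairingAux]) (by simp [pairing, pairingAux])⟩ g
  have hf : Function.Bijective f := by
    constructor
    · rintro (_ | a) (_ | b) h
      · rfl
      · obtain ⟨i, p, h1, h2, h3⟩ := hg b
        have h : _ = g b := h
        rw [← h] at h3; simp [f] at h3
      · obtain ⟨i, p, h1, h2, h3⟩ := hg a
        have h : g a = _ := h
        rw [h] at h3; simp [f] at h3
      · obtain ⟨i, p, h1, h2, h3⟩ := hg a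
        obtain ⟨i', p', h1', h2', h3'⟩ := hg b
        have h : g a = g b := h
        rw [h] at h2 h3
        rw [h2] at h2'
        rw [h3] at h3'
        congr 1
        ext1
        rw [h1, h1', h2', Nat.succ_injective h3']
    · rintro ⟨⟨⟨p, hp⟩, ⟨_ | j, hj⟩⟩, hx⟩
      · refine ⟨none, ?_⟩
        rcases p with _ | ⟨i, p⟩
        · rfl
        · have := congrArg (fun x : Γ.Half => x.2.1) hx
          simp [pairing, pairingAux] at this
      · have hnv : ¬ Γ.IsVertex (j :: p) := by
          intro h
          have := congrArg (fun x : Γ.Half => x.2.1) hx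
          simp [pairing, pairingAux, h] at this
        have hl : Γ.sub (j :: p) = some leaf := by
          obtain ⟨cs', h1⟩ := hp
          rw [arity_eq h1] at hj
          rw [sub_cons h1, List.getElem?_eq_getElem (by omega)]
          rcases h2 : cs'[j] with _ | cs''
          · rfl
          · exact absurd ⟨cs'', by rw [sub_cons h1, List.getElem?_eq_getElem (by omega), h2]⟩ hnv
        refine ⟨some ⟨j :: p, hl⟩, ?_⟩
        obtain ⟨i', p', h1', h2', h3'⟩ := hg ⟨j :: p, hl⟩
        simp only [List.cons.injEq] at h1'
        exact Subtype.ext (Half.ext' (h2'.trans h1'.2.symm)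
          (h3'.trans (congrArg Nat.succ h1'.1.symm)))
  rw [← Nat.card_eq_of_bijective f hf, Finite.card_option, card_leafAddress]

theorem Stable.two_le_arity {Γ : PTree} (hΓ : Γ.Stable) {p : List ℕ} (hp : Γ.IsVertex p) :
    2 ≤ Γ.arity p := by
  have : ∀ p t, Γ.sub p = some t → t.Stable := by
    intro p
    induction p with
    | nil => intro t ht; simp only [sub, Option.some.injEq] at ht; exact ht ▸ hΓ
    | cons i p ih =>
      intro t ht
      obtain ⟨cs, h1, hi, rfl⟩ := sub_cons_eq_some ht
      exact stableList_iff.1 (ih _ h1).2 _ (List.getElem_mem hi)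
  obtain ⟨cs, h⟩ := hp
  rw [arity_eq h]
  exact (this _ _ h).1

end PTree

end BVTree

namespace BVTree

namespace TreeContraction

open PTree

variable {n : ℕ} (G : TreeContraction n)

theorem e_pos (q : Fin G.N) : 0 < G.e q := lt_of_lt_of_le (by norm_num) (G.three_le q)

theorem half_ext {e : Fin n → ℕ} : ∀ {x y : Σ q, Fin (e q)}, x.1 = y.1 → x.2.1 = y.2.1 → x = y
  | ⟨_, ⟨_, _⟩⟩, ⟨_, ⟨_, _⟩⟩, h, h' => by
    simp only at h h'; subst h; subst h'; rfl

theorem next_zero (h : Σ q, Fin (G.e q)) : G.next h 0 = h :=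
  half_ext rfl (by simp [next, Nat.mod_eq_of_lt h.2.2])

theorem next_inj {h : Σ q, Fin (G.e q)} {i j : ℕ} (hi : i < G.e h.1) (hj : j < G.e h.1)
    (hij : G.next h i = G.next h j) : i = j := by
  have h1 : (h.2.1 + i) % G.e h.1 = (h.2.1 + j) % G.e h.1 := by
    simp only [next, Sigma.mk.injEq, heq_eq_eq, true_and, Fin.mk.injEq] at hij
    exact hij
  have h2 : i % G.e h.1 = j % G.e h.1 := Nat.ModEq.add_left_cancel' _ h1
  rwa [Nat.mod_eq_of_lt hi, Nat.mod_eq_of_lt hj] at h2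

theorem exists_next {h k : Σ q, Fin (G.e q)} (hk : k.1 = h.1) :
    ∃ j < G.e h.1, G.next h j = k := by
  obtain ⟨q, i⟩ := h
  obtain ⟨q', j⟩ := k
  obtain rfl : q' = q := hk
  refine ⟨(j + (G.e q' - i)) % G.e q', Nat.mod_lt _ (G.e_pos _), half_ext rfl ?_⟩
  simp only [next, Nat.add_mod_mod]
  have : i.1 + (j + (G.e q' - i)) = j + G.e q' := by omega
  rw [this, Nat.add_mod_right, Nat.mod_eq_of_lt j.2]

/-- The graph underlying a contraction. -/
def graph : SimpleGraph (Fin G.N) := SimpleGraph.fromRel (fun p q => ∃ h, h.1 = p ∧ (G.σ h).1 = q)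

theorem graph_isTree : G.graph.IsTree := G.isTree

/-- The half edge through which the vertex at an address is entered from the half edge `h`. -/
def entry (h : Σ q, Fin (G.e q)) : List ℕ → Σ q, Fin (G.e q)
  | [] => h
  | i :: p => G.σ (G.next (entry h p) (i + 1))

/-- The address can be followed along internal edges. -/
def Valid (h : Σ q, Fin (G.e q)) : List ℕ → Prop
  | [] => True
  | i :: p => Valid h p ∧ i + 1 < G.e (G.entry h p).1 ∧
      G.σ (G.next (G.entry h p) (i + 1)) ≠ G.next (G.entry h p) (i + 1)

/-- The vertices passed on the way to an address. -/
def trail (h : Σ q, Fin (G.e q)) : List ℕ → List (Fin G.N)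
  | [] => [h.1]
  | i :: p => (G.entry h (i :: p)).1 :: trail h p

theorem length_trail (h : Σ q, Fin (G.e q)) : ∀ p, (G.trail h p).length = p.length + 1
  | [] => rfl
  | _ :: p => by simp [trail, length_trail h p]

/-- The edges passed on the way to an address. -/
def trailEdges (h : Σ q, Fin (G.e q)) : List ℕ → List (Sym2 (Fin G.N))
  | [] => []
  | i :: p => s((G.entry h (i :: p)).1, (G.entry h p).1) :: trailEdges h p

variable {G}
variable {h : Σ q, Fin (G.e q)}

theorem Valid.adj {i : ℕ} {p : List ℕ} (hp : G.Valid h (i :: p)) :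
    G.graph.Adj (G.entry h (i :: p)).1 (G.entry h p).1 := by
  rw [graph, SimpleGraph.fromRel_adj]
  exact ⟨G.no_self_edge _ hp.2.2, Or.inr ⟨G.next (G.entry h p) (i + 1), rfl, rfl⟩⟩

theorem Valid.isChain {p : List ℕ} (hp : G.Valid h p) :
    List.IsChain (· ≠ ·) (G.trailEdges h p) := by
  induction p with
  | nil => exact List.isChain_nil
  | cons i p ih =>
    rcases p with _ | ⟨j, p⟩
    · exact List.isChain_singleton _
    · refine List.isChain_cons_cons.2 ⟨?_, ih hp.1⟩
      intro heq
      have hne := hp.adj.ne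
      have h1 : (G.entry h (i :: j :: p)).1 = (G.entry h p).1 := by
        rcases Sym2.eq_iff.1 heq with ⟨h1, _⟩ | ⟨h1, _⟩
        · exact absurd h1 hne
        · exact h1
      have hinv : G.σ (G.entry h (j :: p)) = G.next (G.entry h p) (j + 1) := G.involutive _
      have := G.no_double_edge (G.next (G.entry h (j :: p)) (i + 1)) (G.entry h (j :: p)) hp.2.2
        (by rw [hinv]; exact hp.1.2.2.symm) rfl (by rw [hinv]; exact h1)
      rw [← G.next_zero (G.entry h (j :: p))] at this
      have := G.next_inj (h := G.entry h (j :: p)) hp.2.1 (G.e_pos _) (by simpa [G.next_zero] using this)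
      omega

theorem Valid.exists_walk {p : List ℕ} (hp : G.Valid h p) :
    ∃ w : G.graph.Walk (G.entry h p).1 h.1, w.IsPath ∧ w.support = G.trail h p := by
  suffices ∃ w : G.graph.Walk (G.entry h p).1 h.1,
      w.edges = G.trailEdges h p ∧ w.support = G.trail h p by
    obtain ⟨w, h1, h2⟩ := this
    refine ⟨w, ?_, h2⟩
    rw [SimpleGraph.IsAcyclic.isPath_iff_isChain G.graph_isTree.isAcyclic, h1]
    exact hp.isChain
  induction p with
  | nil => exact ⟨.nil, rfl, rfl⟩
  | cons i p ih =>
    obtain ⟨w, h1, h2⟩ := ih hp.1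
    exact ⟨.cons hp.adj w, by simp [trailEdges, h1], by simp [trail, h2]⟩

theorem eq_of_trail_eq {p p' : List ℕ} (hp : G.Valid h p) (hp' : G.Valid h p')
    (heq : G.trail h p = G.trail h p') : p = p' := by
  induction p generalizing p' with
  | nil =>
    have := congrArg List.length heq
    simp only [length_trail, List.length_nil] at this
    exact (List.length_eq_zero_iff.1 (by omega)).symm
  | cons i p ih =>
    rcases p' with _ | ⟨i', p'⟩
    · have := congrArg List.length heq
      simp [length_trail] at this
    · simp only [trail, List.cons.injEq] at heq
      obtain rfl := ih hp.1 hp'.1 heq.2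
      have := G.no_double_edge _ _ hp.2.2 hp'.2.2 rfl heq.1
      have := G.next_inj hp.2.1 hp'.2.1 this
      simpa using this

theorem eq_of_entry_eq {p p' : List ℕ} (hp : G.Valid h p) (hp' : G.Valid h p')
    (heq : (G.entry h p).1 = (G.entry h p').1) : p = p' := by
  obtain ⟨w, hw, hs⟩ := hp.exists_walk
  obtain ⟨w', hw', hs'⟩ := hp'.exists_walk
  refine eq_of_trail_eq hp hp' ?_
  rw [← hs, ← hs']
  clear hs hs'
  generalize (G.entry h p).1 = a at *
  subst heq
  have := G.graph_isTree.isAcyclic.subsingleton_path (G.entry h p').1 h.1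
  exact congrArg (fun w => w.1.support) (Subsingleton.elim
    (⟨w, hw⟩ : G.graph.Path _ _) ⟨w', hw'⟩)

theorem Valid.length_lt {p : List ℕ} (hp : G.Valid h p) : p.length < G.N := by
  obtain ⟨w, hw, hs⟩ := hp.exists_walk
  have := hw.support_nodup.length_le_card
  rw [hs, length_trail, Fintype.card_fin] at this
  exact this

theorem exists_valid (hh : G.σ h = h) (a : Fin G.N) : ∃ p, G.Valid h p ∧ (G.entry h p).1 = a := by
  have hr := G.isTree.connected.preconnected h.1 a
  rw [SimpleGraph.reachable_iff_reflTransGen] at hr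
  induction hr with
  | refl => exact ⟨[], trivial, rfl⟩
  | @tail b c _ hbc ih =>
    obtain ⟨p, hp, rfl⟩ := ih
    obtain ⟨hne, hk⟩ := (SimpleGraph.fromRel_adj _ _ _).1 hbc
    have : ∃ k, k.1 = (G.entry h p).1 ∧ (G.σ k).1 = c := by
      rcases hk with hk | ⟨k, h1, h2⟩
      · exact hk
      · exact ⟨G.σ k, h2, by rw [G.involutive k]; exact h1⟩
    obtain ⟨k, h1, h2⟩ := this
    obtain ⟨j, hj, rfl⟩ := G.exists_next h1
    rcases j with _ | i
    · rw [G.next_zero] at h2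
      rcases p with _ | ⟨i, p⟩
      · exact absurd (by rw [← h2]; exact congrArg Sigma.fst hh.symm) hne
      · refine ⟨p, hp.1, ?_⟩
        rw [← h2, entry, G.involutive]; rfl
    · refine ⟨i :: p, ⟨hp, hj, fun heq => ?_⟩, h2⟩
      rw [heq] at h2
      exact hne h2

variable (G)

/-- `Φ` identifies the contraction `G` with the rooted planar tree `Γ`: it gives the half edge towards
the root at each vertex of `Γ`. -/
structure Framing (Γ : PTree) (Φ : List ℕ → Σ q, Fin (G.e q)) : Prop where
  root : G.σ (Φ []) = Φ []
  inj : ∀ p q, Γ.IsVertex p → Γ.IsVertex q → (Φ p).1 = (Φ q).1 → p = q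
  surj : ∀ a, ∃ p, Γ.IsVertex p ∧ (Φ p).1 = a
  valence : ∀ p, Γ.IsVertex p → G.e (Φ p).1 = Γ.arity p + 1
  internal : ∀ p i, Γ.IsVertex (i :: p) → G.σ (G.next (Φ p) (i + 1)) = Φ (i :: p)
  external : ∀ p i, Γ.IsVertex p → i < Γ.arity p → ¬ Γ.IsVertex (i :: p) →
    G.σ (G.next (Φ p) (i + 1)) = G.next (Φ p) (i + 1)

variable {G}

theorem sub_unfold {k : ℕ} {p : List ℕ} (hp : G.Valid h p) (hk : p.length ≤ k) :
    (G.unfold k h).sub p = some (G.unfold (k - p.length) (G.entry h p)) := by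
  induction p with
  | nil => simp [sub, entry]
  | cons i p ih =>
    simp only [List.length_cons] at hk
    obtain ⟨l, hl⟩ : ∃ l, k - p.length = l + 1 := ⟨k - p.length - 1, by omega⟩
    have h1 := ih hp.1 (by omega)
    rw [hl, unfold] at h1
    have hi : i < G.e (G.entry h p).1 - 1 := by have := hp.2.1; omega
    rw [sub_cons h1, List.getElem?_map, List.getElem?_range hi, Option.map_some, if_neg hp.2.2,
      List.length_cons, show k - (p.length + 1) = l by omega, entry]

theorem isVertex_unfold_iff {p : List ℕ} : (G.unfold G.N h).IsVertex p ↔ G.Valid h p := by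
  constructor
  · induction p with
    | nil => exact fun _ => trivial
    | cons i p ih =>
      intro hp
      have hv := ih hp.of_cons.1
      obtain ⟨cs, hcs⟩ := hp
      have hlt := hv.length_lt
      obtain ⟨l, hl⟩ : ∃ l, G.N - p.length = l + 1 := ⟨G.N - p.length - 1, by omega⟩
      have h1 := sub_unfold hv hlt.le
      rw [hl, unfold] at h1
      rw [sub_cons h1, List.getElem?_eq_some_iff] at hcs
      obtain ⟨hi, hcs⟩ := hcs
      simp only [List.length_map, List.length_range] at hi
      rw [List.getElem_map, List.getElem_range] at hcs
      refine ⟨hv, by omega, fun heq => ?_⟩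
      rw [if_pos heq] at hcs
      simp at hcs
  · intro hv
    have hlt := hv.length_lt
    obtain ⟨l, hl⟩ : ∃ l, G.N - p.length = l + 1 := ⟨G.N - p.length - 1, by omega⟩
    have h1 := sub_unfold hv hlt.le
    rw [hl, unfold] at h1
    exact ⟨_, h1⟩

theorem arity_unfold {p : List ℕ} (hv : G.Valid h p) :
    G.e (G.entry h p).1 = (G.unfold G.N h).arity p + 1 := by
  have hlt := hv.length_lt
  obtain ⟨l, hl⟩ : ∃ l, G.N - p.length = l + 1 := ⟨G.N - p.length - 1, by omega⟩
  have h1 := sub_unfold hv hlt.le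
  rw [hl, unfold] at h1
  rw [arity_eq h1, List.length_map, List.length_range]
  have := G.e_pos (G.entry h p).1
  omega

theorem framing_entry (hh : G.σ h = h) : G.Framing (G.rootedAt h) (G.entry h) where
  root := hh
  inj p q hp hq := eq_of_entry_eq (isVertex_unfold_iff.1 hp) (isVertex_unfold_iff.1 hq)
  surj a := by
    obtain ⟨p, hp, h⟩ := exists_valid hh a
    exact ⟨p, isVertex_unfold_iff.2 hp, h⟩
  valence p hp := arity_unfold (isVertex_unfold_iff.1 hp)
  internal _ _ _ := rfl
  external p i hp hi hn := by
    rw [rootedAt, isVertex_unfold_iff] at hn hp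
    have h1 := arity_unfold hp
    by_contra h
    exact hn ⟨hp, by rw [h1]; exact Nat.succ_lt_succ hi, h⟩

theorem stable_unfold : ∀ (k : ℕ) (h : Σ q, Fin (G.e q)), (G.unfold k h).Stable
  | 0, h => trivial
  | k + 1, h => by
    rw [unfold, Stable, stableList_iff]
    have := G.three_le h.1
    refine ⟨by rw [List.length_map, List.length_range]; omega, fun c hc => ?_⟩
    obtain ⟨i, -, rfl⟩ := List.mem_map.1 hc
    split_ifs
    · trivial
    · exact stable_unfold k _

namespace Framing

variable {Γ : PTree} {Φ : List ℕ → Σ q, Fin (G.e q)}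

theorem entry_eq (hΦ : G.Framing Γ Φ) {p : List ℕ} (hp : Γ.IsVertex p) : G.entry (Φ []) p = Φ p := by
  induction p with
  | nil => rfl
  | cons i p ih => rw [entry, ih hp.of_cons.1, hΦ.internal p i hp]

theorem bijective (hΦ : G.Framing Γ Φ) : Function.Bijective (fun v : Γ.Vert => (Φ v.1).1) :=
  ⟨fun v w h => Subtype.ext (hΦ.inj _ _ v.2 w.2 h), fun a => by
    obtain ⟨p, hp, h⟩ := hΦ.surj a
    exact ⟨⟨p, hp⟩, h⟩⟩

theorem card_vert (hΦ : G.Framing Γ Φ) : Nat.card Γ.Vert = G.N := by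
  rw [Nat.card_eq_of_bijective _ hΦ.bijective, Nat.card_eq_fintype_card, Fintype.card_fin]

theorem unfold_eq (hΦ : G.Framing Γ Φ) (k : ℕ) {p : List ℕ} (hp : Γ.IsVertex p)
    (hk : ∀ s, Γ.IsVertex (s ++ p) → s.length < k) : Γ.sub p = some (G.unfold k (Φ p)) := by
  induction k generalizing p with
  | zero => exact absurd (hk [] hp) (by simp)
  | succ k ih =>
    obtain ⟨cs, hcs⟩ := hp
    have hp : Γ.IsVertex p := ⟨cs, hcs⟩
    have hval := hΦ.valence p hp
    rw [arity_eq hcs] at hval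
    rw [hcs, unfold]
    congr 2
    refine List.ext_getElem (by rw [List.length_map, List.length_range]; omega) fun i hi _ => ?_
    rw [List.getElem_map, List.getElem_range]
    have hsub : Γ.sub (i :: p) = some cs[i] := by rw [sub_cons hcs, List.getElem?_eq_getElem hi]
    split_ifs with hfix
    · rcases hc : cs[i] with _ | cs'
      · rfl
      · have hv : Γ.IsVertex (i :: p) := ⟨cs', by rw [hsub, hc]⟩
        rw [hΦ.internal p i hv] at hfix
        have h1 : (Φ (i :: p)).1 = (G.next (Φ p) (i + 1)).1 := congrArg Sigma.fst hfix
        have := hΦ.inj _ _ hv hp h1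
        simp at this
    · have hv : Γ.IsVertex (i :: p) := by
        by_contra hv
        exact hfix (hΦ.external p i hp (by rwa [arity_eq hcs]) hv)
      have := ih hv (fun s hs => by
        have := hk (s ++ [i]) (by simpa using hs)
        simp only [List.length_append, List.length_singleton] at this
        omega)
      rw [hsub, Option.some.injEq] at this
      rw [this, hΦ.internal p i hv]

theorem rootedAt_eq (hΦ : G.Framing Γ Φ) : G.rootedAt (Φ []) = Γ := by
  have hv : Γ.IsVertex [] := by
    obtain ⟨p, hp, -⟩ := hΦ.surj ⟨0, by
      have := (Φ []).1.2; omega⟩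
    exact IsVertex.of_append (s := p) (by simpa using hp)
  have := hΦ.unfold_eq G.N hv (fun s hs => by
    rw [← hΦ.card_vert]
    have := hs.length_lt
    simpa using this)
  rw [sub, Option.some.injEq] at this
  exact this.symm

/-- The half edges of `G` are those of `Γ`. -/
theorem bijective_half (hΦ : G.Framing Γ Φ) : Function.Bijective
    (fun x : Γ.Half => G.next (Φ x.1.1) x.2.1) := by
  constructor
  · rintro ⟨⟨p, hp⟩, i⟩ ⟨⟨q, hq⟩, j⟩ h
    have h0 : (G.next (Φ p) i).1 = (G.next (Φ q) j).1 := congrArg Sigma.fst h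
    obtain rfl := hΦ.inj p q hp hq h0
    have h1 := hΦ.valence p hp
    have := G.next_inj (by rw [h1]; exact i.2) (by rw [h1]; exact j.2) h
    exact Half.ext' rfl this
  · intro k
    obtain ⟨p, hp, h⟩ := hΦ.surj k.1
    obtain ⟨j, hj, h⟩ := G.exists_next h.symm
    rw [hΦ.valence p hp] at hj
    exact ⟨⟨⟨p, hp⟩, ⟨j, hj⟩⟩, h⟩

theorem pairing_eq (hΦ : G.Framing Γ Φ) (x : Γ.Half) :
    G.next (Φ (Γ.pairing x).1.1) (Γ.pairing x).2.1 = G.σ (G.next (Φ x.1.1) x.2.1) := by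
  obtain ⟨⟨p, hp⟩, ⟨j, hj⟩⟩ := x
  simp only [pairing]
  rcases j with _ | i
  · rcases p with _ | ⟨i, p⟩
    · simp only [pairingAux, G.next_zero, hΦ.root]
    · simp only [pairingAux, G.next_zero]
      rw [← hΦ.internal p i hp, G.involutive]
  · by_cases hv : Γ.IsVertex (i :: p)
    · simp only [pairingAux, if_pos hv, G.next_zero, hΦ.internal p i hv]
    · simp only [pairingAux, if_neg hv]
      exact (hΦ.external p i hp (Nat.lt_of_succ_lt_succ hj) hv).symm

theorem leaves_eq (hΦ : G.Framing Γ Φ) : Γ.leaves + 1 = n := by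
  have hv : Γ.IsVertex [] := by
    obtain ⟨p, hp, -⟩ := hΦ.surj (Φ []).1
    exact IsVertex.of_append (s := p) (by simpa using hp)
  obtain ⟨cs, hcs⟩ := hv
  simp only [sub, Option.some.injEq] at hcs
  subst hcs
  rw [← card_pairing_fixed, ← G.card_free]
  refine Nat.card_congr (Equiv.subtypeEquiv (Equiv.ofBijective _ hΦ.bijective_half) fun x => ?_)
  rw [Equiv.ofBijective_apply, ← hΦ.pairing_eq]
  exact ⟨fun h => by rw [h], fun h => hΦ.bijective_half.1 h⟩

end Framing

theorem leaves_rootedAt (hh : G.σ h = h) : (G.rootedAt h).leaves + 1 = n :=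
  (framing_entry hh).leaves_eq

end TreeContraction

end BVTree

namespace BVTree

namespace PTree

/-- The vertex below a vertex; the lowest vertex is sent to itself. -/
def parent {Γ : PTree} (v : Γ.Vert) : Γ.Vert :=
  ⟨v.1.tail, by
    obtain ⟨_ | ⟨i, p⟩, hp⟩ := v
    · exact hp
    · exact hp.of_cons.1⟩

theorem pairing_cases {Γ : PTree} (x : Γ.Half) (hx : Γ.pairing x ≠ x) :
    (x.2.1 = 0 ∧ (∃ i, x.1.1 = i :: (Γ.pairing x).1.1 ∧ (Γ.pairing x).2.1 = i + 1)) ∨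
      ∃ i, x.2.1 = i + 1 ∧ (Γ.pairing x).1.1 = i :: x.1.1 ∧ (Γ.pairing x).2.1 = 0 := by
  obtain ⟨⟨p, hp⟩, ⟨_ | i, hj⟩⟩ := x
  · rcases p with _ | ⟨i, p⟩
    · exact absurd (Half.ext' (by simp [pairing, pairingAux]) (by simp [pairing, pairingAux])) hx
    · exact Or.inl ⟨rfl, i, by simp [pairing, pairingAux], by simp [pairing, pairingAux]⟩
  · by_cases hv : Γ.IsVertex (i :: p)
    · exact Or.inr ⟨i, rfl, by simp [pairing, pairingAux, hv], by simp [pairing, pairingAux, hv]⟩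
    · exact absurd (Half.ext' (by simp [pairing, pairingAux, hv])
        (by simp [pairing, pairingAux, hv])) hx

theorem pairing_fst_ne {Γ : PTree} {x : Γ.Half} (hx : Γ.pairing x ≠ x) :
    (Γ.pairing x).1 ≠ x.1 := by
  intro h
  have h := congrArg (fun v : Γ.Vert => v.1.length) h
  rcases pairing_cases x hx with ⟨_, i, h1, _⟩ | ⟨i, _, h1, _⟩ <;> simp [h1] at h

theorem eq_of_pairing_fst_eq {Γ : PTree} {x y : Γ.Half} (hx : Γ.pairing x ≠ x)
    (hy : Γ.pairing y ≠ y) (h : x.1 = y.1) (h' : (Γ.pairing x).1 = (Γ.pairing y).1) : x = y := by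
  have h := congrArg Subtype.val h
  have h' := congrArg Subtype.val h'
  rcases pairing_cases x hx with ⟨h0, i, h1, _⟩ | ⟨i, h0, h1, _⟩ <;>
    rcases pairing_cases y hy with ⟨h0', i', h1', _⟩ | ⟨i', h0', h1', _⟩
  · exact Half.ext' h (h0.trans h0'.symm)
  · have := congrArg List.length (h'.trans h1')
    rw [← h, h1] at this
    simp at this
    omega
  · have := congrArg List.length (h'.symm.trans h1)
    rw [h, h1'] at this
    simp at this
    omega
  · rw [h1, h1', h] at h'
    simp only [List.cons.injEq, and_true] at h'
    exact Half.ext' h (by rw [h0, h0', h'])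

end PTree

open PTree

/-- A labelling of the vertices of `Γ` by an initial segment of the natural numbers, in the order of
their valences, and a choice of the first half edge at each vertex. -/
structure Labelling (Γ : PTree) where
  /-- The labels of the vertices. -/
  vert : Γ.Vert ≃ Fin (Nat.card Γ.Vert)
  mono : Monotone fun q => Γ.arity (vert.symm q).1
  /-- The label of the half edge towards the root. -/
  offset : ∀ v : Γ.Vert, Fin (Γ.arity v.1 + 1)

namespace Labelling

variable {Γ : PTree} (L : Labelling Γ)

/-- The valence of a labelled vertex. -/
def valence (q : Fin (Nat.card Γ.Vert)) : ℕ := Γ.arity (L.vert.symm q).1 + 1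

theorem valence_vert (v : Γ.Vert) : L.valence (L.vert v) = Γ.arity v.1 + 1 := by
  simp [valence]

/-- The label of a half edge. -/
def half (x : Γ.Half) : Σ q, Fin (L.valence q) :=
  ⟨L.vert x.1, ⟨((L.offset x.1).1 + x.2.1) % L.valence (L.vert x.1), Nat.mod_lt _ (Nat.succ_pos _)⟩⟩

theorem half_bijective : Function.Bijective L.half := by
  constructor
  · rintro ⟨v, i⟩ ⟨w, j⟩ h
    obtain rfl := L.vert.injective (congrArg Sigma.fst h)
    simp only [half, Sigma.mk.injEq, heq_eq_eq, true_and, Fin.mk.injEq] at h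
    have h2 := Nat.ModEq.add_left_cancel' _ h
    have hi : i.1 < L.valence (L.vert v) := i.2.trans_eq (L.valence_vert v).symm
    have hj : j.1 < L.valence (L.vert v) := j.2.trans_eq (L.valence_vert v).symm
    unfold Nat.ModEq at h2
    rw [Nat.mod_eq_of_lt hi, Nat.mod_eq_of_lt hj] at h2
    exact Half.ext' rfl h2
  · rintro ⟨q, j⟩
    obtain ⟨v, rfl⟩ := L.vert.surjective q
    refine ⟨⟨v, ⟨(j + (Γ.arity v.1 + 1 - L.offset v)) % (Γ.arity v.1 + 1),
      Nat.mod_lt _ (Nat.succ_pos _)⟩⟩, TreeContraction.half_ext rfl ?_⟩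
    have hj := j.2
    have ho := (L.offset v).2
    simp only [half, L.valence_vert, Nat.add_mod_mod] at hj ⊢
    have : (L.offset v).1 + (j + (Γ.arity v.1 + 1 - L.offset v)) = j + (Γ.arity v.1 + 1) := by omega
    rw [this, Nat.add_mod_right, Nat.mod_eq_of_lt hj]

/-- The half edges of `Γ` and their labels. -/
def halfEquiv : Γ.Half ≃ Σ q, Fin (L.valence q) := Equiv.ofBijective _ L.half_bijective

theorem halfEquiv_fst (x : Γ.Half) : (L.halfEquiv x).1 = L.vert x.1 := rfl

/-- The pairing of the labels of half edges. -/
def pair (k : Σ q, Fin (L.valence q)) : Σ q, Fin (L.valence q) :=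
  L.halfEquiv (Γ.pairing (L.halfEquiv.symm k))

theorem pair_halfEquiv (x : Γ.Half) : L.pair (L.halfEquiv x) = L.halfEquiv (Γ.pairing x) := by
  simp [pair]

theorem pair_involutive : Function.Involutive L.pair := fun k => by
  simp [pair, Γ.pairing_involutive (L.halfEquiv.symm k)]

theorem isTree_pair (hΓ : Γ.IsVertex []) :
    (SimpleGraph.fromRel (fun p q => ∃ h, h.1 = p ∧ (L.pair h).1 = q)).IsTree := by
  set gr := SimpleGraph.fromRel (fun p q => ∃ h, h.1 = p ∧ (L.pair h).1 = q) with hgr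
  have hadj : ∀ i p, ∀ hp : Γ.IsVertex (i :: p),
      gr.Adj (L.vert ⟨i :: p, hp⟩) (L.vert ⟨p, hp.of_cons.1⟩) := by
    intro i p hp
    rw [hgr, SimpleGraph.fromRel_adj]
    refine ⟨fun h => ?_, Or.inl ⟨L.halfEquiv ⟨⟨i :: p, hp⟩, 0⟩, rfl, ?_⟩⟩
    · have := congrArg (fun v : Γ.Vert => v.1.length) (L.vert.injective h)
      simp at this
    · rw [pair_halfEquiv, halfEquiv_fst]
      congr 1
  have hreach : ∀ p, ∀ hp : Γ.IsVertex p, gr.Reachable (L.vert ⟨p, hp⟩) (L.vert ⟨[], hΓ⟩) := by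
    intro p
    induction p with
    | nil => intro _; exact SimpleGraph.Reachable.refl _
    | cons i p ih => intro hp; exact (hadj i p hp).reachable.trans (ih hp.of_cons.1)
  have hconn : gr.Connected := by
    have : Nonempty (Fin (Nat.card Γ.Vert)) := ⟨L.vert ⟨[], hΓ⟩⟩
    refine SimpleGraph.Connected.mk fun a b => ?_
    obtain ⟨v, rfl⟩ := L.vert.surjective a
    obtain ⟨w, rfl⟩ := L.vert.surjective b
    exact (hreach v.1 v.2).trans (hreach w.1 w.2).symm
  rw [SimpleGraph.isTree_iff_connected_and_card]
  refine ⟨hconn, le_antisymm ?_ hconn.card_vert_le_card_edgeSet_add_one⟩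
  have hsub : gr.edgeSet ⊆ (fun v => s(L.vert v, L.vert (parent v))) '' {⟨[], hΓ⟩}ᶜ := by
    intro ed
    induction ed using Sym2.ind with
    | _ a b =>
    intro hab
    rw [SimpleGraph.mem_edgeSet, hgr, SimpleGraph.fromRel_adj] at hab
    obtain ⟨hne, hab⟩ := hab
    have key : ∀ a b, a ≠ b → (∃ h, h.1 = a ∧ (L.pair h).1 = b) →
        s(a, b) ∈ (fun v => s(L.vert v, L.vert (parent v))) '' {⟨[], hΓ⟩}ᶜ := by
      rintro a b hne ⟨k, rfl, rfl⟩
      obtain ⟨x, rfl⟩ := L.halfEquiv.surjective k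
      rw [pair_halfEquiv, halfEquiv_fst, halfEquiv_fst] at hne ⊢
      rcases pairing_cases x (fun h => hne (by rw [h])) with ⟨_, i, h1, _⟩ | ⟨i, _, h1, _⟩
      · refine ⟨x.1, ?_, ?_⟩
        · simp only [Set.mem_compl_iff, Set.mem_singleton_iff, Subtype.ext_iff, h1]; simp
        · have : parent x.1 = (Γ.pairing x).1 := Subtype.ext (by simp [parent, h1])
          simp only [this]
      · refine ⟨(Γ.pairing x).1, ?_, ?_⟩
        · simp only [Set.mem_compl_iff, Set.mem_singleton_iff, Subtype.ext_iff, h1]; simp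
        · have : parent (Γ.pairing x).1 = x.1 := Subtype.ext (by simp [parent, h1])
          simp only [this]
          exact Sym2.eq_swap
    rcases hab with hab | hab
    · exact key a b hne hab
    · rw [Sym2.eq_swap]
      exact key b a hne.symm hab
  have h1 := (Set.ncard_le_ncard hsub (Set.toFinite _)).trans (Set.ncard_image_le (Set.toFinite _))
  have h2 := Set.ncard_add_ncard_compl ({⟨[], hΓ⟩} : Set Γ.Vert)
  rw [Set.ncard_singleton] at h2
  have h3 : Nat.card (Fin (Nat.card Γ.Vert)) = Nat.card Γ.Vert := by simp
  rw [Nat.card_coe_set_eq, h3]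
  omega

/-- The contraction given by a labelling. -/
def contraction {n : ℕ} (hs : Γ.Stable) (hv : Γ.IsVertex []) (hn : Γ.leaves + 1 = n) :
    TreeContraction n where
  N := Nat.card Γ.Vert
  e := L.valence
  mono _ _ h := Nat.succ_le_succ (L.mono h)
  three_le q := Nat.succ_le_succ (hs.two_le_arity (L.vert.symm q).2)
  σ := L.pair
  involutive := L.pair_involutive
  card_free := by
    obtain ⟨cs, hcs⟩ := hv
    simp only [sub, Option.some.injEq] at hcs
    subst hcs
    rw [← hn, ← card_pairing_fixed]
    refine (Nat.card_congr (Equiv.subtypeEquiv L.halfEquiv fun x => ?_)).symm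
    rw [pair_halfEquiv]
    exact L.halfEquiv.injective.eq_iff.symm
  isTree := L.isTree_pair hv
  no_self_edge k hk := by
    obtain ⟨x, rfl⟩ := L.halfEquiv.surjective k
    rw [pair_halfEquiv] at hk ⊢
    exact fun h => pairing_fst_ne (fun h => hk (by rw [h])) (L.vert.injective h)
  no_double_edge k k' hk hk' h h' := by
    obtain ⟨x, rfl⟩ := L.halfEquiv.surjective k
    obtain ⟨y, rfl⟩ := L.halfEquiv.surjective k'
    rw [pair_halfEquiv] at hk hk' h'
    rw [pair_halfEquiv] at h'
    exact congrArg _ (eq_of_pairing_fst_eq (fun h => hk (by rw [h])) (fun h => hk' (by rw [h]))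
      (L.vert.injective h) (L.vert.injective h'))

open Classical in
/-- The label of the half edge towards the root at a vertex. -/
def rootward (hv : Γ.IsVertex []) (p : List ℕ) : Σ q, Fin (L.valence q) :=
  if hp : Γ.IsVertex p then L.halfEquiv ⟨⟨p, hp⟩, 0⟩ else L.halfEquiv ⟨⟨[], hv⟩, 0⟩

theorem rootward_eq (hv : Γ.IsVertex []) {p : List ℕ} (hp : Γ.IsVertex p) :
    L.rootward hv p = L.halfEquiv ⟨⟨p, hp⟩, 0⟩ := dif_pos hp

theorem next_halfEquiv {n : ℕ} (hs : Γ.Stable) (hv : Γ.IsVertex []) (hn : Γ.leaves + 1 = n)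
    (v : Γ.Vert) (i : Fin (Γ.arity v.1 + 1)) :
    (L.contraction hs hv hn).next (L.halfEquiv ⟨v, 0⟩) i.1 = L.halfEquiv ⟨v, i⟩ := by
  refine TreeContraction.half_ext (e := L.valence) rfl ?_
  change (((L.offset v).1 + 0) % L.valence (L.vert v) + i.1) % L.valence (L.vert v) =
    ((L.offset v).1 + i.1) % L.valence (L.vert v)
  rw [add_zero, Nat.mod_add_mod]

theorem framing {n : ℕ} (hs : Γ.Stable) (hv : Γ.IsVertex []) (hn : Γ.leaves + 1 = n) :
    (L.contraction hs hv hn).Framing Γ (L.rootward hv) where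
  root := by
    rw [rootward_eq L hv hv]
    exact (L.pair_halfEquiv _).trans (congrArg _ (Half.ext' rfl rfl))
  inj p q hp hq h := by
    rw [rootward_eq L hv hp, rootward_eq L hv hq] at h
    exact congrArg Subtype.val (L.vert.injective h)
  surj a := by
    obtain ⟨v, rfl⟩ := L.vert.surjective a
    exact ⟨v.1, v.2, by rw [rootward_eq L hv v.2]; rfl⟩
  valence p hp := by
    rw [rootward_eq L hv hp]
    exact L.valence_vert _
  internal p i hp := by
    obtain ⟨hp', hi⟩ := hp.of_cons
    rw [rootward_eq L hv hp, rootward_eq L hv hp']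
    rw [L.next_halfEquiv hs hv hn ⟨p, hp'⟩ ⟨i + 1, Nat.succ_lt_succ hi⟩]
    refine (L.pair_halfEquiv _).trans (congrArg _ (Half.ext' ?_ ?_)) <;>
      simp [pairing, pairingAux, hp]
  external p i hp hi hn' := by
    rw [rootward_eq L hv hp]
    rw [L.next_halfEquiv hs hv hn ⟨p, hp⟩ ⟨i + 1, Nat.succ_lt_succ hi⟩]
    refine (L.pair_halfEquiv _).trans (congrArg _ (Half.ext' ?_ ?_)) <;>
      simp [pairing, pairingAux, hn']

end Labelling

end BVTree

namespace BVTree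

open PTree

theorem card_equiv_monotone {α : Type*} {N : ℕ} (b : α ≃ Fin N) (f : Fin N → ℕ) (hf : Monotone f) :
    Nat.card {β : α ≃ Fin N // Monotone fun q => f (b (β.symm q))} =
      ∏ l ∈ Finset.univ.image f, (Nat.card {q // f q = l}).factorial := by
  classical
  have h1 : Nat.card {β : α ≃ Fin N // Monotone fun q => f (b (β.symm q))} =
      Nat.card {g : Equiv.Perm (Fin N) // f ∘ g = f} := by
    refine Nat.card_congr (Equiv.subtypeEquiv
      ⟨fun β => β.symm.trans b, fun g => (g.trans b.symm).symm, fun β => ?_, fun g => ?_⟩ fun β => ?_)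
    · ext; simp
    · ext; simp
    · constructor
      · intro h
        exact Tuple.unique_monotone (σ := β.symm.trans b) (τ := 1) h hf
      · intro h
        have : (fun q => f (b (β.symm q))) = f := h
        rw [this]; exact hf
  rw [h1, Nat.card_eq_fintype_card, DomMulAct.stabilizer_card' f]
  simp only [Nat.card_eq_fintype_card]

namespace Labelling

/-- A labelling is a numbering of the vertices together with the labels of the half edges towards the
root. -/
def equivProd (Γ : PTree) : Labelling Γ ≃
    {β : Γ.Vert ≃ Fin (Nat.card Γ.Vert) // Monotone fun q => Γ.arity (β.symm q).1} ×
      ∀ v : Γ.Vert, Fin (Γ.arity v.1 + 1) where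
  toFun L := (⟨L.vert, L.mono⟩, L.offset)
  invFun x := ⟨x.1.1, x.1.2, x.2⟩
  left_inv _ := rfl
  right_inv _ := rfl

instance (Γ : PTree) : Nonempty (Labelling Γ) :=
  ⟨{ vert := (Finite.equivFin Γ.Vert).trans
        (Tuple.sort fun q => Γ.arity ((Finite.equivFin Γ.Vert).symm q).1).symm
     mono := Tuple.monotone_sort fun q => Γ.arity ((Finite.equivFin Γ.Vert).symm q).1
     offset := fun _ => 0 }⟩

instance (Γ : PTree) : Finite (Labelling Γ) := Finite.of_equiv _ (equivProd Γ).symm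

end Labelling

namespace TreeContraction

variable {n : ℕ}

/-- Contractions with a free end chosen as root. -/
abbrev Rooted (n : ℕ) : Type := Σ G : TreeContraction n, {h // G.σ h = h}

/-- The planar tree of a rooted contraction. -/
def Rooted.tree (x : Rooted n) : PTree := x.1.rootedAt x.2.1

theorem Framing.card_labelling {G : TreeContraction n} {Γ : PTree}
    {Φ : List ℕ → Σ q, Fin (G.e q)} (hΦ : G.Framing Γ Φ) :
    Nat.card (Labelling Γ) =
      (∏ l ∈ Finset.univ.image G.e, (Nat.card {q // G.e q = l}).factorial) * ∏ q, G.e q := by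
  have := Fintype.ofFinite Γ.Vert
  rw [Nat.card_congr (Labelling.equivProd Γ), Nat.card_prod, Nat.card_pi]
  congr 1
  · rw [← card_equiv_monotone (Equiv.ofBijective _ hΦ.bijective) G.e G.mono, hΦ.card_vert]
    refine Nat.card_congr (Equiv.subtypeEquivRight fun β => ?_)
    have : ∀ q, G.e (Equiv.ofBijective _ hΦ.bijective (β.symm q)) = Γ.arity (β.symm q).1 + 1 :=
      fun q => hΦ.valence _ (β.symm q).2
    simp only [this]
    exact ⟨fun h a b hab => Nat.succ_le_succ (h hab), fun h a b hab => Nat.le_of_succ_le_succ (h hab)⟩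
  · refine Fintype.prod_equiv (Equiv.ofBijective _ hΦ.bijective) _ _ fun v => ?_
    rw [Nat.card_eq_fintype_card, Fintype.card_fin]
    exact (hΦ.valence v.1 v.2).symm

theorem Framing.weight_eq {G : TreeContraction n} {Γ : PTree}
    {Φ : List ℕ → Σ q, Fin (G.e q)} (hΦ : G.Framing Γ Φ) :
    G.weight = (Nat.card (Labelling Γ) : ℂ)⁻¹ := by
  rw [hΦ.card_labelling, weight, Nat.cast_mul, mul_inv, Nat.cast_prod, Nat.cast_prod,
    Finset.prod_inv_distrib, Finset.prod_inv_distrib]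

theorem Rooted.ext_framing {Γ : PTree} (hv : Γ.IsVertex []) : ∀ {G G' : TreeContraction n}
    {Φ : List ℕ → Σ q, Fin (G.e q)} {Φ' : List ℕ → Σ q, Fin (G'.e q)}
    (hΦ : G.Framing Γ Φ) (hΦ' : G'.Framing Γ Φ')
    (_ : ∀ p, Γ.IsVertex p → (Φ p).1.1 = (Φ' p).1.1 ∧ (Φ p).2.1 = (Φ' p).2.1),
    (⟨G, Φ [], hΦ.root⟩ : Rooted n) = ⟨G', Φ' [], hΦ'.root⟩ := by
  intro G G' Φ Φ' hΦ hΦ' h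
  have hN : G.N = G'.N := hΦ.card_vert.symm.trans hΦ'.card_vert
  obtain ⟨N, e, hm, h3, σ, hi, hc, ht, hs, hd⟩ := G
  obtain ⟨N', e', hm', h3', σ', hi', hc', ht', hs', hd'⟩ := G'
  simp only at hN
  subst hN
  have he : e = e' := by
    funext a
    obtain ⟨p, hp, rfl⟩ := hΦ.surj a
    have h1 := hΦ.valence p hp
    have h2 := hΦ'.valence p hp
    have h0 : (Φ p).1 = (Φ' p).1 := Fin.ext (h p hp).1
    rw [← h0] at h2
    exact h1.trans h2.symm
  subst he
  have hΦΦ : ∀ p, Γ.IsVertex p → Φ p = Φ' p := fun p hp => half_ext (Fin.ext (h p hp).1) (h p hp).2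
  have hσ : σ = σ' := by
    funext k
    obtain ⟨x, rfl⟩ := hΦ.bijective_half.2 k
    have h1 := hΦ.pairing_eq x
    have h2 := hΦ'.pairing_eq x
    rw [hΦΦ _ x.1.2, hΦΦ _ (Γ.pairing x).1.2] at h1
    simp only [hΦΦ _ x.1.2]
    exact h1.symm.trans h2
  subst hσ
  simp only [hΦΦ _ hv]

/-- The rooted contractions with a given planar tree correspond to the labellings of this tree. -/
theorem bijective_labelling {Γ : PTree} (hs : Γ.Stable) (hv : Γ.IsVertex [])
    (hn : Γ.leaves + 1 = n) : Function.Bijective (fun L : Labelling Γ =>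
      (⟨⟨L.contraction hs hv hn, L.rootward hv [], (L.framing hs hv hn).root⟩,
        (L.framing hs hv hn).rootedAt_eq⟩ : {x : Rooted n // x.tree = Γ})) := by
  constructor
  · intro L L' h
    have h := congrArg Subtype.val h
    have hraw : ∀ p, Γ.IsVertex p → (L.rootward hv p).1.1 = (L'.rootward hv p).1.1 ∧
        (L.rootward hv p).2.1 = (L'.rootward hv p).2.1 := by
      intro p hp
      have h' := congrArg (fun x : Rooted n => ((x.1.entry x.2.1 p).1.1, (x.1.entry x.2.1 p).2.1)) h
      have h' := Prod.mk.inj h'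
      have e := (L.framing hs hv hn).entry_eq hp
      have e' := (L'.framing hs hv hn).entry_eq hp
      have e₁ := congrArg (fun k : Σ q, Fin (L.valence q) => k.1.1) e
      have e₁' := congrArg (fun k : Σ q, Fin (L'.valence q) => k.1.1) e'
      have e₂ := congrArg (fun k : Σ q, Fin (L.valence q) => k.2.1) e
      have e₂' := congrArg (fun k : Σ q, Fin (L'.valence q) => k.2.1) e'
      exact ⟨e₁.symm.trans (h'.1.trans e₁'), e₂.symm.trans (h'.2.trans e₂')⟩
    have h1 : L.vert = L'.vert := by
      ext v
      have := (hraw v.1 v.2).1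
      rw [L.rootward_eq hv v.2, L'.rootward_eq hv v.2] at this
      exact this
    have h2 : L.offset = L'.offset := by
      funext v
      have := (hraw v.1 v.2).2
      rw [L.rootward_eq hv v.2, L'.rootward_eq hv v.2] at this
      change ((L.offset v).1 + 0) % L.valence (L.vert v) =
        ((L'.offset v).1 + 0) % L'.valence (L'.vert v) at this
      rw [L.valence_vert, L'.valence_vert, add_zero, add_zero, Nat.mod_eq_of_lt (L.offset v).2,
        Nat.mod_eq_of_lt (L'.offset v).2] at this
      exact Fin.ext this
    cases L; cases L'
    simp only at h1 h2
    subst h1; subst h2; rfl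
  · rintro ⟨⟨G, h, hh⟩, hx⟩
    have hΦ := framing_entry hh
    change G.rootedAt h = Γ at hx
    rw [hx] at hΦ
    let b : Γ.Vert ≃ Fin (Nat.card Γ.Vert) :=
      (Equiv.ofBijective _ hΦ.bijective).trans (finCongr hΦ.card_vert.symm)
    have hb : ∀ v, (b v).1 = (G.entry h v.1).1.1 := fun v => rfl
    have hbsymm : ∀ q, (G.entry h (b.symm q).1).1 = finCongr hΦ.card_vert q := by
      intro q
      apply Fin.ext
      rw [← hb, Equiv.apply_symm_apply]; rfl
    let L : Labelling Γ :=
      { vert := b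
        mono := by
          intro q q' hq
          have h1 := hΦ.valence _ (b.symm q).2
          have h2 := hΦ.valence _ (b.symm q').2
          rw [hbsymm] at h1 h2
          have := G.mono (a := finCongr hΦ.card_vert q) (b := finCongr hΦ.card_vert q') hq
          rw [h1, h2] at this
          exact Nat.le_of_succ_le_succ this
        offset := fun v => ⟨(G.entry h v.1).2.1, (G.entry h v.1).2.2.trans_eq (hΦ.valence _ v.2)⟩ }
    refine ⟨L, Subtype.ext (Rooted.ext_framing hv (L.framing hs hv hn) hΦ fun p hp => ?_)⟩
    rw [L.rootward_eq hv hp]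
    refine ⟨rfl, ?_⟩
    change ((L.offset ⟨p, hp⟩).1 + 0) % L.valence (L.vert ⟨p, hp⟩) = _
    rw [L.valence_vert, add_zero, Nat.mod_eq_of_lt (L.offset _).2]

theorem Rooted.tree_mem (x : Rooted (n + 1)) : x.tree ∈ treeFinset n := by
  rw [mem_treeFinset]
  refine ⟨stable_unfold _ _, ?_⟩
  have := leaves_rootedAt x.2.2
  unfold Rooted.tree
  omega

theorem isVertex_nil_of_two_le {Γ : PTree} (h : 2 ≤ Γ.leaves) : Γ.IsVertex [] := by
  rcases Γ with _ | cs
  · simp [leaves] at h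
  · exact isVertex_nil_node cs

theorem finite_rooted (hn : 2 ≤ n) : Finite (Rooted (n + 1)) := by
  have : ∀ Γ : treeFinset n, Finite {x : Rooted (n + 1) // x.tree = Γ} := by
    rintro ⟨Γ, hΓ⟩
    rw [mem_treeFinset] at hΓ
    exact Finite.of_surjective _ (bijective_labelling hΓ.1
      (isVertex_nil_of_two_le (by omega)) (by omega)).2
  refine Finite.of_surjective (fun y : Σ Γ : treeFinset n, {x : Rooted (n + 1) // x.tree = Γ} =>
    y.2.1) fun x => ⟨⟨⟨x.tree, x.tree_mem⟩, x, rfl⟩, rfl⟩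

theorem finite_treeContraction (hn : 2 ≤ n) : Finite (TreeContraction (n + 1)) := by
  have := finite_rooted hn
  refine Finite.of_surjective (fun x : Rooted (n + 1) => x.1) fun G => ?_
  have h : 0 < Nat.card {h // G.σ h = h} := by rw [G.card_free]; omega
  obtain ⟨⟨h⟩, -⟩ := Nat.card_pos_iff.1 h
  exact ⟨⟨G, h⟩, rfl⟩

/-- Summing over the weighted contractions and over the choices of a root among the free ends means
summing over all rooted planar trees. -/
theorem finsum_weight_mul (hn : 2 ≤ n) (f : PTree → ℂ) :
    ∑ᶠ G : TreeContraction (n + 1), G.weight * ∑ᶠ h ∈ {h | G.σ h = h}, f (G.rootedAt h) =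
      ∑ Γ ∈ treeFinset n, f Γ := by
  have := finite_treeContraction hn
  have := Fintype.ofFinite (TreeContraction (n + 1))
  classical
  calc _ = ∑ G : TreeContraction (n + 1), ∑ h : {h // G.σ h = h}, G.weight * f (G.rootedAt h) := by
        rw [finsum_eq_sum_of_fintype]
        refine Finset.sum_congr rfl fun G _ => ?_
        rw [← finsum_set_coe_eq_finsum_mem, finsum_eq_sum_of_fintype, Finset.mul_sum]
        rfl
    _ = ∑ x : Rooted (n + 1), x.1.weight * f x.tree := by
        rw [← Finset.univ_sigma_univ, Finset.sum_sigma]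
        rfl
    _ = ∑ Γ ∈ treeFinset n, ∑ x : Rooted (n + 1) with x.tree = Γ, x.1.weight * f x.tree :=
        (Finset.sum_fiberwise_of_maps_to (fun x _ => x.tree_mem) _).symm
    _ = _ := by
        refine Finset.sum_congr rfl fun Γ hΓ => ?_
        rw [mem_treeFinset] at hΓ
        have hv := isVertex_nil_of_two_le (Γ := Γ) (by omega)
        have hcard := Nat.card_eq_of_bijective _
          (bijective_labelling (n := n + 1) hΓ.1 hv (by omega))
        have hconst : ∀ x ∈ Finset.univ.filter (fun x : Rooted (n + 1) => x.tree = Γ),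
            x.1.weight * f x.tree = (Nat.card (Labelling Γ) : ℂ)⁻¹ * f Γ := by
          intro x hx
          have hx : x.tree = Γ := (Finset.mem_filter.1 hx).2
          have hw : x.1.weight = (Nat.card (Labelling x.tree) : ℂ)⁻¹ :=
            (framing_entry x.2.2).weight_eq
          rw [hw, hx]
        rw [Finset.sum_congr rfl hconst, Finset.sum_const, nsmul_eq_mul]
        rw [← Fintype.card_subtype, ← Nat.card_eq_fintype_card, ← hcard, ← mul_assoc,
          mul_inv_cancel₀, one_mul]
        exact Nat.cast_ne_zero.2 Nat.card_pos.ne'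

end TreeContraction

end BVTree

namespace BVTree

/-! ### Multilinear operations on a space with a basis -/

section Extend

variable {I E : Type*} [AddCommGroup E] [Module ℂ E]

theorem extend_cons (c : List I → E) (v : I →₀ ℂ) (vs : List (I →₀ ℂ)) :
    extend c (v :: vs) =
      Finsupp.linearCombination ℂ (fun i => extend (fun w => c (i :: w)) vs) v := by
  simp [extend, Finsupp.linearCombination_apply]

theorem multilinear_extend (c : List I → E) : Multilinear (extend c) := by
  intro A
  induction A generalizing c with
  | nil =>
    intro B
    simp only [List.nil_append, extend_cons]
    exact LinearMap.isLinear _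
  | cons a A ih =>
    intro B
    simp only [List.cons_append, extend_cons, Finsupp.linearCombination_apply, Finsupp.sum]
    constructor
    · intro x y
      simp only [(ih _ B).map_add, smul_add, Finset.sum_add_distrib]
    · intro r x
      simp only [(ih _ B).map_smul, Finset.smul_sum]
      exact Finset.sum_congr rfl fun i _ => smul_comm _ _ _

/-- The list of basis vectors given by a word. -/
def word (w : List I) : List (I →₀ ℂ) := w.map (fun i => Finsupp.single i 1)

theorem extend_word (c : List I → E) (w : List I) : extend c (word w) = c w := by
  induction w generalizing c with
  | nil => rfl
  | cons i w ih =>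
    change extend c (Finsupp.single i 1 :: word w) = _
    rw [extend_cons, Finsupp.linearCombination_single, one_smul, ih]

theorem Multilinear.ext_word {f g : List (I →₀ ℂ) → E} (hf : Multilinear f) (hg : Multilinear g)
    (h : ∀ w, f (word w) = g (word w)) (xs : List (I →₀ ℂ)) : f xs = g xs := by
  suffices ∀ w, f (word w ++ xs) = g (word w ++ xs) from this []
  induction xs with
  | nil => intro w; simpa using h w
  | cons x xs ih =>
    intro w
    induction x using Finsupp.induction_linear with
    | zero => rw [hf.map_zero, hg.map_zero]
    | add x y hx hy => rw [(hf _ _).map_add, (hg _ _).map_add, hx, hy]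
    | single i c =>
      have h1 : (Finsupp.single i c : I →₀ ℂ) = c • Finsupp.single i 1 := by simp
      have h2 := ih (w ++ [i])
      simp only [word, List.map_append, List.map_cons, List.map_nil, List.append_assoc,
        List.singleton_append] at h2 ⊢
      rw [h1, (hf _ _).map_smul, (hg _ _).map_smul, h2]

theorem Multilinear.comp {V F : Type*} [AddCommGroup V] [Module ℂ V] [AddCommGroup F] [Module ℂ F]
    {f : List V → E} (hf : Multilinear f) (φ : E →ₗ[ℂ] F) : Multilinear (fun xs => φ (f xs)) :=
  fun A B => ⟨fun x y => by simp only [(hf A B).map_add, map_add],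
    fun c x => by simp only [(hf A B).map_smul, map_smul]⟩

theorem Multilinear.append {V : Type*} [AddCommGroup V] [Module ℂ V]
    {f : List V → E} (hf : Multilinear f) (L : List V) : Multilinear (fun xs => f (xs ++ L)) := by
  intro A B
  simp only [List.append_assoc, List.cons_append]
  exact hf A (B ++ L)

theorem Multilinear.prepend {V : Type*} [AddCommGroup V] [Module ℂ V]
    {f : List V → E} (hf : Multilinear f) (L : List V) : Multilinear (fun xs => f (L ++ xs)) := by
  intro A B
  simp only [← List.append_assoc]
  exact hf (L ++ A) B

theorem Multilinear.map {V : Type*} [AddCommGroup V] [Module ℂ V]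
    {f : List V → E} (hf : Multilinear f) (e : V →ₗ[ℂ] V) :
    Multilinear (fun xs => f (xs.map e)) := by
  intro A B
  simp only [List.map_append, List.map_cons]
  exact ⟨fun x y => by rw [map_add, (hf _ _).map_add], fun c x => by rw [map_smul, (hf _ _).map_smul]⟩

theorem IsLinearMap.add {V : Type*} [AddCommGroup V] [Module ℂ V] {f g : V → E}
    (hf : IsLinearMap ℂ f) (hg : IsLinearMap ℂ g) : IsLinearMap ℂ (fun x => f x + g x) :=
  (hf.mk' + hg.mk').isLinear

theorem Multilinear.splitSum {V : Type*} [AddCommGroup V] [Module ℂ V] {f : List V → List V → E}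
    (h₁ : ∀ B, Multilinear (fun A => f A B)) (h₂ : ∀ A, Multilinear (f A)) :
    Multilinear (splitSum f) := by
  intro A B
  simp only [splitSum_append_cons]
  exact IsLinearMap.add (IsLinearMap.splitSum fun A₁ A₂ _ => h₂ A₁ A₂ B)
    (IsLinearMap.splitSum fun B₁ B₂ _ => h₁ B₂ A B₁)

theorem Multilinear.splitSum₃ {V : Type*} [AddCommGroup V] [Module ℂ V]
    {f : List V → List V → List V → E} (h₁ : ∀ B C, Multilinear (fun A => f A B C))
    (h₂ : ∀ A C, Multilinear (fun B => f A B C)) (h₃ : ∀ A B, Multilinear (f A B)) :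
    Multilinear (splitSum₃ f) := by
  refine Multilinear.splitSum (fun D A B => ?_) fun A => Multilinear.splitSum (h₂ A) (h₃ A)
  exact IsLinearMap.splitSum fun B₁ C₁ _ => h₁ B₁ C₁ A B

/-- The operation `(A, B, C) ↦ m(ε A, m(B), C)`, summed over all decompositions. -/
theorem Multilinear.relation {V : Type*} [AddCommGroup V] [Module ℂ V] {m : List V → V}
    (hm : Multilinear m) (e : V →ₗ[ℂ] V) :
    Multilinear (BVTree.splitSum₃ (fun A B C => m (A.map e ++ m B :: C))) :=
  Multilinear.splitSum₃ (fun B C => (hm.append (m B :: C)).map e)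
    (fun A C => hm.comp (hm (A.map e) C).mk')
    (fun A B => by simpa using hm.prepend (A.map e ++ [m B]))

end Extend

/-! ### Degrees and parity -/

section Degree

variable {ι : Type*} (d : ι → ℤ)

theorem mem_grade {k : ℤ} {x : BVSpace ι} : x ∈ grade d k ↔ ∀ i, x i ≠ 0 → deg d i = k := by
  simp only [grade, Finsupp.mem_supported, Set.subset_def, Finset.mem_coe, Finsupp.mem_support_iff]
  rfl

theorem single_mem_grade (i : Idx ι) (c : ℂ) : Finsupp.single i c ∈ grade d (deg d i) := by
  classical
  rw [mem_grade]
  intro j hj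
  rw [Finsupp.single_apply] at hj
  split_ifs at hj with h
  · rw [h]
  · simp at hj

theorem grade_induction {k : ℤ} {p : BVSpace ι → Prop} (h0 : p 0) (hadd : ∀ x y, p x → p y → p (x + y))
    (hs : ∀ i c, deg d i = k → p (Finsupp.single i c)) {x : BVSpace ι} (hx : x ∈ grade d k) : p x := by
  classical
  rw [← Finsupp.sum_single x, Finsupp.sum]
  refine Finset.sum_induction _ p hadd h0 fun i hi => hs i _ ?_
  exact (mem_grade d).1 hx i (Finsupp.mem_support_iff.1 hi)

theorem parity_single (i : Idx ι) (c : ℂ) :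
    parity d (Finsupp.single i c) = (-1 : ℂ) ^ deg d i • Finsupp.single i c := by
  simp [parity, mul_comm]

theorem parity_apply (x : BVSpace ι) (i : Idx ι) : parity d x i = (-1 : ℂ) ^ deg d i * x i := by
  classical
  induction x using Finsupp.induction_linear with
  | zero => simp
  | add x y hx hy => rw [map_add, Finsupp.add_apply, hx, hy, Finsupp.add_apply, mul_add]
  | single j c =>
    rw [parity_single, Finsupp.smul_apply, smul_eq_mul, Finsupp.single_apply]
    split_ifs with h
    · rw [h]
    · simp

theorem parity_of_mem {k : ℤ} {x : BVSpace ι} (hx : x ∈ grade d k) :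
    parity d x = (-1 : ℂ) ^ k • x := by
  ext i
  rw [parity_apply, Finsupp.smul_apply, smul_eq_mul]
  by_cases h : x i = 0
  · simp [h]
  · rw [(mem_grade d).1 hx i h]

theorem neg_one_zpow_mul_self (k : ℤ) : (-1 : ℂ) ^ k * (-1 : ℂ) ^ k = 1 := by
  rw [← zpow_add₀ (by norm_num), Even.neg_one_zpow ⟨k, rfl⟩]

theorem parity_parity (x : BVSpace ι) : parity d (parity d x) = x := by
  ext i
  rw [parity_apply, parity_apply, ← mul_assoc, neg_one_zpow_mul_self, one_mul]

/-- A linear map which shifts the degree by an odd number anticommutes with the parity. -/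
theorem map_parity_of_odd {f : BVSpace ι →ₗ[ℂ] BVSpace ι} {n : ℤ} (hn : Odd n)
    (hf : ∀ k, ∀ x ∈ grade d k, f x ∈ grade d (k + n)) (x : BVSpace ι) :
    f (parity d x) = - parity d (f x) := by
  induction x using Finsupp.induction_linear with
  | zero => simp
  | add x y hx hy => rw [map_add, map_add, hx, hy, map_add, map_add, neg_add]
  | single i c =>
    have h := single_mem_grade d i c
    rw [parity_of_mem d h, map_smul, parity_of_mem d (hf _ _ h), zpow_add₀ (by norm_num),
      hn.neg_one_zpow]
    simp

theorem Multilinear.map_parity {E : Type*} [AddCommGroup E] [Module ℂ E]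
    {f : List (BVSpace ι) → E} (hf : Multilinear f) {ds : List ℤ} {xs : List (BVSpace ι)}
    (h : Homogeneous (grade d) ds xs) (L : List (BVSpace ι)) :
    f (xs.map (parity d) ++ L) = (-1 : ℂ) ^ ds.sum • f (xs ++ L) := by
  induction h generalizing f with
  | nil => simp
  | @cons k x ds xs hx _ ih =>
    have h1 := ih (f := fun l => f (parity d x :: l)) (hf.prepend [parity d x])
    have h2 := (hf [] (xs ++ L)).map_smul ((-1 : ℂ) ^ k) x
    simp only [List.nil_append] at h2
    rw [List.map_cons, List.cons_append, h1, parity_of_mem d hx, h2, List.sum_cons,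
      List.cons_append, smul_smul, ← zpow_add₀ (by norm_num), add_comm]

theorem homogeneous_word (w : List (Idx ι)) : Homogeneous (grade d) (w.map (deg d)) (word w) := by
  induction w with
  | nil => exact .nil
  | cons i w ih => exact .cons (single_mem_grade d i 1) ih

theorem Multilinear.mem_grade_of_homogeneous {f : List (BVSpace ι) → BVSpace ι}
    (hf : Multilinear f) {n : ℤ} (h : ∀ w, f (word w) ∈ grade d (wdeg d w + n)) {ds : List ℤ}
    {xs : List (BVSpace ι)} (hxs : Homogeneous (grade d) ds xs) : f xs ∈ grade d (ds.sum + n) := by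
  suffices ∀ w, f (word w ++ xs) ∈ grade d (wdeg d w + ds.sum + n) by simpa [wdeg, word] using this []
  induction hxs with
  | nil => intro w; simpa using h w
  | @cons k x ds xs hx _ ih =>
    intro w
    refine grade_induction d (k := k) (p := fun x => f (word w ++ x :: xs) ∈ _) ?_ ?_ ?_ hx
    · rw [hf.map_zero]; exact Submodule.zero_mem _
    · intro x y hx hy; rw [(hf _ _).map_add]; exact Submodule.add_mem _ hx hy
    · intro i c hi
      have h1 : (Finsupp.single i c : BVSpace ι) = c • Finsupp.single i 1 := by simp
      have h2 := ih (w ++ [i])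
      simp only [word, List.map_append, List.map_cons, List.map_nil, List.append_assoc,
        List.singleton_append] at h2 ⊢
      rw [h1, (hf _ _).map_smul]
      refine Submodule.smul_mem _ _ ?_
      convert h2 using 2
      simp [wdeg, hi, add_assoc]

end Degree

/-! ### The symplectic form -/

section Omega

variable {ι : Type*} (d : ι → ℤ)

theorem omega_single (i j : Idx ι) (a b : ℂ) :
    omega ι (Finsupp.single i a) (Finsupp.single j b) = a * b * omegaLow i j := by
  simp [omega, mul_assoc]

theorem bilin_ext {I : Type*} {f g : (I →₀ ℂ) →ₗ[ℂ] (I →₀ ℂ) →ₗ[ℂ] ℂ}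
    (h : ∀ i j, f (Finsupp.single i 1) (Finsupp.single j 1) =
      g (Finsupp.single i 1) (Finsupp.single j 1)) (x y : I →₀ ℂ) : f x y = g x y := by
  have : f = g := by
    refine Finsupp.lhom_ext' fun i => LinearMap.ext_ring ?_
    refine Finsupp.lhom_ext' fun j => LinearMap.ext_ring ?_
    exact h i j
  rw [this]

theorem omegaLow_skew (i j : Idx ι) : omegaLow j i = - omegaLow i j := by
  rcases i with a | a <;> rcases j with b | b <;> simp [omegaLow] <;>
    by_cases h : a = b <;> simp [h, eq_comm]

theorem deg_add_of_omegaLow {i j : Idx ι} (h : omegaLow i j ≠ 0) : deg d i + deg d j = 1 := by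
  rcases i with a | a <;> rcases j with b | b <;> simp [omegaLow] at h <;> subst h <;> simp [deg]

theorem omega_skew (x y : BVSpace ι) : omega ι y x = - omega ι x y := by
  refine bilin_ext (f := (omega ι).flip) (g := - omega ι) (fun i j => ?_) x y
  simp [omega_single, omegaLow_skew i j]

theorem omega_parity (x y : BVSpace ι) :
    omega ι (parity d x) (parity d y) = - omega ι x y := by
  refine bilin_ext (f := (omega ι).compl₁₂ (parity d) (parity d)) (g := - omega ι)
    (fun i j => ?_) x y
  by_cases h : omegaLow i j = 0
  · simp [parity_single, omega_single, h]
  · have := deg_add_of_omegaLow d h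
    simp only [LinearMap.compl₁₂_apply, parity_single, map_smul, LinearMap.smul_apply, omega_single,
      LinearMap.neg_apply, smul_eq_mul]
    rw [← mul_assoc, mul_comm ((-1 : ℂ) ^ deg d j), ← zpow_add₀ (by norm_num), this]
    simp

theorem omega_parity_left (x y : BVSpace ι) :
    omega ι (parity d x) y = - omega ι x (parity d y) := by
  rw [← omega_parity d x, parity_parity]

theorem omega_degree {p q : ℤ} {x y : BVSpace ι} (hx : x ∈ grade d p) (hy : y ∈ grade d q)
    (h : p + q ≠ 1) : omega ι x y = 0 := by
  refine grade_induction d (p := fun x => omega ι x y = 0) (by simp) ?_ ?_ hx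
  · intro a b ha hb; rw [map_add, LinearMap.add_apply, ha, hb, add_zero]
  · intro i c hi
    refine grade_induction d (p := fun y => omega ι _ y = 0) (by simp) ?_ ?_ hy
    · intro a b ha hb; rw [map_add, ha, hb, add_zero]
    · intro j c' hj
      rw [omega_single]
      by_cases h0 : omegaLow i j = 0
      · simp [h0]
      · exact absurd (hi ▸ hj ▸ deg_add_of_omegaLow d h0) h

theorem omega_inl (a : ι) (y : BVSpace ι) :
    omega ι (Finsupp.single (Sum.inl a) 1) y = - y (Sum.inr a) := by
  classical
  induction y using Finsupp.induction_linear with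
  | zero => simp
  | add x y hx hy => rw [map_add, hx, hy, Finsupp.add_apply]; ring
  | single j c =>
    rw [omega_single]
    rcases j with b | b
    · simp [omegaLow]
    · by_cases h : a = b <;> simp [omegaLow, h]

theorem omega_inr (a : ι) (y : BVSpace ι) :
    omega ι (Finsupp.single (Sum.inr a) 1) y = y (Sum.inl a) := by
  classical
  induction y using Finsupp.induction_linear with
  | zero => simp
  | add x y hx hy => rw [map_add, hx, hy, Finsupp.add_apply]
  | single j c =>
    rw [omega_single]
    rcases j with b | b <;> simp [omegaLow, Finsupp.single_apply, eq_comm]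

theorem eq_zero_of_omega {y : BVSpace ι} (h : ∀ i, omega ι (Finsupp.single i 1) y = 0) : y = 0 := by
  ext i
  rcases i with a | a
  · simpa [omega_inr] using h (Sum.inr a)
  · simpa [omega_inl] using h (Sum.inl a)

end Omega

end BVTree

namespace BVTree

namespace CyclicFieldTheory

variable {ι : Type*} {d : ι → ℤ} (S : CyclicFieldTheory d)

theorem vertex_apply (w : List (Idx ι)) (j : Idx ι) : S.vertex w j = S.vertexCoeff w j := rfl

theorem deg_swap (i : Idx ι) : deg d i.swap = 1 - deg d i := by
  rcases i with a | a <;> simp [deg]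

theorem multilinear_m : Multilinear S.m := multilinear_extend _

theorem m_word (w : List (Idx ι)) : S.m (word w) = S.vertex w := extend_word _ _

theorem m_nil : S.m [] = 0 := by
  change S.vertex [] = 0
  ext j
  simp [vertex_apply, vertexCoeff, S.coeff_short]

theorem Q_apply (x : BVSpace ι) : S.Q x = S.m [x] := by
  rw [m, extend_cons]; rfl

theorem omega_vertex (i : Idx ι) (w : List (Idx ι)) :
    omega ι (Finsupp.single i 1) (S.vertex w) = (-1 : ℂ) ^ deg d i * S.coeff (i :: w) := by
  rcases i with a | a
  · rw [omega_inl, vertex_apply]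
    simp [vertexCoeff, omegaUp]
  · rw [omega_inr, vertex_apply]
    simp [vertexCoeff, omegaUp]

theorem omega_parity_vertex (i : Idx ι) (w : List (Idx ι)) :
    omega ι (parity d (Finsupp.single i 1)) (S.vertex w) = S.coeff (i :: w) := by
  rw [parity_single, map_smul, LinearMap.smul_apply, omega_vertex, smul_eq_mul, ← mul_assoc,
    neg_one_zpow_mul_self, one_mul]

theorem coeff_rotate (i : Idx ι) (w : List (Idx ι)) :
    S.coeff (i :: w) = (-1 : ℂ) ^ deg d i * S.coeff (w ++ [i]) := by
  by_cases h : wdeg d (w ++ [i]) = 0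
  · rw [S.cyclic]
    have h1 : wdeg d w = - deg d i := by
      simp only [wdeg, List.map_append, List.sum_append, List.map_cons, List.map_nil,
        List.sum_cons, List.sum_nil] at h ⊢
      omega
    rw [h1]
    congr 1
    rcases Int.even_or_odd (deg d i) with he | ho
    · rw [he.neg_one_zpow, (he.mul_left _).neg_one_zpow]
    · rw [ho.neg_one_zpow, (ho.neg.mul ho).neg_one_zpow]
  · have h1 : wdeg d (i :: w) ≠ 0 := by
      simpa [wdeg, add_comm] using h
    rw [S.degree_zero _ h1, S.degree_zero _ h, mul_zero]

theorem vertex_mem_grade (w : List (Idx ι)) : S.vertex w ∈ grade d (wdeg d w + 1) := by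
  rw [mem_grade]
  intro i hi
  rw [vertex_apply, vertexCoeff] at hi
  have h1 : S.coeff (i.swap :: w) ≠ 0 := right_ne_zero_of_mul hi
  have h2 : wdeg d (i.swap :: w) = 0 := by
    by_contra h
    exact h1 (S.degree_zero _ h)
  simp only [wdeg, List.map_cons, List.sum_cons, deg_swap] at h2 ⊢
  omega

theorem m_mem_grade {ds : List ℤ} {xs : List (BVSpace ι)} (h : Homogeneous (grade d) ds xs) :
    S.m xs ∈ grade d (ds.sum + 1) :=
  S.multilinear_m.mem_grade_of_homogeneous d (fun w => by
    rw [m_word]; exact S.vertex_mem_grade w) h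

theorem m_map_parity (xs : List (BVSpace ι)) :
    S.m (xs.map (parity d)) = - parity d (S.m xs) := by
  refine Multilinear.ext_word (S.multilinear_m.map (parity d))
    (S.multilinear_m.comp (-(parity d))) (fun w => ?_) xs
  have h := S.multilinear_m.map_parity d (homogeneous_word d w) []
  have h2 := parity_of_mem d (S.m_mem_grade (homogeneous_word d w))
  simp only [List.append_nil] at h
  rw [h, LinearMap.neg_apply, h2, zpow_add₀ (by norm_num)]
  simp

theorem m_cyclic (x y : BVSpace ι) (xs : List (BVSpace ι)) :
    omega ι x (S.m (y :: xs)) = omega ι (parity d y) (S.m (xs ++ [x])) := by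
  let f : List (BVSpace ι) → ℂ := fun l =>
    match l with
    | x :: y :: xs => omega ι x (S.m (y :: xs))
    | _ => 0
  let g : List (BVSpace ι) → ℂ := fun l =>
    match l with
    | x :: y :: xs => omega ι (parity d y) (S.m (xs ++ [x]))
    | _ => 0
  have h0 : IsLinearMap ℂ (fun _ : BVSpace ι => (0 : ℂ)) := (0 : BVSpace ι →ₗ[ℂ] ℂ).isLinear
  have hm := S.multilinear_m
  have hf : Multilinear f := by
    rintro (_ | ⟨a, _ | ⟨b, A⟩⟩) B
    · rcases B with _ | ⟨b, B⟩
      · exact h0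
      · exact ((omega ι).flip (S.m (b :: B))).isLinear
    · exact ((hm.comp (omega ι a)) [] B)
    · exact ((hm.comp (omega ι a)) (b :: A) B)
  have hg : Multilinear g := by
    rintro (_ | ⟨a, _ | ⟨b, A⟩⟩) B
    · rcases B with _ | ⟨b, B⟩
      · exact h0
      · exact ((hm.comp (omega ι (parity d b))) B [])
    · exact ((omega ι).flip (S.m (B ++ [a])) ∘ₗ parity d).isLinear
    · exact (((hm.append [a]).comp (omega ι (parity d b))) A B)
  refine Multilinear.ext_word hf hg (fun w => ?_) (x :: y :: xs)
  rcases w with _ | ⟨i, _ | ⟨j, w⟩⟩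
  · rfl
  · rfl
  · have h1 : S.m (word w ++ [Finsupp.single i 1]) = S.vertex (w ++ [i]) := by
      rw [← m_word]; simp [word]
    change omega ι (Finsupp.single i 1) (S.m (word (j :: w))) =
      omega ι (parity d (Finsupp.single j 1)) (S.m (word w ++ [Finsupp.single i 1]))
    rw [m_word, h1, omega_vertex, omega_parity_vertex, S.coeff_rotate i, ← mul_assoc,
      neg_one_zpow_mul_self, one_mul, List.cons_append]

/-- The pairing of the operations on two words. -/
def pairWords (T D : List (Idx ι)) : ℂ := omega ι (parity d (S.vertex T)) (S.vertex D)

theorem pairWords_comm (T D : List (Idx ι)) : S.pairWords T D = S.pairWords D T := by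
  rw [pairWords, pairWords, omega_parity_left, omega_skew, neg_neg]

theorem pairWords_nil (D : List (Idx ι)) : S.pairWords [] D = 0 := by
  have : S.vertex [] = 0 := S.m_nil
  simp [pairWords, this]

theorem wdeg_add_of_pairWords {T D : List (Idx ι)} (h : S.pairWords T D ≠ 0) :
    wdeg d T + wdeg d D = -1 := by
  by_contra hne
  refine h ?_
  have hT := S.vertex_mem_grade T
  rw [pairWords, parity_of_mem d hT, map_smul, LinearMap.smul_apply,
    omega_degree d hT (S.vertex_mem_grade D) (by omega), smul_zero]

theorem finsum_bracket (T D : List (Idx ι)) :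
    ∑ᶠ p : Idx ι × Idx ι, S.coeff (p.1 :: D) * omegaUp p.1 p.2 * S.coeff (T ++ [p.2]) =
      S.pairWords T D := by
  classical
  have hup : ∀ i j : Idx ι, omegaUp i j ≠ 0 → j = i.swap := by
    rintro (a | a) (b | b) h <;> simp [omegaUp] at h <;> simp [h]
  have hterm : ∀ i : Idx ι, S.coeff (i :: D) * omegaUp i i.swap * S.coeff (T ++ [i.swap]) =
      S.vertex T i * S.coeff (i :: D) := by
    intro i
    rw [vertex_apply, vertexCoeff, S.coeff_rotate i.swap T]
    have := neg_one_zpow_mul_self (deg d i.swap)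
    linear_combination (-(S.coeff (i :: D) * omegaUp i i.swap * S.coeff (T ++ [i.swap]))) * this
  have hinj : Set.InjOn (fun i : Idx ι => (i, i.swap)) ((S.vertex T).support : Set (Idx ι)) :=
    fun i _ j _ h => (Prod.mk.inj h).1
  rw [finsum_eq_finsetSum_of_support_subset (s := (S.vertex T).support.image (fun i => (i, i.swap))),
    Finset.sum_image hinj]
  · simp only [hterm]
    have h1 : S.vertex T = (S.vertex T).sum (fun i c => c • Finsupp.single i 1) := by simp
    rw [pairWords]
    conv_rhs => rw [h1]
    simp only [Finsupp.sum, map_sum, map_smul, LinearMap.sum_apply, LinearMap.smul_apply,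
      omega_parity_vertex, smul_eq_mul]
  · rintro ⟨i, j⟩ h
    rw [Function.mem_support] at h
    obtain rfl : j = i.swap := hup i j fun h0 => h (by simp only; rw [h0, mul_zero, zero_mul])
    have h' := hterm i
    simp only at h
    rw [h'] at h
    rw [Finset.mem_coe, Finset.mem_image]
    exact ⟨i, Finsupp.mem_support_iff.2 (left_ne_zero_of_mul h), rfl⟩

theorem wdeg_append (T D : List (Idx ι)) : wdeg d (T ++ D) = wdeg d T + wdeg d D := by
  simp [wdeg]

theorem sum_pairWords_rotate (hBV : S.MasterEquation) (w : List (Idx ι)) :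
    ∑ r ∈ Finset.range w.length, ∑ s ∈ Finset.Ico 1 w.length,
      S.pairWords ((w.rotate r).take s) ((w.rotate r).drop s) = 0 := by
  rcases Nat.eq_zero_or_pos w.length with h0 | h0
  · simp [h0]
  have h := hBV w
  rw [bracket] at h
  have h := (mul_eq_zero.1 h).resolve_left (by simp; rintro rfl; simp at h0)
  simp only [finsum_bracket] at h
  rw [← h]
  refine Finset.sum_congr rfl fun r hr => ?_
  rw [Finset.mul_sum]
  refine Finset.sum_congr rfl fun s _ => ?_
  by_cases hp : S.pairWords ((w.rotate r).take s) ((w.rotate r).drop s) = 0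
  · rw [hp, mul_zero]
  · have h1 := S.wdeg_add_of_pairWords hp
    rw [← wdeg_append, List.take_append_drop,
      List.rotate_eq_drop_append_take (Finset.mem_range.1 hr).le, wdeg_append] at h1
    have : Even (wdeg d (w.take r) * wdeg d (w.drop r)) := by
      rw [Int.even_mul]
      rcases Int.even_or_odd (wdeg d (w.take r)) with he | ho
      · exact Or.inl he
      · right
        have : wdeg d (w.drop r) = -1 - wdeg d (w.take r) := by omega
        rw [this]
        exact Odd.sub_odd (by decide) ho
    rw [this.neg_one_zpow, one_mul]

/-- In a sum over all ways to cut a cyclic word in two arcs, one may distinguish the arc which contains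
the first letter. -/
theorem sum_arcs {α : Type*} (g : List α → List α → ℂ) (hg : ∀ T D, g T D = g D T)
    (hg0 : ∀ D, g [] D = 0) (x : α) (xs : List α) :
    ∑ r ∈ Finset.range (x :: xs).length, ∑ s ∈ Finset.Ico 1 (x :: xs).length,
      g (((x :: xs).rotate r).take s) (((x :: xs).rotate r).drop s) =
    2 * splitSum₃ (fun A B C => g B (C ++ x :: A)) xs := by
  set w := x :: xs with hw
  set n := w.length with hn
  set G : ℕ × ℕ → ℂ := fun p => g ((w.rotate p.1).take p.2) ((w.rotate p.1).drop p.2) with hG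
  set D := Finset.range n ×ˢ Finset.Ico 1 n with hD
  set D₁ := D.filter (fun p => 1 ≤ p.1 ∧ p.2 + p.1 ≤ n) with hD₁
  set D₂ := D.filter (fun p => ¬ (1 ≤ p.1 ∧ p.2 + p.1 ≤ n)) with hD₂
  have hmem₁ : ∀ p, p ∈ D₁ ↔ 1 ≤ p.1 ∧ 1 ≤ p.2 ∧ p.2 + p.1 ≤ n ∧ p.1 < n ∧ p.2 < n := by
    intro p
    simp only [hD₁, hD, Finset.mem_filter, Finset.mem_product, Finset.mem_range, Finset.mem_Ico]
    omega
  have hmem₂ : ∀ p, p ∈ D₂ ↔ (p.1 = 0 ∨ n < p.2 + p.1) ∧ 1 ≤ p.2 ∧ p.1 < n ∧ p.2 < n := by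
    intro p
    simp only [hD₂, hD, Finset.mem_filter, Finset.mem_product, Finset.mem_range, Finset.mem_Ico]
    omega
  have hGrot : ∀ r s, s ≤ n → G (r, s) = G (r + s, n - s) := by
    intro r s hs
    simp only [hG]
    rw [hg, ← List.rotate_rotate]
    have hl : (w.rotate r).length = n := List.length_rotate ..
    rw [List.rotate_eq_drop_append_take (by omega : s ≤ (w.rotate r).length)]
    have hl' : ((w.rotate r).drop s).length = n - s := by rw [List.length_drop, hl]
    rw [List.take_left' hl', List.drop_left' hl']
  have hGmod : ∀ r s, G (r, s) = G (r + n, s) := by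
    intro r s
    simp only [hG]
    rw [← List.rotate_mod w (r + n), ← hn, Nat.add_mod_right, hn, List.rotate_mod]
  have hswap : ∑ p ∈ D₂, G p = ∑ p ∈ D₁, G p := by
    refine Finset.sum_nbij' (fun p => (if p.1 + p.2 < n then p.1 + p.2 else p.1 + p.2 - n, n - p.2))
      (fun p => (if p.1 + p.2 < n then p.1 + p.2 else p.1 + p.2 - n, n - p.2)) ?_ ?_ ?_ ?_ ?_
    · intro p hp
      rw [hmem₂] at hp
      rw [hmem₁]
      simp only
      split_ifs <;> omega
    · intro p hp
      rw [hmem₁] at hp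
      rw [hmem₂]
      simp only
      split_ifs <;> omega
    · rintro ⟨r, s⟩ hp
      rw [hmem₂] at hp
      simp only at hp ⊢
      ext
      · simp only
        split_ifs <;> omega
      · simp only; omega
    · rintro ⟨r, s⟩ hp
      rw [hmem₁] at hp
      simp only at hp ⊢
      ext
      · simp only
        split_ifs <;> omega
      · simp only; omega
    · rintro ⟨r, s⟩ hp
      rw [hmem₂] at hp
      simp only at hp ⊢
      rw [hGrot r s (by omega)]
      split_ifs with h
      · rfl
      · rw [hGmod (r + s - n), Nat.sub_add_cancel (by omega)]
  have htot : ∑ r ∈ Finset.range n, ∑ s ∈ Finset.Ico 1 n, G (r, s) = 2 * ∑ p ∈ D₁, G p := by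
    rw [← Finset.sum_product, ← Finset.sum_filter_add_sum_filter_not D
      (fun p => 1 ≤ p.1 ∧ p.2 + p.1 ≤ n), two_mul]
    congr 1
  change ∑ r ∈ Finset.range n, ∑ s ∈ Finset.Ico 1 n, G (r, s) = _
  rw [htot]
  congr 1
  have hnl : n = xs.length + 1 := rfl
  have hterm : ∀ a b, a + b ≤ xs.length → g ((xs.drop a).take b) ((xs.drop a).drop b ++
      x :: xs.take a) = G (a + 1, b) := by
    intro a b hab
    simp only [hG]
    rw [List.rotate_eq_drop_append_take (by rw [← hn]; omega), hw, List.drop_succ_cons,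
      List.take_succ_cons, List.take_append_of_le_length (by rw [List.length_drop]; omega),
      List.drop_append_of_le_length (by rw [List.length_drop]; omega)]
  simp only [splitSum₃, splitSum]
  rw [Finset.sum_sigma']
  symm
  refine Finset.sum_bij_ne_zero (fun p _ _ => (p.1 + 1, p.2)) ?_ ?_ ?_ ?_
  · rintro ⟨a, b⟩ hp hne
    simp only [Finset.mem_sigma, Finset.mem_range, List.length_drop] at hp
    have hb : b ≠ 0 := by
      rintro rfl
      simp [hg0] at hne
    rw [hmem₁]
    simp only
    omega
  · rintro ⟨a, b⟩ _ _ ⟨a', b'⟩ _ _ h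
    simp only [Prod.mk.injEq] at h
    obtain ⟨h1, rfl⟩ := h
    obtain rfl : a = a' := by omega
    rfl
  · rintro ⟨r, s⟩ hp hne
    rw [hmem₁] at hp
    simp only at hp
    have hmem : (⟨r - 1, s⟩ : Σ _ : ℕ, ℕ) ∈ (Finset.range (xs.length + 1)).sigma
        (fun j => Finset.range ((xs.drop j).length + 1)) := by
      simp only [Finset.mem_sigma, Finset.mem_range, List.length_drop]
      omega
    have hr : r - 1 + 1 = r := by omega
    refine ⟨⟨r - 1, s⟩, hmem, ?_, by simp [hr]⟩
    rw [hterm (r - 1) s (by omega), hr]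
    exact hne
  · rintro ⟨a, b⟩ hp _
    simp only [Finset.mem_sigma, Finset.mem_range, List.length_drop] at hp
    exact hterm a b (by omega)

/-- Rotating the arguments of the pairing of `x` with `m`. -/
theorem omega_m_rotate (x z : BVSpace ι) (A C : List (BVSpace ι)) :
    omega ι (parity d x) (S.m (A.map (parity d) ++ z :: C)) =
      omega ι (parity d z) (S.m (C ++ parity d x :: A)) := by
  induction A generalizing x C with
  | nil => exact S.m_cyclic _ _ _
  | cons a A ih =>
    rw [List.map_cons, List.cons_append, m_cyclic, List.append_assoc, List.cons_append, ih,
      parity_parity]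
    simp

/-- The `A_∞`-relations of the operations of a theory satisfying the master equation. -/
theorem m_relation (hBV : S.MasterEquation) (xs : List (BVSpace ι)) :
    splitSum₃ (fun A B C => S.m (A.map (parity d) ++ S.m B :: C)) xs = 0 := by
  have hm := S.multilinear_m
  refine Multilinear.ext_word (hm.relation (parity d)) (g := fun _ => 0)
    (fun A B => (0 : BVSpace ι →ₗ[ℂ] BVSpace ι).isLinear) (fun w => ?_) xs
  refine eq_zero_of_omega fun i => ?_
  have key : ∀ z A C, omega ι (Finsupp.single i 1) (S.m (A.map (parity d) ++ z :: C)) =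
      omega ι (parity d z) (S.m (C ++ Finsupp.single i 1 :: A)) := by
    intro z A C
    have := S.omega_m_rotate (parity d (Finsupp.single i 1)) z A C
    rwa [parity_parity] at this
  rw [map_splitSum₃]
  simp only [key]
  rw [word, splitSum₃, splitSum_map]
  simp only [splitSum_map]
  have h := S.sum_pairWords_rotate hBV (i :: w)
  rw [sum_arcs _ S.pairWords_comm S.pairWords_nil] at h
  have h := (mul_eq_zero.1 h).resolve_left two_ne_zero
  rw [← h]
  refine splitSum_congr fun A D _ => splitSum_congr fun B C _ => ?_
  change _ = omega ι (parity d (S.vertex B)) (S.vertex (C ++ i :: A))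
  rw [← m_word, ← m_word]
  simp [word]

end CyclicFieldTheory

end BVTree

namespace BVTree

section Blocks

variable {ι : Type*}

@[simp] theorem resF_apply (x : BVSpace ι) (a : ι) : resF ι x a = x (Sum.inl a) := rfl

@[simp] theorem resA_apply (x : BVSpace ι) (a : ι) : resA ι x a = x (Sum.inr a) := rfl

@[simp] theorem incF_apply_inl (f : FieldSpace ι) (a : ι) : incF ι f (Sum.inl a) = f a :=
  Finsupp.mapDomain_apply Sum.inl_injective f a

@[simp] theorem incA_apply_inr (f : FieldSpace ι) (a : ι) : incA ι f (Sum.inr a) = f a :=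
  Finsupp.mapDomain_apply Sum.inr_injective f a

@[simp] theorem incF_apply_inr (f : FieldSpace ι) (a : ι) : incF ι f (Sum.inr a) = 0 :=
  Finsupp.mapDomain_of_notMem_range _ _ (by simp)

@[simp] theorem incA_apply_inl (f : FieldSpace ι) (a : ι) : incA ι f (Sum.inl a) = 0 :=
  Finsupp.mapDomain_of_notMem_range _ _ (by simp)

@[simp] theorem resF_incF (f : FieldSpace ι) : resF ι (incF ι f) = f := by ext; simp

@[simp] theorem resA_incA (f : FieldSpace ι) : resA ι (incA ι f) = f := by ext; simp

@[simp] theorem resA_incF (f : FieldSpace ι) : resA ι (incF ι f) = 0 := by ext; simp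

@[simp] theorem resF_incA (f : FieldSpace ι) : resF ι (incA ι f) = 0 := by ext; simp

theorem ext_res {x y : BVSpace ι} (h₁ : resF ι x = resF ι y) (h₂ : resA ι x = resA ι y) : x = y := by
  ext (a | a)
  · exact DFunLike.congr_fun h₁ a
  · exact DFunLike.congr_fun h₂ a

/-- The diagonal operator with the given eigenvalues. -/
def diagonal {I : Type*} (c : I → ℂ) : (I →₀ ℂ) →ₗ[ℂ] (I →₀ ℂ) :=
  Finsupp.linearCombination ℂ (fun i => Finsupp.single i (c i))

theorem diagonal_single {I : Type*} (c : I → ℂ) (i : I) (r : ℂ) :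
    diagonal c (Finsupp.single i r) = c i • Finsupp.single i r := by
  simp [diagonal, mul_comm]

theorem diagonal_apply {I : Type*} (c : I → ℂ) (f : I →₀ ℂ) (i : I) :
    diagonal c f i = c i * f i := by
  classical
  induction f using Finsupp.induction_linear with
  | zero => simp
  | add x y hx hy => rw [map_add, Finsupp.add_apply, hx, hy, Finsupp.add_apply, mul_add]
  | single j r =>
    rw [diagonal_single, Finsupp.smul_apply, smul_eq_mul, Finsupp.single_apply]
    split_ifs with h
    · rw [h]
    · simp

theorem comp_diagonal {I : Type*} {K : (I →₀ ℂ) →ₗ[ℂ] (I →₀ ℂ)} {c c' : I → ℂ}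
    (h : ∀ a b, K (Finsupp.single b 1) a ≠ 0 → c b = c' a) (f : I →₀ ℂ) :
    K (diagonal c f) = diagonal c' (K f) := by
  induction f using Finsupp.induction_linear with
  | zero => simp
  | add x y hx hy => simp only [map_add, hx, hy]
  | single b r =>
    have h1 : (Finsupp.single b r : I →₀ ℂ) = r • Finsupp.single b 1 := by simp
    rw [h1]
    simp only [map_smul, diagonal_single]
    congr 1
    ext a
    rw [diagonal_apply, Finsupp.smul_apply, smul_eq_mul]
    by_cases h0 : K (Finsupp.single b 1) a = 0
    · rw [h0, mul_zero, mul_zero]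
    · rw [h a b h0]

/-- The bilinear form for which the standard basis is orthonormal. -/
def dot (ι : Type*) : FieldSpace ι →ₗ[ℂ] FieldSpace ι →ₗ[ℂ] ℂ :=
  Finsupp.linearCombination ℂ (fun a => Finsupp.lapply a)

theorem dot_single (a : ι) (f : FieldSpace ι) : dot ι (Finsupp.single a 1) f = f a := by
  simp [dot]

theorem dot_comm (f g : FieldSpace ι) : dot ι f g = dot ι g f := by
  classical
  refine bilin_ext (f := dot ι) (g := (dot ι).flip) (fun a b => ?_) f g
  rw [dot_single, LinearMap.flip_apply, dot_single, Finsupp.single_apply, Finsupp.single_apply]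
  simp [eq_comm]

end Blocks

namespace CyclicFieldTheory

variable {ι : Type*} {d : ι → ℤ} (S : CyclicFieldTheory d)
  {Vp : FieldSpace ι →ₗ[ℂ] FieldSpace ι}

theorem kinetic_single (a b : ι) : S.kinetic (Finsupp.single b 1) a =
    (-1 : ℂ) ^ d a * S.coeff [Sum.inl a, Sum.inl b] := by
  have h : S.Q (Finsupp.single (Sum.inl b) 1) = S.vertex [Sum.inl b] := by simp [Q]
  rw [kinetic_apply, h, omega_vertex]
  rfl

theorem deg_of_kinetic {a b : ι} (h : S.kinetic (Finsupp.single b 1) a ≠ 0) : d a = - d b := by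
  rw [kinetic_single] at h
  by_contra hne
  refine right_ne_zero_of_mul h (S.degree_zero _ ?_)
  simp [wdeg, deg]
  omega

theorem dot_kinetic (f g : FieldSpace ι) :
    dot ι (S.kinetic f) g = dot ι (diagonal (fun a => (-1 : ℂ) ^ d a) f) (S.kinetic g) := by
  refine bilin_ext (f := dot ι ∘ₗ S.kinetic)
    (g := (dot ι).compl₁₂ (diagonal (fun a => (-1 : ℂ) ^ d a)) S.kinetic) (fun a b => ?_) f g
  rw [LinearMap.comp_apply, LinearMap.compl₁₂_apply, diagonal_single, dot_comm, dot_single,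
    map_smul, LinearMap.smul_apply, dot_single, kinetic_single, kinetic_single, smul_eq_mul,
    ← mul_assoc, neg_one_zpow_mul_self, one_mul, S.coeff_rotate, ← mul_assoc]
  have : deg d (Sum.inl b) = d b := rfl
  rw [this, neg_one_zpow_mul_self, one_mul]
  rfl

/-- The relations between the kinetic operator and a BV propagator. -/
theorem IsBVPropagator.relations {S : CyclicFieldTheory d} (hVp : S.IsBVPropagator Vp) :
    (∀ f, S.kinetic (Vp (S.kinetic f)) = S.kinetic f) ∧ (∀ f, Vp (S.kinetic (Vp f)) = Vp f) ∧
      (∀ f, S.kinetic (Vp f) = Vp (S.kinetic f)) := by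
  obtain ⟨p, hpp, hr, h1, h2, h3⟩ := hVp
  have e1 : ∀ f, Vp (S.kinetic f) = f - p f := fun f => LinearMap.congr_fun h1 f
  have e2 : ∀ f, S.kinetic (Vp f) = f - p f := fun f => LinearMap.congr_fun h2 f
  have e3 : ∀ f, Vp (p f) = 0 := fun f => LinearMap.congr_fun h3 f
  have e4 : ∀ f, S.kinetic (p f) = 0 := by
    intro f
    have : p f ∈ LinearMap.ker S.kinetic := hr ▸ LinearMap.mem_range_self p f
    exact this
  refine ⟨fun f => ?_, fun f => ?_, fun f => ?_⟩
  · rw [e1, map_sub, e4, sub_zero]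
  · rw [e2, map_sub, e3, sub_zero]
  · rw [e1, e2]

theorem IsBVPropagator.comp_comm {S : CyclicFieldTheory d} (hVp : S.IsBVPropagator Vp)
    {A A' : FieldSpace ι →ₗ[ℂ] FieldSpace ι} (h : ∀ f, S.kinetic (A f) = A' (S.kinetic f))
    (h' : ∀ f, S.kinetic (A' f) = A (S.kinetic f)) (f : FieldSpace ι) : Vp (A f) = A' (Vp f) := by
  obtain ⟨h1, h2, h3⟩ := hVp.relations
  have hR : ∀ B B' : FieldSpace ι →ₗ[ℂ] FieldSpace ι, (∀ f, S.kinetic (B f) = B' (S.kinetic f)) →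
      (∀ f, S.kinetic (B' f) = B (S.kinetic f)) →
      ∀ f, Vp (S.kinetic (B f)) = B (Vp (S.kinetic f)) := by
    intro B B' hB hB' f
    have e1 : Vp (S.kinetic (B (f - Vp (S.kinetic f)))) = 0 := by
      rw [hB, map_sub, h1, sub_self, map_zero, map_zero]
    have e2 : Vp (S.kinetic (B (Vp (S.kinetic f)))) = B (Vp (S.kinetic f)) := by
      have : B (Vp (S.kinetic f)) = S.kinetic (B' (Vp f)) := by rw [hB', h3]
      rw [this, ← h3, h1]
    rw [map_sub, map_sub, map_sub, e2, sub_eq_zero] at e1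
    exact e1
  calc Vp (A f) = Vp (Vp (S.kinetic (A f))) := by rw [← h3, h2]
    _ = Vp (A (S.kinetic (Vp f))) := by rw [hR A A' h h', h3]
    _ = Vp (S.kinetic (A' (Vp f))) := by rw [h']
    _ = A' (Vp f) := by rw [hR A' A h' h, h2]

theorem IsBVPropagator.deg_eq {S : CyclicFieldTheory d} (hVp : S.IsBVPropagator Vp) {a b : ι}
    (h : Vp (Finsupp.single b 1) a ≠ 0) : d a = - d b := by
  have key := hVp.comp_comm (A := diagonal (fun c => if d c = d b then 1 else 0))
    (A' := diagonal (fun c => if d c = - d b then 1 else 0))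
    (comp_diagonal fun a' b' h => by
      have := S.deg_of_kinetic h
      simp only [this, neg_inj])
    (comp_diagonal fun a' b' h => by
      have := S.deg_of_kinetic h
      simp only [this, neg_eq_iff_eq_neg]) (Finsupp.single b 1)
  have := DFunLike.congr_fun key a
  rw [diagonal_single, diagonal_apply] at this
  by_contra hne
  simp [hne] at this
  exact h this

theorem IsBVPropagator.dot_eq {S : CyclicFieldTheory d} (hVp : S.IsBVPropagator Vp)
    (f g : FieldSpace ι) :
    dot ι (Vp f) g = dot ι (diagonal (fun a => (-1 : ℂ) ^ d a) f) (Vp g) := by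
  obtain ⟨h1, h2, h3⟩ := hVp.relations
  set D := diagonal (fun a => (-1 : ℂ) ^ d a) with hD
  have hDK : ∀ f, S.kinetic (D f) = D (S.kinetic f) := comp_diagonal fun a b h => by
    rw [S.deg_of_kinetic h, zpow_neg, ← inv_zpow]; norm_num
  have hDD : ∀ f, D (D f) = f := by
    intro f
    ext a
    rw [hD, diagonal_apply, diagonal_apply, ← mul_assoc, neg_one_zpow_mul_self, one_mul]
  have e1 : dot ι (Vp f) g = dot ι (Vp f) (S.kinetic (Vp g)) := by
    have ez : Vp f = S.kinetic (Vp (Vp f)) := by rw [h3, h2]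
    rw [ez, dot_kinetic, dot_kinetic, h3 g, h1]
  have e2 : ∀ z y, dot ι z (S.kinetic y) = dot ι (S.kinetic (D z)) y := by
    intro z y
    rw [dot_kinetic, ← hD, hDD]
  have e3 : Vp g = S.kinetic (Vp (Vp g)) := by rw [h3, h2]
  rw [e1, e2, hDK, e3, e2, e2, hDD, hDD, h3, h1]

theorem IsBVPropagator.single_eq {S : CyclicFieldTheory d} (hVp : S.IsBVPropagator Vp) (a b : ι) :
    Vp (Finsupp.single b 1) a = (-1 : ℂ) ^ d b * Vp (Finsupp.single a 1) b := by
  have := hVp.dot_eq (Finsupp.single b 1) (Finsupp.single a 1)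
  rwa [dot_comm, dot_single, diagonal_single, map_smul, LinearMap.smul_apply, dot_single,
    smul_eq_mul] at this

theorem Qplus_apply (x : BVSpace ι) : Qplus Vp x = - incF ι (Vp (resA ι x)) := by
  simp [Qplus, omegaMatrix]

theorem Qplus_Qplus (x : BVSpace ι) : Qplus Vp (Qplus Vp x) = 0 := by
  rw [Qplus_apply, Qplus_apply]; simp

theorem Qplus_mem_grade {S : CyclicFieldTheory d} (hVp : S.IsBVPropagator Vp) {k : ℤ}
    {x : BVSpace ι} (hx : x ∈ grade d k) : Qplus Vp x ∈ grade d (k + -1) := by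
  refine grade_induction d (p := fun x => Qplus Vp x ∈ grade d (k + -1)) ?_ ?_ ?_ hx
  · simp
  · intro x y hx hy; rw [map_add]; exact Submodule.add_mem _ hx hy
  · rintro (b | b) c hb
    · have : resA ι (Finsupp.single (Sum.inl b) c) = 0 := by ext; simp
      rw [Qplus_apply, this]; simp
    · have : resA ι (Finsupp.single (Sum.inr b) c) = c • Finsupp.single b 1 := by
        classical
        ext a; simp [Finsupp.single_apply]
      rw [Qplus_apply, this, map_smul, map_smul]
      refine Submodule.neg_mem _ (Submodule.smul_mem _ _ ((mem_grade d).2 ?_))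
      rintro (a | a) ha
      · rw [incF_apply_inl] at ha
        have := hVp.deg_eq ha
        simp only [deg] at hb ⊢
        omega
      · simp at ha

theorem Qplus_parity {S : CyclicFieldTheory d} (hVp : S.IsBVPropagator Vp) (x : BVSpace ι) :
    Qplus Vp (parity d x) = - parity d (Qplus Vp x) :=
  map_parity_of_odd d (by decide) (fun _ _ hx => Qplus_mem_grade hVp hx) x

theorem omega_Qplus {S : CyclicFieldTheory d} (hVp : S.IsBVPropagator Vp) (x z : BVSpace ι) :
    omega ι (Qplus Vp x) z = omega ι x (Qplus Vp (parity d z)) := by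
  have hinl : ∀ b : ι, Qplus Vp (Finsupp.single (Sum.inl b) 1) = 0 := by
    intro b
    have : resA ι (Finsupp.single (Sum.inl b) 1) = 0 := by ext; simp
    rw [Qplus_apply, this]; simp
  have hinr : ∀ b : ι, Qplus Vp (Finsupp.single (Sum.inr b) 1) =
      - incF ι (Vp (Finsupp.single b 1)) := by
    intro b
    have : resA ι (Finsupp.single (Sum.inr b) 1) = Finsupp.single b 1 := by
      classical
      ext a; simp [Finsupp.single_apply]
    rw [Qplus_apply, this]
  refine bilin_ext (f := omega ι ∘ₗ Qplus Vp) (g := (omega ι).compl₂ (Qplus Vp ∘ₗ parity d))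
    (fun i j => ?_) x z
  simp only [LinearMap.comp_apply, LinearMap.compl₂_apply, parity_single, map_smul, smul_eq_mul]
  rw [omega_skew]
  rcases i with b | b <;> rcases j with c | c
  · simp [hinl]
  · simp [hinl, hinr, omega_inl]
  · simp [hinl, hinr, omega_inl]
  · simp only [hinr, omega_inr, Finsupp.neg_apply, incF_apply_inl, neg_neg, deg]
    rw [hVp.single_eq b c, sub_eq_add_neg, zpow_add₀ (by norm_num), zpow_neg, ← inv_zpow]
    have := neg_one_zpow_mul_self (d c)
    norm_num
    linear_combination (-(Vp (Finsupp.single b 1) c)) * this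

end CyclicFieldTheory

end BVTree

namespace BVTree

theorem isInternal_comap_subtype {V : Type*} [AddCommGroup V] [Module ℂ V]
    {𝒜 : ℤ → Submodule ℂ V} (h𝒜 : iSupIndep 𝒜) (p : Submodule ℂ V)
    (hp : ∀ x : p, x ∈ ⨆ k, (𝒜 k).comap p.subtype) :
    DirectSum.IsInternal fun k => (𝒜 k).comap p.subtype := by
  refine (DirectSum.isInternal_submodule_iff_iSupIndep_and_iSup_eq_top _).2
    ⟨?_, eq_top_iff.2 fun x _ => hp x⟩
  rw [iSupIndep_def]
  intro k
  rw [Submodule.disjoint_def]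
  intro x hx hx'
  refine Subtype.ext (Submodule.disjoint_def.1 (iSupIndep_def.1 h𝒜 k) x hx ?_)
  have h2 := Submodule.mem_map_of_mem (f := p.subtype) hx'
  simp only [Submodule.map_iSup] at h2
  refine (iSup₂_mono fun j _ => ?_ : _ ≤ (⨆ j, ⨆ (_ : j ≠ k), 𝒜 j)) h2
  rintro _ ⟨y, hy, rfl⟩
  exact hy

section Degree

variable {V : Type*} [AddCommGroup V] [Module ℂ V] {𝒜 : ℤ → Submodule ℂ V} {m : List V → V}
  {Qp : V →ₗ[ℂ] V}

mutual

theorem PTree.evalF_mem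
    (hm : ∀ ds xs, Homogeneous 𝒜 ds xs → m xs ∈ 𝒜 (ds.sum + 1))
    (hQp : ∀ k, ∀ x ∈ 𝒜 (k + 1), Qp x ∈ 𝒜 k) :
    ∀ (Γ : PTree) (ds : List ℤ) (xs : List V), Homogeneous 𝒜 ds xs → xs.length = Γ.leaves →
      PTree.evalF m Qp Γ xs ∈ 𝒜 ds.sum
  | .leaf, ds, xs, hxs, hl => by
    obtain ⟨x, rfl⟩ := List.length_eq_one_iff.1 hl
    cases hxs with
    | cons hx h => cases h; simpa [PTree.evalF] using hx
  | .node cs, ds, xs, hxs, hl => by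
    obtain ⟨es, hes, hsum⟩ := PTree.evalFs_homogeneous hm hQp cs ds xs hxs hl
    rw [PTree.evalF, ← hsum]
    exact Submodule.neg_mem _ (hQp _ _ (hm _ _ hes))

theorem PTree.evalFs_homogeneous
    (hm : ∀ ds xs, Homogeneous 𝒜 ds xs → m xs ∈ 𝒜 (ds.sum + 1))
    (hQp : ∀ k, ∀ x ∈ 𝒜 (k + 1), Qp x ∈ 𝒜 k) :
    ∀ (cs : List PTree) (ds : List ℤ) (xs : List V), Homogeneous 𝒜 ds xs →
      xs.length = PTree.leavesList cs →
      ∃ es, Homogeneous 𝒜 es (PTree.evalFs m Qp cs xs) ∧ es.sum = ds.sum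
  | [], ds, xs, hxs, hl => by
    obtain rfl := List.length_eq_zero_iff.1 hl
    cases hxs
    exact ⟨[], .nil, rfl⟩
  | c :: cs, ds, xs, hxs, hl => by
    rw [PTree.leavesList] at hl
    obtain ⟨es, hes, hsum⟩ := PTree.evalFs_homogeneous hm hQp cs (ds.drop c.leaves)
      (xs.drop c.leaves) (List.forall₂_drop _ hxs) (by simp [hl])
    refine ⟨(ds.take c.leaves).sum :: es, ?_, ?_⟩
    · rw [PTree.evalFs]
      exact .cons (PTree.evalF_mem hm hQp c _ _ (List.forall₂_take _ hxs) (by simp [hl])) hes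
    · rw [List.sum_cons, hsum, List.sum_take_add_sum_drop]

end

theorem treeM_mem (hm : ∀ ds xs, Homogeneous 𝒜 ds xs → m xs ∈ 𝒜 (ds.sum + 1))
    (hQp : ∀ k, ∀ x ∈ 𝒜 (k + 1), Qp x ∈ 𝒜 k) {ds : List ℤ} {xs : List V}
    (hxs : Homogeneous 𝒜 ds xs) : treeM m Qp xs ∈ 𝒜 (ds.sum + 1) := by
  refine Submodule.sum_mem _ fun cs hcs => ?_
  obtain ⟨es, hes, hsum⟩ := PTree.evalFs_homogeneous hm hQp cs ds xs hxs
    (PTree.mem_forestFinset.1 hcs).2.symm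
  rw [higher]
  split_ifs
  · rw [← hsum]
    exact hm _ _ hes
  · exact Submodule.zero_mem _

end Degree

namespace CyclicFieldTheory

variable {ι : Type*} {d : ι → ℤ} {S : CyclicFieldTheory d}
  {Vp : FieldSpace ι →ₗ[ℂ] FieldSpace ι}

theorem kinetic_apply' (f : FieldSpace ι) : S.kinetic f = - resA ι (S.Q (incF ι f)) := by
  simp [kinetic]

/-- The blocks of `Q` for a proper action. -/
theorem IsProper.exists_blocks (h : S.IsProper) : ∃ t : FieldSpace ι →ₗ[ℂ] FieldSpace ι, ∀ x,
    resA ι (S.Q x) = - S.kinetic (resF ι x + t (resA ι x)) ∧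
      resF ι (S.Q x) = t (S.kinetic (resF ι x + t (resA ι x))) := by
  obtain ⟨t, -, -, h⟩ := h
  refine ⟨t, fun x => ?_⟩
  have h := LinearMap.congr_fun h x
  simp only [LinearMap.comp_apply, LinearMap.add_apply, LinearMap.id_apply, Qlow, map_add,
    resF_incF] at h
  rw [← map_add, ← map_add, ← map_add, ← map_add] at h
  have hA := congrArg (resA ι) h
  have hF := congrArg (resF ι) h
  simp only [map_add, resA_incF, resF_incF, resA_incA, resF_incA, add_zero] at hA hF
  have hA' : resA ι (S.Q x) = - S.kinetic (resF ι x + t (resA ι x)) := by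
    rw [kinetic_apply', neg_neg, hA]; simp
  refine ⟨hA', ?_⟩
  rw [eq_neg_of_add_eq_zero_left hF, hA', map_neg, neg_neg]

theorem Q_Q (h : S.IsProper) (x : BVSpace ι) : S.Q (S.Q x) = 0 := by
  obtain ⟨t, ht⟩ := h.exists_blocks
  have h0 : resF ι (S.Q x) + t (resA ι (S.Q x)) = 0 := by
    rw [(ht x).1, (ht x).2, map_neg, add_neg_cancel]
  refine ext_res ?_ ?_
  · rw [(ht _).2, h0]; simp
  · rw [(ht _).1, h0]; simp

theorem Q_Qplus_Q (h : S.IsProper) (hVp : S.IsBVPropagator Vp) (x : BVSpace ι) :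
    S.Q (Qplus Vp (S.Q x)) = S.Q x := by
  obtain ⟨t, ht⟩ := h.exists_blocks
  have h0 : S.kinetic (resF ι (Qplus Vp (S.Q x)) + t (resA ι (Qplus Vp (S.Q x)))) =
      S.kinetic (resF ι x + t (resA ι x)) := by
    rw [Qplus_apply, (ht x).1]
    simp only [map_neg, neg_neg, resF_incF, resA_incF, map_zero, add_zero, hVp.relations.1]
  refine ext_res ?_ ?_
  · rw [(ht _).2, (ht x).2, h0]
  · rw [(ht _).1, (ht x).1, h0]

theorem Qplus_Q_Qplus (h : S.IsProper) (hVp : S.IsBVPropagator Vp) (x : BVSpace ι) :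
    Qplus Vp (S.Q (Qplus Vp x)) = Qplus Vp x := by
  obtain ⟨t, ht⟩ := h.exists_blocks
  rw [Qplus_apply, (ht _).1, Qplus_apply]
  simp only [map_neg, neg_neg, resF_incF, resA_incF, map_zero, neg_zero, add_zero,
    hVp.relations.2.1]

theorem P_apply (x : BVSpace ι) : S.P Vp x = x - S.Q (Qplus Vp x) - Qplus Vp (S.Q x) := rfl

theorem Q_P (h : S.IsProper) (hVp : S.IsBVPropagator Vp) (x : BVSpace ι) : S.Q (S.P Vp x) = 0 := by
  rw [P_apply, map_sub, map_sub, Q_Q h, Q_Qplus_Q h hVp, sub_zero, sub_self]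

theorem P_Q (h : S.IsProper) (hVp : S.IsBVPropagator Vp) (x : BVSpace ι) : S.P Vp (S.Q x) = 0 := by
  rw [P_apply, Q_Q h, Q_Qplus_Q h hVp, map_zero, sub_zero, sub_self]

theorem P_P (h : S.IsProper) (hVp : S.IsBVPropagator Vp) (x : BVSpace ι) :
    S.P Vp (S.P Vp x) = S.P Vp x := by
  have h1 : Qplus Vp (S.P Vp x) = 0 := by
    rw [P_apply, map_sub, map_sub, Qplus_Qplus, Qplus_Q_Qplus h hVp, sub_zero, sub_self]
  rw [P_apply (S.P Vp x), h1, Q_P h hVp, map_zero, map_zero, sub_zero, sub_zero]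

theorem P_of_mem (h : S.IsProper) (hVp : S.IsBVPropagator Vp) (x : S.Hp Vp) :
    S.P Vp x = x := by
  obtain ⟨x, y, rfl⟩ := x
  exact P_P h hVp y

theorem Q_of_mem (h : S.IsProper) (hVp : S.IsBVPropagator Vp) (x : S.Hp Vp) :
    S.Q (x : BVSpace ι) = 0 := by
  rw [← P_of_mem h hVp x, Q_P h hVp]

theorem Q_mem_grade {k : ℤ} {x : BVSpace ι} (hx : x ∈ grade d k) : S.Q x ∈ grade d (k + 1) := by
  rw [Q_apply]
  simpa using S.m_mem_grade (.cons hx .nil)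

theorem P_mem_grade (hVp : S.IsBVPropagator Vp) {k : ℤ} {x : BVSpace ι} (hx : x ∈ grade d k) :
    S.P Vp x ∈ grade d k := by
  rw [P_apply]
  have h1 := Q_mem_grade (S := S) (Qplus_mem_grade hVp hx)
  have h2 := Qplus_mem_grade hVp (Q_mem_grade (S := S) hx)
  rw [neg_add_cancel_right] at h1
  rw [add_neg_cancel_right] at h2
  exact Submodule.sub_mem _ (Submodule.sub_mem _ hx h1) h2

theorem Q_parity (x : BVSpace ι) : S.Q (parity d x) = - parity d (S.Q x) :=
  map_parity_of_odd d (by decide) (fun _ _ hx => Q_mem_grade hx) x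

theorem omega_Q (x y : BVSpace ι) : omega ι (S.Q x) y = - omega ι x (S.Q (parity d y)) := by
  have := S.m_cyclic x (parity d y) []
  rw [List.nil_append, ← Q_apply, ← Q_apply, parity_parity] at this
  rw [this, omega_skew]

theorem omega_P (hVp : S.IsBVPropagator Vp) (x y : BVSpace ι) :
    omega ι (S.P Vp x) y = omega ι x (S.P Vp y) := by
  have h1 : omega ι (S.Q (Qplus Vp x)) y = omega ι x (Qplus Vp (S.Q y)) := by
    rw [omega_Q, omega_Qplus hVp, Q_parity, map_neg, parity_parity, map_neg, map_neg, neg_neg]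
  have h2 : omega ι (Qplus Vp (S.Q x)) y = omega ι x (S.Q (Qplus Vp y)) := by
    rw [omega_Qplus hVp, omega_Q, Qplus_parity hVp, map_neg, parity_parity, map_neg, map_neg,
      neg_neg]
  simp only [P_apply, map_sub, LinearMap.sub_apply, h1, h2]
  ring

theorem iSupIndep_grade : iSupIndep (grade d) := by
  rw [iSupIndep_def]
  intro k
  have : (⨆ j, ⨆ (_ : j ≠ k), grade d j) ≤ Finsupp.supported ℂ ℂ {i | deg d i ≠ k} := by
    refine iSup₂_le fun j hj => Finsupp.supported_mono fun i hi => ?_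
    exact fun h => hj (hi.symm.trans h)
  refine Disjoint.mono_right this (Finsupp.disjoint_supported_supported ?_)
  rw [Set.disjoint_left]
  exact fun i h1 h2 => h2 h1

theorem isInternal_gradeHp (hVp : S.IsBVPropagator Vp) :
    DirectSum.IsInternal (S.gradeHp Vp) := by
  refine isInternal_comap_subtype iSupIndep_grade (S.Hp Vp) ?_
  rintro ⟨_, y, rfl⟩
  induction y using Finsupp.induction_linear with
  | zero =>
    have : (⟨S.P Vp 0, 0, rfl⟩ : S.Hp Vp) = 0 := Subtype.ext (map_zero _)
    rw [this]
    exact Submodule.zero_mem _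
  | add x y hx hy =>
    have : (⟨S.P Vp (x + y), x + y, rfl⟩ : S.Hp Vp) = ⟨S.P Vp x, x, rfl⟩ + ⟨S.P Vp y, y, rfl⟩ :=
      Subtype.ext (map_add _ _ _)
    rw [this]
    exact Submodule.add_mem _ hx hy
  | single i c =>
    exact Submodule.mem_iSup_of_mem (deg d i) (P_mem_grade hVp (single_mem_grade d i c))

theorem isOddSymplectic_omegaHp (h : S.IsProper) (hVp : S.IsBVPropagator Vp) :
    IsOddSymplectic (V := S.Hp Vp) (S.gradeHp Vp) (S.omegaHp Vp) where
  degree _ _ _ hx _ hy hpq := omega_degree d hx hy hpq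
  skew x y := omega_skew _ _
  nondegenerate x hx := by
    by_contra! hne
    refine hx (Subtype.ext (eq_zero_of_omega fun i => ?_))
    have h1 := hne ⟨S.P Vp (Finsupp.single i 1), _, rfl⟩
    change omega ι x (S.P Vp (Finsupp.single i 1)) = 0 at h1
    rw [← P_of_mem h hVp x, ← omega_P hVp, omega_skew, h1, neg_zero]

/-! ### The minimal model -/

theorem coe_mp (h : S.IsProper) (hVp : S.IsBVPropagator Vp) (xs : List (S.Hp Vp)) :
    (S.mp Vp xs : BVSpace ι) = S.P Vp (treeM S.m (Qplus Vp) (xs.map (S.Hp Vp).subtype)) := by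
  have h1 : ∀ ys : List (BVSpace ι), ∑ᶠ Γ ∈ PTree.treesWith ys.length,
      PTree.evalM S.m (Qplus Vp) Γ ys = (if ys.length = 1 then S.m ys else 0) +
        treeM S.m (Qplus Vp) ys := by
    intro ys
    rw [finsum_mem_eq_finite_toFinset_sum _ (PTree.finite_treesWith _)]
    change ∑ Γ ∈ PTree.treeFinset ys.length, _ = _
    rw [PTree.sum_treeFinset]
    congr 1
    refine Finset.sum_congr rfl fun cs _ => ?_
    simp only [higher, length_evalFs]
    rfl
  have h2 := h1 (xs.map (S.Hp Vp).subtype)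
  rw [List.length_map] at h2
  change S.P Vp (∑ᶠ Γ ∈ PTree.treesWith xs.length, _) = _
  rw [h2, map_add]
  split_ifs with hl
  · obtain ⟨x, rfl⟩ := List.length_eq_one_iff.1 hl
    rw [List.map_singleton, ← Q_apply, P_Q h hVp, zero_add]
  · rw [map_zero, zero_add]

theorem treeM_mem_grade (hVp : S.IsBVPropagator Vp) {ds : List ℤ} {xs : List (BVSpace ι)}
    (hxs : Homogeneous (grade d) ds xs) : treeM S.m (Qplus Vp) xs ∈ grade d (ds.sum + 1) :=
  treeM_mem (fun _ _ => S.m_mem_grade)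
    (fun k x hx => by simpa using Qplus_mem_grade hVp hx) hxs

end CyclicFieldTheory

end BVTree

namespace BVTree

theorem splitSum₃_eq_sum {α W : Type*} [AddCommMonoid W] (f : List α → List α → List α → W)
    (hf : ∀ A C, f A [] C = 0) (xs : List α) :
    splitSum₃ f xs = ∑ j ∈ Finset.range xs.length, ∑ l ∈ Finset.Icc 1 (xs.length - j),
      f (xs.take j) ((xs.drop j).take l) (xs.drop (j + l)) := by
  have h (j : ℕ) : splitSum (fun B C => f (xs.take j) B C) (xs.drop j) =
      ∑ l ∈ Finset.Icc 1 (xs.length - j), f (xs.take j) ((xs.drop j).take l) (xs.drop (j + l)) := by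
    rw [splitSum, Finset.sum_range_succ', List.length_drop, List.take_zero, hf, add_zero]
    simp only [List.drop_drop]
    rw [Finset.range_eq_Ico, Finset.sum_Ico_add' (fun l => f (xs.take j) ((xs.drop j).take l)
      (xs.drop (j + l))) 0 (xs.length - j) 1]
    rfl
  rw [splitSum₃, splitSum, Finset.sum_range_succ, h xs.length, Nat.sub_self,
    Finset.Icc_eq_empty_of_lt one_pos, Finset.sum_empty, add_zero]
  exact Finset.sum_congr rfl fun j _ => h j

namespace CyclicFieldTheory

variable {ι : Type*} {d : ι → ℤ} {S : CyclicFieldTheory d}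
  {Vp : FieldSpace ι →ₗ[ℂ] FieldSpace ι}

theorem homogeneous_coe {ds : List ℤ} {xs : List (S.Hp Vp)}
    (h : Homogeneous (S.gradeHp Vp) ds xs) :
    Homogeneous (grade d) ds (xs.map (S.Hp Vp).subtype) :=
  List.forall₂_map_right_iff.2 h

theorem P_relation (hBV : S.MasterEquation) (h : S.IsProper) (hVp : S.IsBVPropagator Vp)
    (xs : List (BVSpace ι)) (hxs : ∀ x ∈ xs, S.Q x = 0) :
    splitSum₃ (fun A B C => S.P Vp (treeM S.m (Qplus Vp)
      (A.map (parity d) ++ S.P Vp (treeM S.m (Qplus Vp) B) :: C))) xs = 0 := by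
  have key := treeM_relation (P := S.P Vp) S.multilinear_m S.m_nil S.m_map_parity
    (Qplus_parity hVp) (S.m_relation hBV) (fun x => by simpa only [Q_apply] using Q_Q h x)
    (fun x => by rw [P_apply, Q_apply, Q_apply]) xs
    (fun x hx => by rw [← Q_apply]; exact hxs x hx)
  have := congrArg (S.P Vp) key
  rwa [map_add, ← Q_apply, P_Q h hVp, zero_add, map_zero, map_splitSum₃] at this

theorem mp_relation (hBV : S.MasterEquation) (h : S.IsProper) (hVp : S.IsBVPropagator Vp)
    (ds : List ℤ) (xs : List (S.Hp Vp)) (hxs : Homogeneous (S.gradeHp Vp) ds xs) :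
    ∑ j ∈ Finset.range xs.length, ∑ l ∈ Finset.Icc 1 (xs.length - j),
      ((-1 : ℂ) ^ (ds.take j).sum) •
        S.mp Vp (xs.take j ++ S.mp Vp ((xs.drop j).take l) :: xs.drop (j + l)) = 0 := by
  have hT := S.multilinear_m.treeM (Qplus Vp)
  have key := P_relation hBV h hVp (xs.map (S.Hp Vp).subtype) (fun x hx => by
    obtain ⟨y, -, rfl⟩ := List.mem_map.1 hx
    exact Q_of_mem h hVp y)
  rw [splitSum₃_eq_sum _ (fun A C => by rw [treeM_nil, map_zero, hT.map_zero, map_zero])] at key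
  refine Subtype.ext ?_
  rw [ZeroMemClass.coe_zero, ← key, List.length_map, AddSubmonoidClass.coe_finsetSum]
  refine Finset.sum_congr rfl fun j _ => ?_
  rw [AddSubmonoidClass.coe_finsetSum]
  refine Finset.sum_congr rfl fun l _ => ?_
  rw [Submodule.coe_smul, coe_mp h hVp, List.map_append, List.map_cons, Submodule.subtype_apply,
    coe_mp h hVp, ← List.map_take, ← List.map_drop, ← List.map_take, ← List.map_drop,
    hT.map_parity d (homogeneous_coe (List.forall₂_take j hxs)), map_smul]

theorem isAInfinity_mp (hBV : S.MasterEquation) (h : S.IsProper) (hVp : S.IsBVPropagator Vp) :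
    IsAInfinity (V := S.Hp Vp) (S.gradeHp Vp) (S.mp Vp) where
  grading := isInternal_gradeHp hVp
  map_nil := Subtype.ext (by rw [coe_mp h hVp, List.map_nil, treeM_nil, map_zero]; rfl)
  multilinear A B := by
    have hT := S.multilinear_m.treeM (Qplus Vp) (A.map (S.Hp Vp).subtype)
      (B.map (S.Hp Vp).subtype)
    constructor
    · intro x y
      refine Subtype.ext ?_
      rw [Submodule.coe_add]
      simp only [coe_mp h hVp, List.map_append, List.map_cons, map_add, hT.map_add]
    · intro c x
      refine Subtype.ext ?_
      rw [Submodule.coe_smul]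
      simp only [coe_mp h hVp, List.map_append, List.map_cons, map_smul, hT.map_smul]
  degree_one ds xs hxs := by
    change (S.mp Vp xs : BVSpace ι) ∈ grade d (ds.sum + 1)
    rw [coe_mp h hVp]
    exact P_mem_grade hVp (treeM_mem_grade hVp (homogeneous_coe hxs))
  relation := mp_relation hBV h hVp

theorem omegaHp_mp (h : S.IsProper) (hVp : S.IsBVPropagator Vp) (x : S.Hp Vp)
    (ys : List (S.Hp Vp)) : S.omegaHp Vp x (S.mp Vp ys) =
      omega ι x (treeM S.m (Qplus Vp) (ys.map (S.Hp Vp).subtype)) := by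
  change omega ι x (S.mp Vp ys) = _
  rw [coe_mp h hVp, ← omega_P hVp, P_of_mem h hVp]

theorem isMinimalCyclicAInfinity_mp (hBV : S.MasterEquation) (h : S.IsProper)
    (hVp : S.IsBVPropagator Vp) :
    IsMinimalCyclicAInfinity (V := S.Hp Vp) (S.gradeHp Vp) (S.omegaHp Vp) (S.mp Vp) where
  toIsAInfinity := isAInfinity_mp hBV h hVp
  symplectic := isOddSymplectic_omegaHp h hVp
  cyclic d₁ d₂ ds x₁ x₂ xs hxs := by
    rcases hxs with _ | ⟨-, _ | ⟨hx₂, -⟩⟩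
    rw [omegaHp_mp h hVp, omegaHp_mp h hVp, List.map_cons, List.map_append,
      treeM_cyclic S.multilinear_m S.m_cyclic omega_skew (omega_parity d) (Qplus_parity hVp)
        (omega_Qplus hVp), Submodule.subtype_apply, parity_of_mem d (show (x₂ : BVSpace ι) ∈ grade d d₂ from hx₂),
      map_smul]
    rfl
  minimal x := Subtype.ext (by
    rw [coe_mp h hVp, List.map_singleton, treeM_singleton, map_zero]; rfl)

theorem treeCorrelation_eq (x : BVSpace ι) {ys : List (BVSpace ι)} (hys : 2 ≤ ys.length) :
    S.treeCorrelation Vp x ys = omega ι (parity d x) (treeM S.m (Qplus Vp) ys) := by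
  have h := TreeContraction.finsum_weight_mul hys fun Γ =>
    omega ι (parity d x) (PTree.evalM S.m (Qplus Vp) Γ ys)
  refine h.trans ?_
  rw [PTree.sum_treeFinset, if_neg (by omega), zero_add, treeM, forestSum, map_sum]
  refine Finset.sum_congr rfl fun cs _ => ?_
  simp only [higher, length_evalFs]
  split_ifs
  · rfl
  · rw [map_zero]

theorem onShellAmplitude_eq (h : S.IsProper) (hVp : S.IsBVPropagator Vp) {k : ℤ} {x : S.Hp Vp}
    (hx : x ∈ S.gradeHp Vp k) {ys : List (S.Hp Vp)} (hys : 2 ≤ ys.length) :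
    S.onShellAmplitude Vp x ys = (-1 : ℂ) ^ k * S.omegaHp Vp x (S.mp Vp ys) := by
  rw [onShellAmplitude, treeCorrelation_eq _ (by rwa [List.length_map]),
    parity_of_mem d (show (x : BVSpace ι) ∈ grade d k from hx),
    omegaHp_mp h hVp, map_smul]
  rfl

end CyclicFieldTheory

end BVTree

end

theorem corollary5p5 {ι : Type*} (d : ι → ℤ) (S : BVTree.CyclicFieldTheory d)
    (hBV : S.MasterEquation) (hproper : S.IsProper)
    (Vp : BVTree.FieldSpace ι →ₗ[ℂ] BVTree.FieldSpace ι) (hVp : S.IsBVPropagator Vp) :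
    (S.P Vp ∘ₗ S.P Vp = S.P Vp ∧ S.Q ∘ₗ S.P Vp = 0) ∧
    (∀ (k : ℤ) (x : S.Hp Vp) (ys : List (S.Hp Vp)), x ∈ S.gradeHp Vp k → 2 ≤ ys.length →
      S.onShellAmplitude Vp x ys = (-1 : ℂ) ^ k * S.omegaHp Vp x (S.mp Vp ys)) ∧
    BVTree.IsMinimalCyclicAInfinity (S.gradeHp Vp) (S.omegaHp Vp) (S.mp Vp) := by
  refine ⟨⟨?_, ?_⟩, ?_, ?_⟩
  · exact LinearMap.ext fun x => BVTree.CyclicFieldTheory.P_P hproper hVp x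
  · exact LinearMap.ext fun x => BVTree.CyclicFieldTheory.Q_P hproper hVp x
  · intro k x ys hx hys
    exact BVTree.CyclicFieldTheory.onShellAmplitude_eq hproper hVp hx hys
  · exact BVTree.CyclicFieldTheory.isMinimalCyclicAInfinity_mp hBV hproper hVp
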